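/- **Fundamental estimate.** *Setting.* Let $n\ge 1$ and let $W\colon\mathbb R\to[0,\infty)$ be continuous with $W^{-1}(0)=\{-1,1\}$, $W(s)\ge(|s|-1)^2$ for all $s$, and, for some $c_0\ge1$, $W(s)\le c_0W(t)+c_0$ whenever $|s|\le|t|$. Let $\mathcal A_1$ be the family of bounded open subsets of $\mathbb R^n$ with $C^1$ boundary, and write $A\subset\subset A'$ for $\overline A\subset A'$. For $\varepsilon>0$, $q\in\mathbb R$ and $\Omega$ open put $$\mathcal M^-_{\varepsilon}(u,\Omega)=\int_\Omega \frac{W(u)}{\varepsilon}-q\varepsilon|\nabla u|^2+\varepsilon^3|\nabla^2u|^2\,dx\in(-\infty,+\infty]\quad\text{if }u\in W^{2,2}(\Omega),$$ and $\mathcal M^-_\varepsilon(u,\Omega)=+\infty$ otherwise. Call $q^*>0$ a *threshold constant* if for every $q<q^*/n$: (i) $\int_R W(u)-q|\nabla u|^2+|\nabla^2u|^2\,dx\ge0$ for every open rectangle $R\subset\mathbb R^n$ with all sides of length at least $1$ and every $u\in W^{2,2}(R)$; (ii) for every $A\in\mathcal A_1$ there is $\varepsilon_0(A,q)>0$ with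 $q\varepsilon^2\int_A|\nabla u|^2\le\int_AW(u)+\varepsilon^4\int_A|\nabla^2u|^2$ for all $\varepsilon\in(0,\varepsilon_0(A,q))$ and $u\in W^{2,2}(A)$. For $0<c_1\le c_2$ and $q>0$, let $(f_\varepsilon)_{\varepsilon>0}$ be Borel functions on $\mathbb R^n\times\mathbb R\times\mathbb R^n\times\mathbb R^{n\times n}$ with $$c_1\big(W(s)-q|\xi|^2+|\zeta|^2\big)\le f_\varepsilon(x,s,\xi,\zeta)\le c_2\big(W(s)+q|\xi|^2+|\zeta|^2\big),$$ and put $\mathcal E_\varepsilon(u,\Omega)=\frac1\varepsilon\int_\Omega f_\varepsilon(x,u,\varepsilon\nabla u,\varepsilon^2\nabla^2u)\,dx$ if $u\in W^{2,2}(\Omega)$, and $\mathcal E_\varepsilon(u,\Omega)=+\infty$ otherwise. (The densities may be negative.) *Statement.* A threshold constant exists. Moreover, let $q^*$ be any threshold constant, let $0<q<q^*/n$, $0<c_1\le c_2$ and let $(f_\varepsilon)_\varepsilon$ be as above. Then there are functionals $\omega_\varepsilon(u,v,A,A')\in[0,\infty)$, $\varepsilon>0$, depending on $u$ and $v$ only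 through their a.e. classes on $A'\setminus\overline A$, such that the following holds for all $A,A',B\in\mathcal A_1$ with $A\subset\subset A'$ and $S:=A'\setminus\overline A\subset B$, and all families $(u_\varepsilon)_{\varepsilon>0}\subset W^{2,2}(A')$, $(v_\varepsilon)_{\varepsilon>0}\subset W^{2,2}(B)$. There are $\varepsilon_0>0$, depending (for given $n$, $W$, $q^*$) only on $q,A,A',B$, and $C>0$, depending (for given $n$, $q^*$) only on $c_1,c_2,W,q,A,A'$, such that: 1. For every $\varepsilon\in(0,\varepsilon_0]$ there is $w_\varepsilon\in W^{2,2}(A\cup B)$ of the form $w_\varepsilon=\varphi_\varepsilon u_\varepsilon+(1-\varphi_\varepsilon)v_\varepsilon$ a.e. in $A\cup B$, with $\varphi_\varepsilon\in C_c^\infty(A';[0,1])$ and $\varphi_\varepsilon=1$ on $A$; in particular $w_\varepsilon=u_\varepsilon$ a.e. in $A$ and $w_\varepsilon=v_\varepsilon$ a.e. in $B\setminus\overline{A'}$; and $$\mathcal E_\varepsilon(w_\varepsilon,A\cup B)\le\mathcal E_\varepsilon(u_\varepsilon,A')+\mathcal E_\varepsilon(v_\varepsilon,B)+\omega_\varepsilon(u_\varepsilon,v_\varepsilon,A,A').$$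 2. For every $\varepsilon\in(0,\varepsilon_0]$ and every measurable $\tilde S\subset S$ with $u_\varepsilon=v_\varepsilon$ a.e. on $\tilde S$, $$\omega_\varepsilon(u_\varepsilon,v_\varepsilon,A,A')\le C\mathcal L^n(S\setminus\tilde S)+C\int_{S\setminus\tilde S}|u_\varepsilon-v_\varepsilon|^2\,dx+C\varepsilon\big(\mathcal M^-_\varepsilon(u_\varepsilon,S)+\mathcal M^-_\varepsilon(v_\varepsilon,S)\big).$$ 3. If $\mathcal E_\varepsilon(u_\varepsilon,S)+\mathcal E_\varepsilon(v_\varepsilon,S)$ is bounded above uniformly for all sufficiently small $\varepsilon>0$ and $u_\varepsilon-v_\varepsilon\to0$ in $L^2(S)$ as $\varepsilon\to0$, then $\omega_\varepsilon(u_\varepsilon,v_\varepsilon,A,A')\to0$ as $\varepsilon\to0$. -/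

import Mathlib

open MeasureTheory Filter Set
open scoped Topology NNReal ENNReal ContDiff

namespace PhaseTransition

noncomputable section

/-- The Euclidean space `ℝⁿ`. -/
abbrev E (n : ℕ) := EuclideanSpace ℝ (Fin n)

/-- The space `ℝ^{n × n}` of matrices, with the Euclidean (Frobenius) norm. -/
abbrev Mat (n : ℕ) := EuclideanSpace ℝ (Fin n × Fin n)

/-- Open bounded subsets of `ℝⁿ` with `C¹` boundary (the class `𝒜₁`): near every boundary point the
set is, for a suitable unit vector `ν`, the strict subgraph in direction `ν` of a `C¹` function of
the component orthogonal to `ν`. -/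
structure IsC1Domain {n : ℕ} (A : Set (E n)) : Prop where
  isOpen : IsOpen A
  isBounded : Bornology.IsBounded A
  boundary : ∀ x ∈ frontier A, ∃ ν : E n, ‖ν‖ = 1 ∧
    ∃ γ : ((Submodule.span ℝ {ν})ᗮ : Submodule ℝ (E n)) → ℝ, ContDiff ℝ 1 γ ∧
      ∃ r : ℝ, 0 < r ∧ ∀ y ∈ Metric.ball x r,
        (y ∈ A ↔ inner ℝ ν y < γ ((Submodule.span ℝ {ν})ᗮ.orthogonalProjectionOnto y))

/-- Open rectangles, of arbitrary orientation, all of whose sides have length at least one. -/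
def IsLargeRectangle {n : ℕ} (R : Set (E n)) : Prop :=
  ∃ (e : E n ≃ₗᵢ[ℝ] E n) (a b : Fin n → ℝ), (∀ i, a i + 1 ≤ b i) ∧
    R = e '' {y : E n | ∀ i, a i < y i ∧ y i < b i}

/-- `g` is the weak `i`-th partial derivative of `u` in `Ω`. -/
def IsWeakPartial {n : ℕ} (Ω : Set (E n)) (i : Fin n) (u g : E n → ℝ) : Prop :=
  ∀ φ : E n → ℝ, ContDiff ℝ ∞ φ → HasCompactSupport φ → tsupport φ ⊆ Ω →
    ∫ x in Ω, u x * fderiv ℝ φ x (EuclideanSpace.single i (1 : ℝ)) = - ∫ x in Ω, g x * φ x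

/-- `u ∈ W^{2,2}(Ω)`, with weak gradient `G` and weak Hessian `H`. -/
structure IsW22With {n : ℕ} (Ω : Set (E n)) (u : E n → ℝ) (G : E n → E n) (H : E n → Mat n) :
    Prop where
  memLp : MemLp u 2 (volume.restrict Ω)
  memLp_grad : MemLp G 2 (volume.restrict Ω)
  memLp_hess : MemLp H 2 (volume.restrict Ω)
  grad : ∀ i, IsWeakPartial Ω i u (fun x => G x i)
  hess : ∀ i j, IsWeakPartial Ω j (fun x => G x i) (fun x => H x (i, j))

/-- `u ∈ W^{2,2}(Ω)`; only the values of `u` on `Ω` matter. -/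
def MemW22 {n : ℕ} (Ω : Set (E n)) (u : E n → ℝ) : Prop :=
  ∃ (G : E n → E n) (H : E n → Mat n), IsW22With Ω u G H

open Classical in
/-- The weak gradient of `u` in `Ω` (zero if `u ∉ W^{2,2}(Ω)`). -/
def weakGrad {n : ℕ} (Ω : Set (E n)) (u : E n → ℝ) : E n → E n :=
  if h : MemW22 Ω u then h.choose else 0

open Classical in
/-- The weak Hessian of `u` in `Ω` (zero if `u ∉ W^{2,2}(Ω)`). -/
def weakHess {n : ℕ} (Ω : Set (E n)) (u : E n → ℝ) : E n → Mat n :=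
  if h : MemW22 Ω u then h.choose_spec.choose else 0

/-- The weak gradient and the weak Hessian have the defining property. -/
theorem isW22With_weakGrad_weakHess {n : ℕ} {Ω : Set (E n)} {u : E n → ℝ} (h : MemW22 Ω u) :
    IsW22With Ω u (weakGrad Ω u) (weakHess Ω u) := by
  simp only [weakGrad, weakHess, h, dif_pos]
  exact h.choose_spec.choose_spec

/-- The integral `∫_Ω g dx` with values in `[-∞, +∞]`, as the difference of the integrals of the
positive and of the negative part. It is used only for `g` with integrable negative part. -/
def extInt {n : ℕ} (Ω : Set (E n)) (g : E n → ℝ) : EReal :=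
  ((∫⁻ x in Ω, ENNReal.ofReal (g x) : ℝ≥0∞) : EReal) -
    ((∫⁻ x in Ω, ENNReal.ofReal (-g x) : ℝ≥0∞) : EReal)

/-- Double well potentials. -/
structure IsDoubleWell (W : ℝ → ℝ) : Prop where
  nonneg : ∀ s, 0 ≤ W s
  continuous : Continuous W
  zero_iff : ∀ s, W s = 0 ↔ s = -1 ∨ s = 1
  lower : ∀ s, (|s| - 1) ^ 2 ≤ W s
  almost_mono : ∃ c₀ : ℝ, 1 ≤ c₀ ∧ ∀ s t : ℝ, |s| ≤ |t| → W s ≤ c₀ * W t + c₀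

/-- The class `𝓕(W, c₁, c₂, q)` of energy densities. -/
structure IsDensity {n : ℕ} (W : ℝ → ℝ) (c₁ c₂ q : ℝ)
    (f : E n → ℝ → E n → Mat n → ℝ) : Prop where
  measurable : Measurable fun p : E n × ℝ × E n × Mat n => f p.1 p.2.1 p.2.2.1 p.2.2.2
  lower : ∀ x s ξ ζ, c₁ * (W s - q * ‖ξ‖ ^ 2 + ‖ζ‖ ^ 2) ≤ f x s ξ ζ
  upper : ∀ x s ξ ζ, f x s ξ ζ ≤ c₂ * (W s + q * ‖ξ‖ ^ 2 + ‖ζ‖ ^ 2)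

open Classical in
/-- The energy `𝓔_ε(u, Ω) = (1/ε) ∫_Ω f(x, u, ε∇u, ε²∇²u) dx` if `u ∈ W^{2,2}(Ω)`, and `+∞`
otherwise. -/
def energy {n : ℕ} (f : E n → ℝ → E n → Mat n → ℝ) (ε : ℝ) (u : E n → ℝ) (Ω : Set (E n)) :
    EReal :=
  if MemW22 Ω u then
    ((1 / ε : ℝ) : EReal) *
      extInt Ω (fun x => f x (u x) (ε • weakGrad Ω u x) (ε ^ 2 • weakHess Ω u x))
  else ⊤

open Classical in
/-- The functional `𝓜⁻_ε(u, Ω) = ∫_Ω W(u)/ε - q ε |∇u|² + ε³ |∇²u|² dx` if `u ∈ W^{2,2}(Ω)`, and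
`+∞` otherwise. -/
def Mminus {n : ℕ} (W : ℝ → ℝ) (q ε : ℝ) (u : E n → ℝ) (Ω : Set (E n)) : EReal :=
  if MemW22 Ω u then
    extInt Ω (fun x => W (u x) / ε - q * ε * ‖weakGrad Ω u x‖ ^ 2
      + ε ^ 3 * ‖weakHess Ω u x‖ ^ 2)
  else ⊤

/-- `qs` is an admissible threshold constant (`q^*`) for `W` in dimension `n`: for every
`q < qs / n`, the functional `∫_R W(u) - q|∇u|² + |∇²u|²` is nonnegative on `W^{2,2}(R)` for all
large rectangles `R`, and for each bounded `C¹` domain `A` there is `ε₀ = ε₀(A, q) > 0` with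
`q ε² ∫_A |∇u|² ≤ ∫_A W(u) + ε⁴ ∫_A |∇²u|²` for all `ε ∈ (0, ε₀)` and `u ∈ W^{2,2}(A)`
(the last inequality is divided by `ε` here). -/
structure IsThreshold (n : ℕ) (W : ℝ → ℝ) (qs : ℝ) : Prop where
  pos : 0 < qs
  rectangle : ∀ q : ℝ, q < qs / n → ∀ R : Set (E n), IsLargeRectangle R →
    ∀ u : E n → ℝ, MemW22 R u → 0 ≤ Mminus W q 1 u R
  domain : ∀ q : ℝ, q < qs / n → ∀ A : Set (E n), IsC1Domain A →
    ∃ ε₀ : ℝ, 0 < ε₀ ∧ ∀ ε : ℝ, 0 < ε → ε < ε₀ →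
      ∀ u : E n → ℝ, MemW22 A u → 0 ≤ Mminus W q ε u A

/-- `w` is a cut-off interpolation on `A ∪ B` between `u` (on `A'`) and `v` (on `B`):
`w = φ u + (1 - φ) v` with a smooth cut-off function `φ` between `A` and `A'`. -/
def IsCutoffInterpolation {n : ℕ} (A A' B : Set (E n)) (u v w : E n → ℝ) : Prop :=
  ∃ φ : E n → ℝ, ContDiff ℝ ∞ φ ∧ HasCompactSupport φ ∧ tsupport φ ⊆ A' ∧
    (∀ x, 0 ≤ φ x ∧ φ x ≤ 1) ∧ (∀ x ∈ A, φ x = 1) ∧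
    ∀ᵐ x ∂(volume.restrict (A ∪ B)), w x = φ x * u x + (1 - φ x) * v x

end

end PhaseTransition

open PhaseTransition

/-! The interpolation is De Giorgi's slicing argument. Since the densities may be negative,
discarding a piece of energy is not free, and the threshold inequality has to pay for it.

Let `η` be a smooth profile with `η > 3/4` on `closure A` and `η < 1/4` off `A'`. For a level `t`,
the cut-off rises from 0 to 1 in the layer `t ≤ η ≤ t + ε`, so that `w = v` below the layer and `w =
u` above it. Compared with the energies of `u` on `A'` and of `v` on `B`, what is thrown away is `u`
on `A' ∩ {η < t}` and `v` on `B ∩ {t < η}`. For a regular value `t` both sets are `C¹` domains, so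
the threshold inequality makes the discarded energies nonnegative for small `ε`
(`IsProfile.integral_interp_le`). What remains is an integral of `layerPot` over the layer.
Averaging over levels yields a `t` for which it is at most `8 ε` times the integral over `S = A' \
closure A`, and the factor `ε` cancels the `1 / ε` of the energy (`IsProfile.exists_interp`). Hence
the error is a constant times `layerInt`.

Two uniformity problems arise. Almost every level must be regular: a small linear tilt makes all
relevant critical points of `η` nondegenerate, hence countable (`exists_isProfile`). And the
admissible `ε` depends on `t`, while `t` is selected depending on `ε`, `u`, `v`: the sets
`goodLevels` grow to all regular levels as `δ` decreases to 0, so one `δ` serves a set of levels of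
measure more than `1/8`, and the averaging uses only those (`IsProfile.exists_goodLevels`).

For the error bounds, take `q < q' < qs / n`. Nonnegativity on `S` with `q'` makes the functional
with `q` coercive, so it controls the integral of `pot` (`integral_pot_le`). The potential between
the values of `u` and `v` is bounded by the growth condition, or by a small constant plus a multiple
of `W(u) + W(v) + |u - v|²` because `W` is small near its wells (`IsDoubleWell.exists_hullPot_le`).

A threshold constant exists by a one-dimensional inequality: a function with large initial slope and
small second derivative cannot stay near `±1` (`sq_slope_le_lintegral`). It is integrated along
segments in the domain. Every point of a large rectangle or of a `C¹` domain is the vertex of a fan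
of such segments, with enough directions to recover the full gradient (`HasFans.lintegral_grad_le`).
-/

namespace PhaseTransition

/-! ### Partial derivatives of smooth functions -/

/-- The `i`-th partial derivative. -/
noncomputable def partialDeriv {n : ℕ} (i : Fin n) (φ : E n → ℝ) (x : E n) : ℝ :=
  fderiv ℝ φ x (EuclideanSpace.single i (1 : ℝ))

theorem contDiff_partialDeriv {n : ℕ} {φ : E n → ℝ} (hφ : ContDiff ℝ ∞ φ) (i : Fin n) :
    ContDiff ℝ ∞ (partialDeriv i φ) :=
  (hφ.fderiv_right (m := ∞) (by simp)).clm_apply contDiff_const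

theorem partialDeriv_eq_zero {n : ℕ} {φ : E n → ℝ} {x : E n} (hx : x ∉ tsupport φ) (i : Fin n) :
    partialDeriv i φ x = 0 := by
  have : fderiv ℝ φ x = 0 := by
    by_contra h
    exact hx (support_fderiv_subset ℝ h)
  simp [partialDeriv, this]

theorem tsupport_partialDeriv_subset {n : ℕ} (φ : E n → ℝ) (i : Fin n) :
    tsupport (partialDeriv i φ) ⊆ tsupport φ := by
  refine closure_minimal (fun x hx => ?_) (isClosed_tsupport φ)
  by_contra h
  exact hx (partialDeriv_eq_zero h i)

theorem partialDeriv_mul {n : ℕ} {φ ψ : E n → ℝ} (hφ : ContDiff ℝ ∞ φ) (hψ : ContDiff ℝ ∞ ψ)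
    (i : Fin n) (x : E n) :
    partialDeriv i (fun y => φ y * ψ y) x
      = φ x * partialDeriv i ψ x + ψ x * partialDeriv i φ x := by
  have h1 := hφ.differentiable (by simp) x
  have h2 := hψ.differentiable (by simp) x
  simp [partialDeriv, fderiv_fun_mul h1 h2]

/-! ### Weak derivatives -/

theorem setIntegral_eq_integral_of_tsupport_subset {n : ℕ} {Ω : Set (E n)} {g φ : E n → ℝ}
    (h : tsupport φ ⊆ Ω) : ∫ x in Ω, g x * φ x = ∫ x, g x * φ x := by
  refine setIntegral_eq_integral_of_forall_compl_eq_zero fun x hx => ?_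
  rw [image_eq_zero_of_notMem_tsupport fun h' => hx (h h'), mul_zero]

theorem isWeakPartial_iff {n : ℕ} {Ω : Set (E n)} {i : Fin n} {u g : E n → ℝ} :
    IsWeakPartial Ω i u g ↔ ∀ φ : E n → ℝ, ContDiff ℝ ∞ φ → HasCompactSupport φ →
      tsupport φ ⊆ Ω → ∫ x, u x * partialDeriv i φ x = - ∫ x, g x * φ x := by
  refine forall_congr' fun φ => forall_congr' fun _ => forall_congr' fun _ => forall_congr' fun h => ?_
  rw [setIntegral_eq_integral_of_tsupport_subset h]
  have := setIntegral_eq_integral_of_tsupport_subset (g := u)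
    ((tsupport_partialDeriv_subset φ i).trans h)
  rw [← this]
  rfl

theorem IsWeakPartial.mono {n : ℕ} {Ω Ω' : Set (E n)} {i : Fin n} {u g : E n → ℝ}
    (h : IsWeakPartial Ω i u g) (hs : Ω' ⊆ Ω) : IsWeakPartial Ω' i u g := by
  rw [isWeakPartial_iff] at h ⊢
  exact fun φ h1 h2 h3 => h φ h1 h2 (h3.trans hs)

theorem IsWeakPartial.congr {n : ℕ} {Ω : Set (E n)} {i : Fin n} {u u' g g' : E n → ℝ}
    (h : IsWeakPartial Ω i u g) (hu : u =ᵐ[volume.restrict Ω] u')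
    (hg : g =ᵐ[volume.restrict Ω] g') : IsWeakPartial Ω i u' g' := by
  intro φ h1 h2 h3
  have e1 : ∫ x in Ω, u' x * fderiv ℝ φ x (EuclideanSpace.single i (1 : ℝ))
      = ∫ x in Ω, u x * fderiv ℝ φ x (EuclideanSpace.single i (1 : ℝ)) :=
    integral_congr_ae (by filter_upwards [hu] with x hx; rw [hx])
  have e2 : ∫ x in Ω, g' x * φ x = ∫ x in Ω, g x * φ x :=
    integral_congr_ae (by filter_upwards [hg] with x hx; rw [hx])
  rw [e1, e2]
  exact h φ h1 h2 h3

theorem integrable_mul_of_tsupport_subset {n : ℕ} {Ω : Set (E n)}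
    {u φ : E n → ℝ} (hu : MemLp u 2 (volume.restrict Ω)) (hφ : Continuous φ)
    (hc : HasCompactSupport φ) (hs : tsupport φ ⊆ Ω) : Integrable fun x => u x * φ x := by
  have h1 : MemLp φ 2 (volume.restrict Ω) :=
    (hφ.memLp_of_hasCompactSupport hc).restrict Ω
  have h2 : IntegrableOn (fun x => u x * φ x) Ω := hu.integrable_mul h1
  refine (integrableOn_iff_integrable_of_support_subset fun x hx => ?_).1 h2
  refine hs (subset_tsupport _ fun h => hx ?_)
  simp [h]

theorem isWeakPartial_ae_unique {n : ℕ} {Ω : Set (E n)} (hΩ : IsOpen Ω) {i : Fin n}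
    {u g g' : E n → ℝ} (h : IsWeakPartial Ω i u g) (h' : IsWeakPartial Ω i u g')
    (hg : MemLp g 2 (volume.restrict Ω)) (hg' : MemLp g' 2 (volume.restrict Ω)) :
    g =ᵐ[volume.restrict Ω] g' := by
  rw [isWeakPartial_iff] at h h'
  have hd : MemLp (fun x => g x - g' x) 2 (volume.restrict Ω) := hg.sub hg'
  have hloc : LocallyIntegrableOn (fun x => g x - g' x) Ω := by
    rw [locallyIntegrableOn_iff hΩ.isLocallyClosed]
    intro K hK hKc
    have : MemLp (fun x => g x - g' x) 2 (volume.restrict K) :=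
      hd.mono_measure (Measure.restrict_mono hK le_rfl)
    have : IsFiniteMeasure (volume.restrict K) := ⟨by simpa using hKc.measure_lt_top⟩
    exact MemLp.integrable (q := 2) (by norm_num) (by assumption)
  have key := hΩ.ae_eq_zero_of_integral_contDiff_smul_eq_zero hloc (fun φ h1 h2 h3 => by
    have i1 := integrable_mul_of_tsupport_subset hg h1.continuous h2 h3
    have i2 := integrable_mul_of_tsupport_subset hg' h1.continuous h2 h3
    have : ∫ x, φ x • (g x - g' x) = ∫ x, (g x * φ x - g' x * φ x) := by
      congr 1; ext x; simp; ring
    rw [this, integral_sub i1 i2]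
    linarith [h φ h1 h2 h3, h' φ h1 h2 h3])
  rw [EventuallyEq, ae_restrict_iff' hΩ.measurableSet]
  filter_upwards [key] with x hx hxΩ
  linarith [hx hxΩ]

/-- If `φ` is a test function in `Ω`, then `θ φ` is one in `Ω₁`, because the two supports meet only
inside `Ω₁`; the Leibniz rule does the rest. Letting the domain change makes it possible to glue
functions living on different sets. -/
theorem isWeakPartial_mul {n : ℕ} {Ω Ω₁ : Set (E n)} {i : Fin n}
    {u g θ : E n → ℝ} (h : IsWeakPartial Ω₁ i u g)
    (hu : MemLp u 2 (volume.restrict Ω₁)) (hg : MemLp g 2 (volume.restrict Ω₁))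
    (hθ : ContDiff ℝ ∞ θ) (hs : tsupport θ ∩ Ω ⊆ Ω₁) :
    IsWeakPartial Ω i (fun x => θ x * u x) (fun x => θ x * g x + u x * partialDeriv i θ x) := by
  rw [isWeakPartial_iff] at h ⊢
  intro φ h1 h2 h3
  have hsub : tsupport θ ∩ tsupport φ ⊆ Ω₁ := fun x hx => hs ⟨hx.1, h3 hx.2⟩
  have sup : ∀ a b : E n → ℝ, tsupport a ⊆ tsupport θ → tsupport b ⊆ tsupport φ →
      tsupport (fun x => a x * b x) ⊆ Ω₁ := fun a b ha hb x hx =>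
    hsub ⟨ha (tsupport_mul_subset_left hx), hb (tsupport_mul_subset_right hx)⟩
  have hd := contDiff_partialDeriv h1 i
  have hdθ := contDiff_partialDeriv hθ i
  have hdc : HasCompactSupport (partialDeriv i φ) :=
    h2.mono' ((subset_tsupport _).trans (tsupport_partialDeriv_subset φ i))
  have e := h (fun x => θ x * φ x) (hθ.mul h1) h2.mul_left (sup θ φ subset_rfl subset_rfl)
  have i1 := integrable_mul_of_tsupport_subset hu (hθ.mul hd).continuous hdc.mul_left
    (sup _ _ subset_rfl (tsupport_partialDeriv_subset φ i))
  have i2 := integrable_mul_of_tsupport_subset hu (hdθ.mul h1).continuous h2.mul_left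
    (sup _ _ (tsupport_partialDeriv_subset θ i) subset_rfl)
  have i3 := integrable_mul_of_tsupport_subset hg (hθ.mul h1).continuous h2.mul_left
    (sup θ φ subset_rfl subset_rfl)
  have e1 : ∫ x, u x * partialDeriv i (fun y => θ y * φ y) x
      = (∫ x, u x * (θ x * partialDeriv i φ x)) + ∫ x, u x * (partialDeriv i θ x * φ x) := by
    rw [← integral_add i1 i2]
    congr 1; ext x
    rw [partialDeriv_mul hθ h1]; ring
  have e2 : ∫ x, (θ x * g x + u x * partialDeriv i θ x) * φ x
      = (∫ x, g x * (θ x * φ x)) + ∫ x, u x * (partialDeriv i θ x * φ x) := by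
    rw [← integral_add i3 i2]
    congr 1; ext x; ring
  have e3 : ∫ x, θ x * u x * partialDeriv i φ x = ∫ x, u x * (θ x * partialDeriv i φ x) := by
    congr 1; ext x; ring
  rw [e2, e3]
  linarith

theorem IsWeakPartial.add {n : ℕ} {Ω : Set (E n)} {i : Fin n}
    {u v g h : E n → ℝ} (hug : IsWeakPartial Ω i u g) (hvh : IsWeakPartial Ω i v h)
    (hu : MemLp u 2 (volume.restrict Ω)) (hg : MemLp g 2 (volume.restrict Ω))
    (hv : MemLp v 2 (volume.restrict Ω)) (hh : MemLp h 2 (volume.restrict Ω)) :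
    IsWeakPartial Ω i (fun x => u x + v x) (fun x => g x + h x) := by
  rw [isWeakPartial_iff] at hug hvh ⊢
  intro φ h1 h2 h3
  have hd := contDiff_partialDeriv h1 i
  have hdc : HasCompactSupport (partialDeriv i φ) :=
    h2.mono' ((subset_tsupport _).trans (tsupport_partialDeriv_subset φ i))
  have hds := (tsupport_partialDeriv_subset φ i).trans h3
  simp_rw [add_mul]
  rw [integral_add (integrable_mul_of_tsupport_subset hu hd.continuous hdc hds)
      (integrable_mul_of_tsupport_subset hv hd.continuous hdc hds),
    integral_add (integrable_mul_of_tsupport_subset hg h1.continuous h2 h3)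
      (integrable_mul_of_tsupport_subset hh h1.continuous h2 h3),
    hug φ h1 h2 h3, hvh φ h1 h2 h3]
  ring

/-! ### The space `W^{2,2}` -/

theorem IsW22With.mono {n : ℕ} {Ω Ω' : Set (E n)} {u : E n → ℝ} {G : E n → E n}
    {H : E n → Mat n} (h : IsW22With Ω u G H) (hs : Ω' ⊆ Ω) : IsW22With Ω' u G H where
  memLp := h.memLp.mono_measure (Measure.restrict_mono hs le_rfl)
  memLp_grad := h.memLp_grad.mono_measure (Measure.restrict_mono hs le_rfl)
  memLp_hess := h.memLp_hess.mono_measure (Measure.restrict_mono hs le_rfl)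
  grad i := (h.grad i).mono hs
  hess i j := (h.hess i j).mono hs

theorem IsW22With.congr {n : ℕ} {Ω : Set (E n)} {u u' : E n → ℝ} {G : E n → E n}
    {H : E n → Mat n} (h : IsW22With Ω u G H) (hu : u =ᵐ[volume.restrict Ω] u') :
    IsW22With Ω u' G H where
  memLp := (memLp_congr_ae hu).1 h.memLp
  memLp_grad := h.memLp_grad
  memLp_hess := h.memLp_hess
  grad i := (h.grad i).congr hu ae_eq_rfl
  hess := h.hess

theorem IsW22With.memW22 {n : ℕ} {Ω : Set (E n)} {u : E n → ℝ} {G : E n → E n}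
    {H : E n → Mat n} (h : IsW22With Ω u G H) : MemW22 Ω u := ⟨G, H, h⟩

theorem IsW22With.ae_unique {n : ℕ} {Ω : Set (E n)} (hΩ : IsOpen Ω) {u : E n → ℝ}
    {G G' : E n → E n} {H H' : E n → Mat n} (h : IsW22With Ω u G H) (h' : IsW22With Ω u G' H') :
    G =ᵐ[volume.restrict Ω] G' ∧ H =ᵐ[volume.restrict Ω] H' := by
  have hG : ∀ i, (fun x => G x i) =ᵐ[volume.restrict Ω] fun x => G' x i := fun i =>
    isWeakPartial_ae_unique hΩ (h.grad i) (h'.grad i) (h.memLp_grad.eval_piLp i)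
      (h'.memLp_grad.eval_piLp i)
  have hH : ∀ p, (fun x => H x p) =ᵐ[volume.restrict Ω] fun x => H' x p := fun p =>
    isWeakPartial_ae_unique hΩ (h.hess p.1 p.2) ((h'.hess p.1 p.2).congr (hG p.1).symm ae_eq_rfl)
      (h.memLp_hess.eval_piLp p) (h'.memLp_hess.eval_piLp p)
  constructor
  · filter_upwards [ae_all_iff.2 hG] with x hx
    ext i; exact hx i
  · filter_upwards [ae_all_iff.2 hH] with x hx
    ext i; exact hx i

theorem IsW22With.weakGrad_ae_eq {n : ℕ} {Ω : Set (E n)} (hΩ : IsOpen Ω) {u : E n → ℝ}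
    {G : E n → E n} {H : E n → Mat n} (h : IsW22With Ω u G H) :
    weakGrad Ω u =ᵐ[volume.restrict Ω] G ∧ weakHess Ω u =ᵐ[volume.restrict Ω] H :=
  (isW22With_weakGrad_weakHess h.memW22).ae_unique hΩ h

/-- On `Ω` the product agrees with its extension by zero from `Ω₁`, so the arbitrary values of `g`
outside `Ω₁` play no role. -/
theorem _root_.MeasureTheory.MemLp.mul_of_eq_zero_diff {n : ℕ} {Ω Ω₁ : Set (E n)} (hΩ : IsOpen Ω) (hΩ₁ : IsOpen Ω₁)
    {g ψ : E n → ℝ} (hg : MemLp g 2 (volume.restrict Ω₁)) (hψ : Continuous ψ) {K : ℝ}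
    (hK : ∀ x, |ψ x| ≤ K) (h0 : ∀ x ∈ Ω, x ∉ Ω₁ → ψ x = 0) :
    MemLp (fun x => ψ x * g x) 2 (volume.restrict Ω) := by
  have h1 : MemLp (fun x => ψ x * g x) 2 (volume.restrict Ω₁) := by
    refine hg.of_le_mul (c := K) (hψ.aestronglyMeasurable.mul hg.1) (Eventually.of_forall fun x => ?_)
    rw [norm_mul]
    exact mul_le_mul_of_nonneg_right (hK x) (norm_nonneg _)
  have h2 := ((memLp_indicator_iff_restrict hΩ₁.measurableSet).2 h1).restrict Ω
  refine (memLp_congr_ae ?_).1 h2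
  rw [EventuallyEq, ae_restrict_iff' hΩ.measurableSet]
  refine Eventually.of_forall fun x hx => ?_
  by_cases hx1 : x ∈ Ω₁
  · simp [hx1]
  · simp [hx1, h0 x hx hx1]

/-- The gradient of a product, in coordinates. -/
noncomputable def mulGrad {n : ℕ} (θ u : E n → ℝ) (G : E n → E n) (x : E n) : E n :=
  WithLp.toLp 2 fun i => θ x * G x i + u x * partialDeriv i θ x

/-- The Hessian of a product, in coordinates. -/
noncomputable def mulHess {n : ℕ} (θ u : E n → ℝ) (G : E n → E n) (H : E n → Mat n) (x : E n) :
    Mat n :=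
  WithLp.toLp 2 fun p => (θ x * H x p + G x p.1 * partialDeriv p.2 θ x) +
    (partialDeriv p.1 θ x * G x p.2 + u x * partialDeriv p.2 (partialDeriv p.1 θ) x)

/-- Meant for `Ω = A ∪ B`, with `Ω₁ = A'` for the part `φ u` and `Ω₁ = B` for the part `(1 - φ) v`
of the interpolation. -/
theorem IsW22With.mul {n : ℕ} {Ω Ω₁ : Set (E n)} (hΩ : IsOpen Ω) (hΩ₁ : IsOpen Ω₁)
    {u θ : E n → ℝ} {G : E n → E n} {H : E n → Mat n} (h : IsW22With Ω₁ u G H)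
    (hθ : ContDiff ℝ ∞ θ) (hs : tsupport θ ∩ Ω ⊆ Ω₁) {K : ℝ} (hK0 : ∀ x, |θ x| ≤ K)
    (hK1 : ∀ i x, |partialDeriv i θ x| ≤ K)
    (hK2 : ∀ i j x, |partialDeriv j (partialDeriv i θ) x| ≤ K) :
    IsW22With Ω (fun x => θ x * u x) (mulGrad θ u G) (mulHess θ u G H) := by
  have z0 : ∀ x ∈ Ω, x ∉ Ω₁ → x ∉ tsupport θ := fun x hx hx1 h' => hx1 (hs ⟨h', hx⟩)
  have hd := fun i => contDiff_partialDeriv hθ i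
  have hdd := fun i j => contDiff_partialDeriv (hd i) j
  have hts := fun i => tsupport_partialDeriv_subset θ i
  have hG := fun i => h.memLp_grad.eval_piLp i
  have hH := fun p => h.memLp_hess.eval_piLp p
  have m0 : ∀ g : E n → ℝ, MemLp g 2 (volume.restrict Ω₁) →
      MemLp (fun x => θ x * g x) 2 (volume.restrict Ω) := fun g hg =>
    MemLp.mul_of_eq_zero_diff hΩ hΩ₁ hg hθ.continuous hK0
      fun x hx hx1 => image_eq_zero_of_notMem_tsupport (z0 x hx hx1)
  have m1 : ∀ i, ∀ g : E n → ℝ, MemLp g 2 (volume.restrict Ω₁) →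
      MemLp (fun x => partialDeriv i θ x * g x) 2 (volume.restrict Ω) := fun i g hg =>
    MemLp.mul_of_eq_zero_diff hΩ hΩ₁ hg (hd i).continuous (hK1 i)
      fun x hx hx1 => partialDeriv_eq_zero (z0 x hx hx1) i
  have m2 : ∀ i j, MemLp (fun x => partialDeriv j (partialDeriv i θ) x * u x) 2
      (volume.restrict Ω) := fun i j =>
    MemLp.mul_of_eq_zero_diff hΩ hΩ₁ h.memLp (hdd i j).continuous (hK2 i j)
      fun x hx hx1 => partialDeriv_eq_zero (fun h' => z0 x hx hx1 (hts i h')) j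
  have m1' : ∀ i, ∀ g : E n → ℝ, MemLp g 2 (volume.restrict Ω₁) →
      MemLp (fun x => g x * partialDeriv i θ x) 2 (volume.restrict Ω) := fun i g hg => by
    simpa only [mul_comm] using m1 i g hg
  have m2' : ∀ i j, MemLp (fun x => u x * partialDeriv j (partialDeriv i θ) x) 2
      (volume.restrict Ω) := fun i j => by simpa only [mul_comm] using m2 i j
  refine ⟨m0 u h.memLp, ?_, ?_, fun i => ?_, fun i j => ?_⟩
  · exact memLp_piLp_iff.2 fun i => (m0 _ (hG i)).add (m1' i _ h.memLp)
  · exact memLp_piLp_iff.2 fun p =>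
      ((m0 _ (hH p)).add (m1' p.2 _ (hG p.1))).add ((m1 p.1 _ (hG p.2)).add (m2' p.1 p.2))
  · exact isWeakPartial_mul (h.grad i) h.memLp (hG i) hθ hs
  · have w1 := isWeakPartial_mul (h.hess i j) (hG i) (hH (i, j)) hθ hs
    have w2 := isWeakPartial_mul (Ω := Ω) (h.grad j) h.memLp (hG j) (hd i)
      (fun x hx => hs ⟨hts i hx.1, hx.2⟩)
    have w := w1.add w2 (m0 _ (hG i))
      ((m0 _ (hH (i, j))).add (m1' j _ (hG i)))
      (m1 i _ h.memLp) ((m1 i _ (hG j)).add (m2' i j))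
    refine w.congr ?_ ae_eq_rfl
    exact Eventually.of_forall fun x => by simp [mulGrad, mul_comm]

theorem IsW22With.add {n : ℕ} {Ω : Set (E n)} {u v : E n → ℝ}
    {G G' : E n → E n} {H H' : E n → Mat n} (h : IsW22With Ω u G H) (h' : IsW22With Ω v G' H') :
    IsW22With Ω (fun x => u x + v x) (fun x => G x + G' x) (fun x => H x + H' x) where
  memLp := h.memLp.add h'.memLp
  memLp_grad := h.memLp_grad.add h'.memLp_grad
  memLp_hess := h.memLp_hess.add h'.memLp_hess
  grad i := (h.grad i).add (h'.grad i) h.memLp (h.memLp_grad.eval_piLp i) h'.memLp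
    (h'.memLp_grad.eval_piLp i)
  hess i j := (h.hess i j).add (h'.hess i j) (h.memLp_grad.eval_piLp i)
    (h.memLp_hess.eval_piLp _) (h'.memLp_grad.eval_piLp i) (h'.memLp_hess.eval_piLp _)

/-! ### Extended integrals -/

theorem extInt_congr {n : ℕ} {Ω : Set (E n)} {g g' : E n → ℝ}
    (h : g =ᵐ[volume.restrict Ω] g') : extInt Ω g = extInt Ω g' := by
  have h1 : ∫⁻ x in Ω, ENNReal.ofReal (g x) = ∫⁻ x in Ω, ENNReal.ofReal (g' x) :=
    lintegral_congr_ae (h.mono fun x hx => by simp only [hx])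
  have h2 : ∫⁻ x in Ω, ENNReal.ofReal (-g x) = ∫⁻ x in Ω, ENNReal.ofReal (-g' x) :=
    lintegral_congr_ae (h.mono fun x hx => by simp only [hx])
  rw [extInt, extInt, h1, h2]

theorem extInt_of_integrable {n : ℕ} {Ω : Set (E n)} {g : E n → ℝ}
    (h : Integrable g (volume.restrict Ω)) : extInt Ω g = ((∫ x in Ω, g x : ℝ) : EReal) := by
  have h1 : ∫⁻ x in Ω, ENNReal.ofReal (g x) ≠ ⊤ := h.lintegral_lt_top.ne
  have h2 : ∫⁻ x in Ω, ENNReal.ofReal (-g x) ≠ ⊤ := h.neg.lintegral_lt_top.ne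
  rw [extInt, integral_eq_lintegral_pos_part_sub_lintegral_neg_part h, EReal.coe_sub,
    EReal.coe_ennreal_toReal h1, EReal.coe_ennreal_toReal h2]

/-- The integrable minorant keeps the negative part finite, so non-integrability can only come from
the positive part and `∞ - ∞` never occurs. -/
theorem extInt_eq_top {n : ℕ} {Ω : Set (E n)} {g b : E n → ℝ}
    (hm : AEStronglyMeasurable g (volume.restrict Ω)) (hb : Integrable b (volume.restrict Ω))
    (hgb : ∀ x, b x ≤ g x) (h : ¬ Integrable g (volume.restrict Ω)) : extInt Ω g = ⊤ := by
  have h2 : ∫⁻ x in Ω, ENNReal.ofReal (-g x) ≠ ⊤ := by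
    refine ne_top_of_le_ne_top hb.neg.lintegral_lt_top.ne (lintegral_mono fun x => ?_)
    exact ENNReal.ofReal_le_ofReal (neg_le_neg (hgb x))
  have h1 : ∫⁻ x in Ω, ENNReal.ofReal (g x) = ⊤ := by
    by_contra h1
    refine h ⟨hm, ?_⟩
    rw [hasFiniteIntegral_iff_norm]
    calc ∫⁻ x in Ω, ENNReal.ofReal ‖g x‖
        ≤ ∫⁻ x in Ω, (ENNReal.ofReal (g x) + ENNReal.ofReal (-g x)) := by
          refine lintegral_mono fun x => ?_
          rcases le_total 0 (g x) with hx | hx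
          · simp [Real.norm_of_nonneg hx]
          · simp [Real.norm_of_nonpos hx]
      _ = _ := lintegral_add_left' hm.aemeasurable.ennreal_ofReal _
      _ < ⊤ := by simp [lt_top_iff_ne_top, h1, h2]
  rw [extInt, h1, ← EReal.coe_ennreal_toReal h2]
  simp

/-! ### The functionals in terms of arbitrary weak derivatives -/

theorem _root_.MeasureTheory.MemLp.integrable_norm_sq {n : ℕ} {F : Type*} [NormedAddCommGroup F] {Ω : Set (E n)}
    {g : E n → F} (h : MemLp g 2 (volume.restrict Ω)) :
    Integrable (fun x => ‖g x‖ ^ 2) (volume.restrict Ω) := h.integrable_norm_pow (by norm_num)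

theorem IsW22With.aestronglyMeasurable_comp {n : ℕ} {Ω : Set (E n)} {u : E n → ℝ}
    {G : E n → E n} {H : E n → Mat n} (h : IsW22With Ω u G H) {W : ℝ → ℝ} (hW : Continuous W) :
    AEStronglyMeasurable (fun x => W (u x)) (volume.restrict Ω) :=
  hW.comp_aestronglyMeasurable h.memLp.1

theorem Mminus_eq_extInt {n : ℕ} {Ω : Set (E n)} (hΩ : IsOpen Ω) {u : E n → ℝ}
    {G : E n → E n} {H : E n → Mat n} (h : IsW22With Ω u G H) (W : ℝ → ℝ) (q ε : ℝ) :
    Mminus W q ε u Ω =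
      extInt Ω (fun x => W (u x) / ε - q * ε * ‖G x‖ ^ 2 + ε ^ 3 * ‖H x‖ ^ 2) := by
  rw [Mminus, if_pos h.memW22]
  obtain ⟨h1, h2⟩ := h.weakGrad_ae_eq hΩ
  refine extInt_congr ?_
  filter_upwards [h1, h2] with x hx1 hx2
  rw [hx1, hx2]

theorem Mminus_of_integrable {n : ℕ} {Ω : Set (E n)} (hΩ : IsOpen Ω) {u : E n → ℝ}
    {G : E n → E n} {H : E n → Mat n} (h : IsW22With Ω u G H) {W : ℝ → ℝ} (q ε : ℝ)
    (hi : IntegrableOn (fun x => W (u x)) Ω) :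
    Mminus W q ε u Ω = (((∫ x in Ω, W (u x)) / ε - q * ε * (∫ x in Ω, ‖G x‖ ^ 2)
      + ε ^ 3 * (∫ x in Ω, ‖H x‖ ^ 2) : ℝ) : EReal) := by
  have i1 := h.memLp_grad.integrable_norm_sq.const_mul (q * ε)
  have i2 := h.memLp_hess.integrable_norm_sq.const_mul (ε ^ 3)
  have i0 := Integrable.div_const hi ε
  rw [Mminus_eq_extInt hΩ h]
  refine (extInt_of_integrable ((i0.sub i1).add i2)).trans (congrArg _ ?_)
  have e1 := integral_add (i0.sub i1) i2
  have e2 := integral_sub i0 i1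
  simp only [Pi.sub_apply] at e1
  refine e1.trans ?_
  rw [e2, integral_const_mul, integral_const_mul, integral_div]

theorem Mminus_eq_top {n : ℕ} {Ω : Set (E n)} (hΩ : IsOpen Ω) {u : E n → ℝ}
    {G : E n → E n} {H : E n → Mat n} (h : IsW22With Ω u G H) {W : ℝ → ℝ} (hW : Continuous W)
    (hW0 : ∀ s, 0 ≤ W s) (q : ℝ) {ε : ℝ} (hε : 0 < ε)
    (hi : ¬ IntegrableOn (fun x => W (u x)) Ω) : Mminus W q ε u Ω = ⊤ := by
  have i1 := h.memLp_grad.integrable_norm_sq.const_mul (q * ε)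
  have i2 := h.memLp_hess.integrable_norm_sq.const_mul (ε ^ 3)
  have m0 := h.aestronglyMeasurable_comp hW
  rw [Mminus_eq_extInt hΩ h]
  refine extInt_eq_top (b := fun x => ε ^ 3 * ‖H x‖ ^ 2 - q * ε * ‖G x‖ ^ 2)
    (((m0.aemeasurable.div_const ε).aestronglyMeasurable.sub i1.1).add i2.1) (i2.sub i1)
    (fun x => ?_) fun hint => hi ?_
  · have : 0 ≤ W (u x) / ε := div_nonneg (hW0 _) hε.le
    linarith
  · have := ((hint.sub i2).add i1).const_mul ε
    refine this.congr (Eventually.of_forall fun x => ?_)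
    simp only [Pi.add_apply, Pi.sub_apply]
    field_simp
    ring

theorem Mminus_nonneg_iff {n : ℕ} {Ω : Set (E n)} (hΩ : IsOpen Ω) {u : E n → ℝ}
    {G : E n → E n} {H : E n → Mat n} (h : IsW22With Ω u G H) {W : ℝ → ℝ} (q : ℝ) {ε : ℝ}
    (hε : 0 < ε) (hi : IntegrableOn (fun x => W (u x)) Ω) :
    0 ≤ Mminus W q ε u Ω ↔ q * (ε ^ 2 * ∫ x in Ω, ‖G x‖ ^ 2) ≤
      (∫ x in Ω, W (u x)) + ε ^ 4 * ∫ x in Ω, ‖H x‖ ^ 2 := by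
  rw [Mminus_of_integrable hΩ h q ε hi, EReal.coe_nonneg]
  have : (∫ x in Ω, W (u x)) / ε - q * ε * (∫ x in Ω, ‖G x‖ ^ 2) + ε ^ 3 * (∫ x in Ω, ‖H x‖ ^ 2)
      = (((∫ x in Ω, W (u x)) + ε ^ 4 * ∫ x in Ω, ‖H x‖ ^ 2)
        - q * (ε ^ 2 * ∫ x in Ω, ‖G x‖ ^ 2)) / ε := by
    field_simp
    ring
  rw [this, le_div_iff₀ hε, zero_mul, sub_nonneg]

theorem IsDensity.aestronglyMeasurable {n : ℕ} {W : ℝ → ℝ} {c₁ c₂ q : ℝ}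
    {f : E n → ℝ → E n → Mat n → ℝ} (hf : IsDensity W c₁ c₂ q f) {Ω : Set (E n)} {u : E n → ℝ}
    {G : E n → E n} {H : E n → Mat n} (h : IsW22With Ω u G H) (ε : ℝ) :
    AEStronglyMeasurable (fun x => f x (u x) (ε • G x) (ε ^ 2 • H x)) (volume.restrict Ω) := by
  have hm : AEMeasurable (fun x => (x, u x, ε • G x, ε ^ 2 • H x)) (volume.restrict Ω) :=
    aemeasurable_id.prodMk (h.memLp.1.aemeasurable.prodMk
      ((h.memLp_grad.1.aemeasurable.const_smul ε).prodMk
        (h.memLp_hess.1.aemeasurable.const_smul (ε ^ 2))))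
  exact (hf.measurable.comp_aemeasurable hm).aestronglyMeasurable

/-- The derivatives are square integrable anyway, so the two growth bounds reduce everything to
`W(u)`. This gives the dichotomy used throughout: the functionals are finite real integrals if
`W(u)` is integrable, and `⊤` otherwise. -/
theorem IsDensity.integrableOn_iff {n : ℕ} {W : ℝ → ℝ} (hW : Continuous W)
    (hW0 : ∀ s, 0 ≤ W s) {c₁ c₂ q : ℝ} (hc₁ : 0 < c₁)
    {f : E n → ℝ → E n → Mat n → ℝ} (hf : IsDensity W c₁ c₂ q f) {Ω : Set (E n)} {u : E n → ℝ}
    {G : E n → E n} {H : E n → Mat n} (h : IsW22With Ω u G H) (ε : ℝ) :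
    IntegrableOn (fun x => f x (u x) (ε • G x) (ε ^ 2 • H x)) Ω ↔
      IntegrableOn (fun x => W (u x)) Ω := by
  have i1 := (h.memLp_grad.const_smul ε).integrable_norm_sq
  have i2 := (h.memLp_hess.const_smul (ε ^ 2)).integrable_norm_sq
  simp only [Pi.smul_apply] at i1 i2
  constructor
  · intro hi
    refine ((hi.const_mul c₁⁻¹).add (i1.const_mul q)).mono' (h.aestronglyMeasurable_comp hW)
      (Eventually.of_forall fun x => ?_)
    have h1 := hf.lower x (u x) (ε • G x) (ε ^ 2 • H x)
    rw [Real.norm_of_nonneg (hW0 _)]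
    have h2 := mul_le_mul_of_nonneg_left h1 (inv_pos.2 hc₁).le
    rw [inv_mul_cancel_left₀ hc₁.ne'] at h2
    simp only [Pi.add_apply]
    nlinarith [sq_nonneg ‖ε ^ 2 • H x‖]
  · intro hi
    have hlo : Integrable (fun x => c₁ * (W (u x) - q * ‖ε • G x‖ ^ 2 + ‖ε ^ 2 • H x‖ ^ 2))
        (volume.restrict Ω) := ((hi.sub (i1.const_mul q)).add i2).const_mul c₁
    have hup : Integrable (fun x => c₂ * (W (u x) + q * ‖ε • G x‖ ^ 2 + ‖ε ^ 2 • H x‖ ^ 2))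
        (volume.restrict Ω) := ((hi.add (i1.const_mul q)).add i2).const_mul c₂
    exact integrable_of_le_of_le (hf.aestronglyMeasurable h ε)
      (Eventually.of_forall fun x => hf.lower x (u x) (ε • G x) (ε ^ 2 • H x))
      (Eventually.of_forall fun x => hf.upper x (u x) (ε • G x) (ε ^ 2 • H x)) hlo hup

theorem energy_eq_extInt {n : ℕ} {Ω : Set (E n)} (hΩ : IsOpen Ω) {u : E n → ℝ}
    {G : E n → E n} {H : E n → Mat n} (h : IsW22With Ω u G H)
    (f : E n → ℝ → E n → Mat n → ℝ) (ε : ℝ) :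
    energy f ε u Ω = ((1 / ε : ℝ) : EReal) *
      extInt Ω (fun x => f x (u x) (ε • G x) (ε ^ 2 • H x)) := by
  rw [energy, if_pos h.memW22]
  obtain ⟨h1, h2⟩ := h.weakGrad_ae_eq hΩ
  congr 1
  refine extInt_congr ?_
  filter_upwards [h1, h2] with x hx1 hx2
  rw [hx1, hx2]

theorem energy_of_integrable {n : ℕ} {Ω : Set (E n)} (hΩ : IsOpen Ω) {W : ℝ → ℝ}
    (hW : Continuous W) (hW0 : ∀ s, 0 ≤ W s) {c₁ c₂ q : ℝ} (hc₁ : 0 < c₁)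
    {f : E n → ℝ → E n → Mat n → ℝ} (hf : IsDensity W c₁ c₂ q f) {u : E n → ℝ}
    {G : E n → E n} {H : E n → Mat n} (h : IsW22With Ω u G H) (ε : ℝ)
    (hi : IntegrableOn (fun x => W (u x)) Ω) :
    energy f ε u Ω =
      ((1 / ε * ∫ x in Ω, f x (u x) (ε • G x) (ε ^ 2 • H x) : ℝ) : EReal) := by
  rw [energy_eq_extInt hΩ h, extInt_of_integrable ((hf.integrableOn_iff hW hW0 hc₁ h ε).2 hi),
    EReal.coe_mul]

theorem energy_eq_top {n : ℕ} {Ω : Set (E n)} (hΩ : IsOpen Ω) {W : ℝ → ℝ}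
    (hW : Continuous W) (hW0 : ∀ s, 0 ≤ W s) {c₁ c₂ q : ℝ} (hc₁ : 0 < c₁)
    {f : E n → ℝ → E n → Mat n → ℝ} (hf : IsDensity W c₁ c₂ q f) {u : E n → ℝ}
    {G : E n → E n} {H : E n → Mat n} (h : IsW22With Ω u G H) {ε : ℝ} (hε : 0 < ε)
    (hi : ¬ IntegrableOn (fun x => W (u x)) Ω) : energy f ε u Ω = ⊤ := by
  have i1 := (h.memLp_grad.const_smul ε).integrable_norm_sq
  have i2 := (h.memLp_hess.const_smul (ε ^ 2)).integrable_norm_sq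
  simp only [Pi.smul_apply] at i1 i2
  rw [energy_eq_extInt hΩ h, extInt_eq_top
    (b := fun x => c₁ * (‖ε ^ 2 • H x‖ ^ 2 - q * ‖ε • G x‖ ^ 2)) (hf.aestronglyMeasurable h ε)
    ((i2.sub (i1.const_mul q)).const_mul c₁) (fun x => ?_)
    (fun hh => hi ((hf.integrableOn_iff hW hW0 hc₁ h ε).1 hh)),
    EReal.coe_mul_top_of_pos (by positivity)]
  refine le_trans ?_ (hf.lower x (u x) (ε • G x) (ε ^ 2 • H x))
  exact mul_le_mul_of_nonneg_left (by linarith [hW0 (u x)]) hc₁.le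

/-! ### A one-dimensional nonlinear interpolation inequality -/

/-- Two points of the set satisfy `m |t - s| < m / 4`, so its diameter, and with it its outer
measure, is at most `1/4`. -/
theorem volume_abs_sub_lt_le {F : ℝ → ℝ} {m a : ℝ} (hm : 0 < m)
    (hF : ∀ s ∈ Ioc (0 : ℝ) 1, ∀ t ∈ Ioc (0 : ℝ) 1, m * |t - s| ≤ |F t - F s|) :
    volume {s ∈ Ioc (0 : ℝ) 1 | |F s - a| < m / 8} ≤ ENNReal.ofReal (1 / 4) := by
  refine (Real.volume_le_diam _).trans (Metric.ediam_le fun s hs t ht => ?_)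
  rw [edist_dist]
  refine ENNReal.ofReal_le_ofReal ?_
  rw [Real.dist_eq]
  have h1 := hF t ht.1 s hs.1
  have h2 : |F s - F t| ≤ |F s - a| + |F t - a| := by
    rw [abs_sub_comm (F t) a]
    exact abs_sub_le _ _ _
  have h3 := hs.2
  have h4 := ht.2
  by_contra! h
  nlinarith

/-- An expanding `F` is within `m / 8` of each of the points `1` and `-1` for a time at most `1/4`.
During the remaining time, at least `1/2`, the integrand is at least `m² / 64`. -/
theorem le_lintegral_sq_abs_sub_one {F : ℝ → ℝ} {m : ℝ} (hm : 0 < m) (hc : Measurable F)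
    (hF : ∀ s ∈ Ioc (0 : ℝ) 1, ∀ t ∈ Ioc (0 : ℝ) 1, m * |t - s| ≤ |F t - F s|) :
    ENNReal.ofReal (m ^ 2 / 128) ≤
      ∫⁻ s in Ioc (0 : ℝ) 1, ENNReal.ofReal ((|F s| - 1) ^ 2) := by
  have hmeas : Measurable fun s => ENNReal.ofReal ((|F s| - 1) ^ 2) := by fun_prop
  set P := {s | ENNReal.ofReal (m ^ 2 / 64) ≤ ENNReal.ofReal ((|F s| - 1) ^ 2)} with hP
  have hPm : MeasurableSet P := measurableSet_le measurable_const hmeas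
  have h1 := mul_meas_ge_le_lintegral (μ := volume.restrict (Ioc (0 : ℝ) 1)) hmeas
    (ENNReal.ofReal (m ^ 2 / 64))
  rw [Measure.restrict_apply hPm] at h1
  refine le_trans ?_ h1
  have hcov : Ioc (0 : ℝ) 1 ⊆ (P ∩ Ioc 0 1) ∪ ({s ∈ Ioc (0 : ℝ) 1 | |F s - 1| < m / 8} ∪
      {s ∈ Ioc (0 : ℝ) 1 | |F s - (-1)| < m / 8}) := by
    intro s hs
    by_cases h : s ∈ P
    · exact Or.inl ⟨h, hs⟩
    · right
      have h' : (|F s| - 1) ^ 2 < m ^ 2 / 64 := by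
        by_contra! hc
        exact h (ENNReal.ofReal_le_ofReal hc)
      have h2 : |(|F s| - 1)| < m / 8 := abs_lt_of_sq_lt_sq (by nlinarith) (by positivity)
      rcases le_total 0 (F s) with h0 | h0
      · left
        refine ⟨hs, ?_⟩
        rwa [abs_of_nonneg h0] at h2
      · right
        refine ⟨hs, ?_⟩
        rw [abs_of_nonpos h0] at h2
        rwa [sub_neg_eq_add, ← abs_neg, neg_add']
  have h2 : (1 : ℝ≥0∞) ≤ volume (P ∩ Ioc 0 1) + ENNReal.ofReal (1 / 2) := by
    calc (1 : ℝ≥0∞) = volume (Ioc (0 : ℝ) 1) := by simp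
      _ ≤ _ := measure_mono hcov
      _ ≤ _ := measure_union_le _ _
      _ ≤ volume (P ∩ Ioc 0 1) + (ENNReal.ofReal (1 / 4) + ENNReal.ofReal (1 / 4)) := by
        gcongr
        exact (measure_union_le _ _).trans
          (add_le_add (volume_abs_sub_lt_le hm hF) (volume_abs_sub_lt_le hm hF))
      _ = _ := by rw [← ENNReal.ofReal_add (by norm_num) (by norm_num)]; norm_num
  have h3 : ENNReal.ofReal (1 / 2) ≤ volume (P ∩ Ioc 0 1) := by
    have : ENNReal.ofReal (1 / 2) + ENNReal.ofReal (1 / 2) = 1 := by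
      rw [← ENNReal.ofReal_add (by norm_num) (by norm_num)]; norm_num
    rw [← this] at h2
    exact (ENNReal.add_le_add_iff_right ENNReal.ofReal_ne_top).1 h2
  calc ENNReal.ofReal (m ^ 2 / 128)
      = ENNReal.ofReal (m ^ 2 / 64) * ENNReal.ofReal (1 / 2) := by
        rw [← ENNReal.ofReal_mul (by positivity)]; congr 1; ring
    _ ≤ _ := by gcongr

/-- If the right side were smaller, the second derivative `c` would have so little mass that the
slope stays above `g₀ / 2` on the whole interval. Then `f` is expanding and leaves the wells, which
already costs `g₀² / 512`. -/
theorem sq_slope_le_lintegral_of_pos {f g c : ℝ → ℝ} {f₀ g₀ : ℝ} (h0 : 0 < g₀)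
    (hc : IntervalIntegrable c volume 0 1)
    (hgc : ∀ᵐ s ∂(volume.restrict (Ioc (0 : ℝ) 1)), g s = g₀ + ∫ r in (0 : ℝ)..s, c r)
    (hfg : ∀ᵐ s ∂(volume.restrict (Ioc (0 : ℝ) 1)), f s = f₀ + ∫ r in (0 : ℝ)..s, g r) :
    ENNReal.ofReal (g₀ ^ 2) ≤
      512 * ∫⁻ s in Ioc (0 : ℝ) 1, ENNReal.ofReal ((|f s| - 1) ^ 2 + c s ^ 2) := by
  by_contra! hJ
  set J := ∫⁻ s in Ioc (0 : ℝ) 1, ENNReal.ofReal ((|f s| - 1) ^ 2 + c s ^ 2) with hJdef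
  have hc' : IntegrableOn c (Ioc 0 1) :=
    (intervalIntegrable_iff_integrableOn_Ioc_of_le zero_le_one).1 hc
  have e512 : (512 : ℝ≥0∞) = ENNReal.ofReal 512 := by simp
  -- the primitive of `c` oscillates little
  have hJc : ∫⁻ s in Ioc (0 : ℝ) 1, ENNReal.ofReal (c s ^ 2) ≤ J :=
    lintegral_mono fun s => ENNReal.ofReal_le_ofReal (by nlinarith [sq_nonneg (|f s| - 1)])
  have hJfin : J ≠ ⊤ := by
    intro h
    rw [h] at hJ
    simp at hJ
  have hJr : J.toReal ≤ g₀ ^ 2 / 512 := by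
    have h1 : J ≤ ENNReal.ofReal (g₀ ^ 2 / 512) := by
      rw [div_eq_inv_mul, ENNReal.ofReal_mul (by norm_num), ENNReal.ofReal_inv_of_pos (by norm_num),
        ← e512]
      rw [← ENNReal.mul_le_iff_le_inv (by simp) (by simp)]
      exact hJ.le
    exact ENNReal.toReal_le_of_le_ofReal (by positivity) h1
  have hc2 : IntegrableOn (fun s => c s ^ 2) (Ioc 0 1) := by
    refine ⟨hc'.1.pow 2, ?_⟩
    rw [hasFiniteIntegral_iff_ofReal (Eventually.of_forall fun s => sq_nonneg _)]
    exact lt_of_le_of_lt hJc (lt_top_iff_ne_top.2 hJfin)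
  have hc2J : ∫ s in Ioc (0 : ℝ) 1, c s ^ 2 ≤ g₀ ^ 2 / 512 := by
    refine le_trans ?_ hJr
    rw [integral_eq_lintegral_of_nonneg_ae (Eventually.of_forall fun s => sq_nonneg _) hc2.1]
    exact ENNReal.toReal_mono hJfin hJc
  -- Young's inequality `|c| ≤ g₀ / 4 + c² / g₀`, together with `∫ c² ≤ g₀² / 512`.
  have habs : ∫ s in Ioc (0 : ℝ) 1, |c s| ≤ g₀ / 2 := by
    have h1 : ∫ s in Ioc (0 : ℝ) 1, |c s| ≤ ∫ s in Ioc (0 : ℝ) 1, (g₀ / 4 + c s ^ 2 / g₀) := by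
      refine integral_mono hc'.abs ((integrable_const _).add (hc2.div_const _)) fun s => ?_
      have : g₀ / 4 + c s ^ 2 / g₀ - |c s| = (|c s| - g₀ / 2) ^ 2 / g₀ := by
        field_simp
        rw [← sq_abs (c s)]
        ring
      have h2 : 0 ≤ (|c s| - g₀ / 2) ^ 2 / g₀ := by positivity
      simp only
      linarith
    rw [integral_add (integrable_const _) (hc2.div_const _),
      show ∫ s in Ioc (0 : ℝ) 1, c s ^ 2 / g₀ = (∫ s in Ioc (0 : ℝ) 1, c s ^ 2) / g₀ from
        integral_div _ _] at h1
    simp only [integral_const, MeasurableSet.univ, measureReal_restrict_apply, univ_inter,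
      Real.volume_real_Ioc, sub_zero, zero_le_one, sup_of_le_left, smul_eq_mul, one_mul] at h1
    have h2 : (∫ s in Ioc (0 : ℝ) 1, c s ^ 2) / g₀ ≤ g₀ / 512 := by
      rw [div_le_iff₀ h0]
      nlinarith
    linarith
  set G : ℝ → ℝ := fun s => g₀ + ∫ r in (0 : ℝ)..s, c r with hG
  have hGlo : ∀ s ∈ Icc (0 : ℝ) 1, g₀ / 2 ≤ G s := by
    intro s hs
    have h1 : |∫ r in (0 : ℝ)..s, c r| ≤ g₀ / 2 := by
      refine (intervalIntegral.abs_integral_le_integral_abs hs.1).trans ?_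
      rw [intervalIntegral.integral_of_le hs.1]
      exact (setIntegral_mono_set hc'.abs (Eventually.of_forall fun s => abs_nonneg _)
        (Ioc_subset_Ioc_right hs.2).eventuallyLE).trans habs
    simp only [hG]
    linarith [(abs_le.1 h1).1]
  have hGc : ContinuousOn G (Icc 0 1) := by
    refine continuousOn_const.add ?_
    exact intervalIntegral.continuousOn_primitive_interval' (b₁ := 0) (b₂ := 1) hc (by simp)
      |>.mono (by simp)
  -- a measurable representative of `f`
  set F : ℝ → ℝ := fun s => f₀ + ∫ r in (0 : ℝ)..s, (Icc (0 : ℝ) 1).indicator G r with hF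
  have hind : Integrable ((Icc (0 : ℝ) 1).indicator G) :=
    (integrable_indicator_iff measurableSet_Icc).2 hGc.integrableOn_Icc
  have hFc : Continuous F :=
    continuous_const.add (intervalIntegral.continuous_primitive
      (fun a b => hind.intervalIntegrable) 0)
  have hFf : ∀ᵐ s ∂(volume.restrict (Ioc (0 : ℝ) 1)), f s = F s := by
    filter_upwards [hfg, ae_restrict_mem measurableSet_Ioc] with s hs hs1
    rw [hs, hF]
    congr 1
    rw [intervalIntegral.integral_of_le hs1.1.le, intervalIntegral.integral_of_le hs1.1.le]
    refine integral_congr_ae ?_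
    have := ae_mono (Measure.restrict_mono (Ioc_subset_Ioc_right hs1.2) le_rfl) hgc
    filter_upwards [this, ae_restrict_mem measurableSet_Ioc] with r hr hr1
    rw [hr, indicator_of_mem (show r ∈ Icc (0 : ℝ) 1 from ⟨hr1.1.le, hr1.2.trans hs1.2⟩)]
  have hexp' : ∀ s ∈ Ioc (0 : ℝ) 1, ∀ t ∈ Ioc (0 : ℝ) 1, s ≤ t →
      g₀ / 2 * (t - s) ≤ F t - F s := by
    intro s hs t ht hst
    have h1 : F t - F s = ∫ r in s..t, (Icc (0 : ℝ) 1).indicator G r := by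
      simp only [hF]
      rw [add_sub_add_left_eq_sub]
      exact intervalIntegral.integral_interval_sub_left hind.intervalIntegrable
        hind.intervalIntegrable
    rw [h1]
    have h2 : ∫ r in s..t, (g₀ / 2) = g₀ / 2 * (t - s) := by simp; ring
    rw [← h2]
    refine intervalIntegral.integral_mono_on hst (by simp) hind.intervalIntegrable fun r hr => ?_
    have : r ∈ Icc (0 : ℝ) 1 := ⟨hs.1.le.trans hr.1, hr.2.trans ht.2⟩
    rw [indicator_of_mem this]
    exact hGlo r this
  have hexp : ∀ s ∈ Ioc (0 : ℝ) 1, ∀ t ∈ Ioc (0 : ℝ) 1, g₀ / 2 * |t - s| ≤ |F t - F s| := by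
    intro s hs t ht
    rcases le_total s t with h | h
    · rw [abs_of_nonneg (sub_nonneg.2 h)]
      exact (hexp' s hs t ht h).trans (le_abs_self _)
    · rw [abs_sub_comm t s, abs_of_nonneg (sub_nonneg.2 h), abs_sub_comm]
      exact (hexp' t ht s hs h).trans (le_abs_self _)
  have hlow := le_lintegral_sq_abs_sub_one (half_pos h0) hFc.measurable hexp
  have hup : ∫⁻ s in Ioc (0 : ℝ) 1, ENNReal.ofReal ((|F s| - 1) ^ 2) ≤ J := by
    refine lintegral_mono_ae ?_
    filter_upwards [hFf] with s hs
    rw [hs]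
    exact ENNReal.ofReal_le_ofReal (by nlinarith [sq_nonneg (c s)])
  -- The expansion rate is `m = g₀ / 2`, and `m² / 128 = g₀² / 512`.
  refine absurd hJ (not_lt.2 ?_)
  calc ENNReal.ofReal (g₀ ^ 2) = 512 * ENNReal.ofReal ((g₀ / 2) ^ 2 / 128) := by
        rw [e512, ← ENNReal.ofReal_mul (by norm_num)]; congr 1; ring
    _ ≤ 512 * J := by gcongr; exact hlow.trans hup

/-- The right side is even in `f` and `c`, so a negative slope reduces to a positive one by changing
signs. -/
theorem sq_slope_le_lintegral {f g c : ℝ → ℝ} {f₀ g₀ : ℝ}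
    (hc : IntervalIntegrable c volume 0 1)
    (hgc : ∀ᵐ s ∂(volume.restrict (Ioc (0 : ℝ) 1)), g s = g₀ + ∫ r in (0 : ℝ)..s, c r)
    (hfg : ∀ᵐ s ∂(volume.restrict (Ioc (0 : ℝ) 1)), f s = f₀ + ∫ r in (0 : ℝ)..s, g r) :
    ENNReal.ofReal (g₀ ^ 2) ≤
      512 * ∫⁻ s in Ioc (0 : ℝ) 1, ENNReal.ofReal ((|f s| - 1) ^ 2 + c s ^ 2) := by
  rcases lt_trichotomy g₀ 0 with h | h | h
  · have := sq_slope_le_lintegral_of_pos (f := fun s => -f s) (g := fun s => -g s)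
      (c := fun s => -c s) (f₀ := -f₀) (g₀ := -g₀) (by linarith) hc.neg
      (by filter_upwards [hgc] with s hs; rw [hs, intervalIntegral.integral_neg]; ring)
      (by filter_upwards [hfg] with s hs; rw [hs, intervalIntegral.integral_neg]; ring)
    simpa using this
  · simp [h]
  · exact sq_slope_le_lintegral_of_pos h hc hgc hfg

/-! ### Weak directional derivatives along segments -/

/-- The points from which the segment in direction `w` stays in `A`. -/
def segmentSet {n : ℕ} (A : Set (E n)) (w : E n) : Set (E n) :=
  {x | ∀ s ∈ Icc (0 : ℝ) 1, x + s • w ∈ A}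

/-- A compact segment inside an open set stays inside under small translations. -/
theorem isOpen_segmentSet {n : ℕ} {A : Set (E n)} (hA : IsOpen A) (w : E n) :
    IsOpen (segmentSet A w) := by
  rw [isOpen_iff_mem_nhds]
  intro x hx
  refine isCompact_Icc.eventually_forall_of_forall_eventually fun s hs => ?_
  have hc : Continuous fun z : E n × ℝ => z.1 + z.2 • w := by fun_prop
  exact hc.continuousAt.eventually (hA.mem_nhds (hx s hs))

/-- `g` is the weak derivative of `u` in direction `w` in `A`. -/
def IsWeakDirDeriv {n : ℕ} (A : Set (E n)) (w : E n) (u g : E n → ℝ) : Prop :=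
  ∀ φ : E n → ℝ, ContDiff ℝ ∞ φ → HasCompactSupport φ → tsupport φ ⊆ A →
    ∫ x, u x * fderiv ℝ φ x w = - ∫ x, g x * φ x

theorem measurePreserving_shear {n : ℕ} (w : E n) (ν : Measure ℝ) [SFinite ν] :
    MeasurePreserving (fun p : ℝ × E n => (p.1, p.2 + p.1 • w)) (ν.prod volume)
      (ν.prod volume) := by
  refine (MeasurePreserving.id ν).skew_product (g := fun r x => x + r • w) (by fun_prop) ?_
  exact Eventually.of_forall fun r => (measurePreserving_add_right volume (r • w)).map_eq

theorem _root_.MeasureTheory.MemLp.comp_shear {n : ℕ} {g : E n → ℝ} (hg : MemLp g 2 volume)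
    (w : E n) (ν : Measure ℝ) [IsFiniteMeasure ν] :
    MemLp (fun p : ℝ × E n => g (p.2 + p.1 • w)) 2 (ν.prod volume) :=
  (hg.comp_snd ν).comp_measurePreserving (measurePreserving_shear w ν)

theorem integrable_mul_shear {n : ℕ} {h g : E n → ℝ} (hh : MemLp h 2 volume)
    (hg : MemLp g 2 volume) (w : E n) (ν : Measure ℝ) [IsFiniteMeasure ν] :
    Integrable (fun p : ℝ × E n => h p.2 * g (p.2 + p.1 • w)) (ν.prod volume) :=
  (hh.comp_snd ν).integrable_mul (hg.comp_shear w ν)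

theorem hasCompactSupport_comp_add {n : ℕ} {φ : E n → ℝ} (hφ : HasCompactSupport φ) (a : E n) :
    HasCompactSupport fun x => φ (x + a) :=
  hφ.comp_homeomorph (Homeomorph.addRight a)

/-- The fundamental theorem of calculus along `w`, in weak form. Fubini and a translation move the
shift by `r • w` onto `φ`; since `φ` is supported in `segmentSet A w`, the shifted function is still
a test function in `A`. The weak derivative then falls on `φ`, where the integration in `r` is
classical. -/
theorem integral_test_segment {n : ℕ} {A : Set (E n)} {w : E n} {u g : E n → ℝ}
    (hug : IsWeakDirDeriv A w u g) (hu : MemLp u 2 volume) (hg : MemLp g 2 volume)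
    {s : ℝ} (hs : s ∈ Icc (0 : ℝ) 1) {φ : E n → ℝ} (h1 : ContDiff ℝ ∞ φ)
    (h2 : HasCompactSupport φ) (h3 : tsupport φ ⊆ segmentSet A w) :
    ∫ x, φ x * ∫ r in Ioc 0 s, g (x + r • w) = ∫ x, φ x * (u (x + s • w) - u x) := by
  have hφL : MemLp φ 2 volume := h1.continuous.memLp_of_hasCompactSupport h2
  have hdc : Continuous fun x => fderiv ℝ φ x w :=
    (h1.continuous_fderiv (by simp)).clm_apply continuous_const
  have hds : HasCompactSupport fun x => fderiv ℝ φ x w := (h2.fderiv ℝ).comp_left (g := fun L : E n →L[ℝ] ℝ => L w) rfl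
  have hdL : MemLp (fun x => fderiv ℝ φ x w) 2 volume := hdc.memLp_of_hasCompactSupport hds
  have htr : ∀ a : E n, MemLp (fun x => u (x + a)) 2 volume := fun a =>
    hu.comp_measurePreserving (measurePreserving_add_right volume a)
  have htrφ : ∀ a : E n, MemLp (fun x => φ (x + a)) 2 volume := fun a =>
    hφL.comp_measurePreserving (measurePreserving_add_right volume a)
  have hslice : ∀ r ∈ Ioc 0 s, ∫ x, φ x * g (x + r • w) =
      - ∫ y, u y * fderiv ℝ φ (y + r • (-w)) w := by
    intro r hr
    have e1 : ∫ x, φ x * g (x + r • w) = ∫ y, g y * φ (y + r • (-w)) := by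
      rw [← integral_add_right_eq_self (μ := volume) (fun y => g y * φ (y + r • (-w))) (r • w)]
      congr 1; ext x
      rw [smul_neg, add_neg_cancel_right, mul_comm]
    have e2 := hug (fun y => φ (y + r • (-w))) (h1.comp (contDiff_id.add contDiff_const))
      (hasCompactSupport_comp_add h2 _) (by
        intro y hy
        have hy' : y + r • (-w) ∈ tsupport φ :=
          (tsupport_comp_subset_preimage φ (f := fun y => y + r • (-w)) (by fun_prop)) hy
        have := h3 hy' r ⟨hr.1.le, hr.2.trans hs.2⟩
        simpa using this)
    rw [e1, eq_neg_iff_add_eq_zero, add_comm, ← eq_neg_iff_add_eq_zero, ← e2]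
    congr 1; ext y
    rw [fderiv_comp_add_right]
  have hfub : ∫ x, φ x * ∫ r in Ioc 0 s, g (x + r • w)
      = ∫ r in Ioc 0 s, ∫ x, φ x * g (x + r • w) := by
    rw [integral_integral_swap (integrable_mul_shear hφL hg w (volume.restrict (Ioc 0 s)))]
    congr 1; ext x
    rw [integral_const_mul]
  have hfub2 : ∫ r in Ioc 0 s, ∫ y, u y * fderiv ℝ φ (y + r • (-w)) w
      = ∫ y, u y * ∫ r in Ioc 0 s, fderiv ℝ φ (y + r • (-w)) w := by
    rw [integral_integral_swap (integrable_mul_shear hu hdL (-w) (volume.restrict (Ioc 0 s)))]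
    congr 1; ext x
    rw [integral_const_mul]
  have hftc : ∀ y, ∫ r in Ioc 0 s, fderiv ℝ φ (y + r • (-w)) w = φ y - φ (y + s • (-w)) := by
    intro y
    rw [← intervalIntegral.integral_of_le hs.1]
    have hd : ∀ r ∈ uIcc 0 s, HasDerivAt (fun r : ℝ => - φ (y + r • (-w)))
        (fderiv ℝ φ (y + r • (-w)) w) r := by
      intro r _
      have hin : HasDerivAt (fun r : ℝ => y + r • (-w)) (-w) r := by
        simpa using ((hasDerivAt_id r).smul_const (-w)).const_add y
      have := ((h1.differentiable (by simp) (y + r • (-w))).hasFDerivAt.comp_hasDerivAt r hin).neg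
      rw [map_neg, neg_neg] at this
      exact this
    rw [intervalIntegral.integral_eq_sub_of_hasDerivAt hd]
    · simp; ring
    · have hcc : Continuous fun r : ℝ => fderiv ℝ φ (y + r • (-w)) w :=
        hdc.comp (by fun_prop)
      exact hcc.intervalIntegrable _ _
  rw [hfub, setIntegral_congr_fun measurableSet_Ioc hslice, integral_neg, hfub2]
  simp_rw [hftc]
  have i1 : Integrable fun y => u y * φ y := hu.integrable_mul hφL
  have i2 : Integrable fun y => u y * φ (y + s • (-w)) := hu.integrable_mul (htrφ _)
  have i3 : Integrable fun y => φ y * u (y + s • w) := hφL.integrable_mul (htr _)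
  have i4 : Integrable fun y => φ y * u y := hφL.integrable_mul hu
  simp_rw [mul_sub]
  rw [integral_sub i1 i2, integral_sub i3 i4]
  have e3 : ∫ y, u y * φ (y + s • (-w)) = ∫ y, φ y * u (y + s • w) := by
    rw [← integral_add_right_eq_self (μ := volume) (fun y => u y * φ (y + s • (-w))) (s • w)]
    congr 1; ext x
    rw [smul_neg, add_neg_cancel_right, mul_comm]
  have e4 : ∫ y, u y * φ y = ∫ y, φ y * u y := by simp_rw [mul_comm]
  rw [e3, e4]
  ring

theorem ae_eq_add_integral_segment {n : ℕ} {A : Set (E n)} (hA : IsOpen A) {w : E n}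
    {u g : E n → ℝ} (hug : IsWeakDirDeriv A w u g) (hu : MemLp u 2 volume)
    (hg : MemLp g 2 volume) {s : ℝ} (hs : s ∈ Icc (0 : ℝ) 1) :
    ∀ᵐ x ∂(volume.restrict (segmentSet A w)),
      u (x + s • w) = u x + ∫ r in Ioc 0 s, g (x + r • w) := by
  have hO := isOpen_segmentSet hA w
  have htr : MemLp (fun x => u (x + s • w) - u x) 2 volume :=
    (hu.comp_measurePreserving (measurePreserving_add_right volume (s • w))).sub hu
  have hmul : ∀ h : E n → ℝ, MemLp h 2 volume →
      Integrable fun x => h x * ∫ r in Ioc 0 s, g (x + r • w) := by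
    intro h hh
    have := (integrable_mul_shear hh hg w (volume.restrict (Ioc 0 s))).integral_prod_right
    refine this.congr (Eventually.of_forall fun x => ?_)
    simp only
    rw [integral_const_mul]
  have hloc : LocallyIntegrable (fun x => ∫ r in Ioc 0 s, g (x + r • w)) volume := by
    rw [locallyIntegrable_iff]
    intro K hK
    have hind : MemLp (K.indicator fun _ => (1 : ℝ)) 2 volume :=
      memLp_indicator_const 2 hK.measurableSet 1 (Or.inr hK.measure_lt_top.ne)
    rw [← integrable_indicator_iff hK.measurableSet]
    refine (hmul _ hind).congr (Eventually.of_forall fun x => ?_)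
    by_cases hx : x ∈ K <;> simp [hx]
  have hloc' : LocallyIntegrable (fun x => (u (x + s • w) - u x) -
      ∫ r in Ioc 0 s, g (x + r • w)) volume :=
    (htr.locallyIntegrable (by norm_num)).sub hloc
  have key := hO.ae_eq_zero_of_integral_contDiff_smul_eq_zero (hloc'.locallyIntegrableOn _)
    (fun φ h1 h2 h3 => by
      have hφL : MemLp φ 2 volume := h1.continuous.memLp_of_hasCompactSupport h2
      simp only [smul_eq_mul]
      simp_rw [mul_sub _ (_ - _)]
      have hi : Integrable fun x => φ x * (u (x + s • w) - u x) := hφL.integrable_mul htr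
      rw [integral_sub hi (hmul φ hφL),
        integral_test_segment hug hu hg hs h1 h2 h3, sub_self])
  rw [ae_restrict_iff' hO.measurableSet]
  filter_upwards [key] with x hx hxO
  linarith [hx hxO]

/-- The identity is known for each `s` and almost every `x`. Exchanging the two quantifiers requires
a jointly measurable exceptional set, which is why Borel representatives are assumed. -/
theorem ae_ae_eq_add_integral_segment {n : ℕ} {A : Set (E n)} (hA : IsOpen A) {w : E n}
    {u g : E n → ℝ} (hug : IsWeakDirDeriv A w u g) (hu : MemLp u 2 volume)
    (hg : MemLp g 2 volume) (hum : Measurable u) (hgm : Measurable g) :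
    ∀ᵐ x ∂(volume.restrict (segmentSet A w)), ∀ᵐ s ∂(volume.restrict (Ioc (0 : ℝ) 1)),
      u (x + s • w) = u x + ∫ r in (0 : ℝ)..s, g (x + r • w) := by
  have hint : ∀ (s : ℝ) (x : E n), s ∈ Ioc (0 : ℝ) 1 → ∫ r in (0 : ℝ)..s, g (x + r • w) =
      ∫ r in Ioc (0 : ℝ) 1, (Iic s).indicator (fun r => g (x + r • w)) r := by
    intro s x hs
    rw [intervalIntegral.integral_of_le hs.1.le, setIntegral_indicator measurableSet_Iic,
      Ioc_inter_Iic, min_eq_right hs.2]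
  suffices h : ∀ᵐ x ∂(volume.restrict (segmentSet A w)), ∀ᵐ s ∂(volume.restrict (Ioc (0 : ℝ) 1)),
      u (x + s • w) = u x +
        ∫ r in Ioc (0 : ℝ) 1, (Iic s).indicator (fun r => g (x + r • w)) r by
    filter_upwards [h] with x hx
    filter_upwards [hx, ae_restrict_mem measurableSet_Ioc] with s hs hs1
    rw [hs, hint s x hs1]
  -- Writing the variable upper limit as an indicator on a fixed interval makes the integral a
  -- measurable function of `(x, s)`.
  have hjm : Measurable fun q : (E n × ℝ) × ℝ =>
      (Iic q.1.2).indicator (fun r => g (q.1.1 + r • w)) q.2 := by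
    have : (fun q : (E n × ℝ) × ℝ => (Iic q.1.2).indicator (fun r => g (q.1.1 + r • w)) q.2)
        = {q : (E n × ℝ) × ℝ | q.2 ≤ q.1.2}.indicator fun q => g (q.1.1 + q.2 • w) := by
      ext q
      by_cases hq : q.2 ≤ q.1.2 <;> simp [hq]
    rw [this]
    exact (hgm.comp (by fun_prop)).indicator (measurableSet_le (by fun_prop) (by fun_prop))
  rw [Measure.ae_ae_comm]
  · filter_upwards [ae_restrict_mem measurableSet_Ioc] with s hs
    filter_upwards [ae_eq_add_integral_segment hA hug hu hg ⟨hs.1.le, hs.2⟩] with x hx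
    rw [hx, ← hint s x hs, intervalIntegral.integral_of_le hs.1.le]
  · refine measurableSet_eq_fun (hum.comp (by fun_prop)) ((hum.comp measurable_fst).add ?_)
    exact (hjm.stronglyMeasurable.integral_prod_right').measurable

/-- The one-dimensional inequality is applied on the segment starting at almost every `x` and then
integrated in `x`. For fixed `s` the translate of `segmentSet A w` by `s • w` lies in `A`, so Fubini
costs no further constant. -/
theorem lintegral_sq_deriv_le_of_measurable {n : ℕ} {A : Set (E n)} (hA : IsOpen A) {w : E n}
    {u g c : E n → ℝ} (hug : IsWeakDirDeriv A w u g) (hgc : IsWeakDirDeriv A w g c)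
    (hu : MemLp u 2 volume) (hg : MemLp g 2 volume) (hc : MemLp c 2 volume)
    (hum : Measurable u) (hgm : Measurable g) (hcm : Measurable c) :
    ∫⁻ x in segmentSet A w, ENNReal.ofReal (g x ^ 2) ≤
      512 * ∫⁻ x in A, ENNReal.ofReal ((|u x| - 1) ^ 2 + c x ^ 2) := by
  have hO := isOpen_segmentSet hA w
  set F : E n → ℝ≥0∞ := fun x => ENNReal.ofReal ((|u x| - 1) ^ 2 + c x ^ 2) with hF
  have hFm : Measurable F := by fun_prop
  have hcint : ∀ᵐ x ∂(volume : Measure (E n)),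
      IntervalIntegrable (fun r => c (x + r • w)) volume 0 1 := by
    have h := (hc.comp_shear w (volume.restrict (Ioc (0 : ℝ) 1))).integrable_norm_pow
      (by norm_num)
    filter_upwards [h.prod_left_ae] with x hx
    rw [intervalIntegrable_iff_integrableOn_Ioc_of_le zero_le_one]
    have hm : AEStronglyMeasurable (fun r : ℝ => c (x + r • w)) (volume.restrict (Ioc 0 1)) :=
      (hcm.comp (by fun_prop)).aestronglyMeasurable
    have : MemLp (fun r : ℝ => c (x + r • w)) 2 (volume.restrict (Ioc 0 1)) := by
      refine (memLp_two_iff_integrable_sq hm).2 ?_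
      simpa using hx
    exact this.integrable (by norm_num)
  have hpt : ∀ᵐ x ∂(volume.restrict (segmentSet A w)), ENNReal.ofReal (g x ^ 2) ≤
      512 * ∫⁻ s in Ioc (0 : ℝ) 1, F (x + s • w) := by
    filter_upwards [ae_ae_eq_add_integral_segment hA hug hu hg hum hgm,
      ae_ae_eq_add_integral_segment hA hgc hg hc hgm hcm, ae_restrict_of_ae hcint] with x h1 h2 h3
    exact sq_slope_le_lintegral (f := fun s => u (x + s • w)) (g := fun s => g (x + s • w))
      (c := fun s => c (x + s • w)) h3 h2 h1
  have hslice : ∀ s ∈ Ioc (0 : ℝ) 1,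
      ∫⁻ x in segmentSet A w, F (x + s • w) ≤ ∫⁻ x in A, F x := by
    intro s hs
    rw [← lintegral_indicator hO.measurableSet, ← lintegral_indicator hA.measurableSet,
      ← lintegral_add_right_eq_self (A.indicator F) (s • w)]
    refine lintegral_mono fun x => ?_
    by_cases hx : x ∈ segmentSet A w
    · rw [indicator_of_mem hx, indicator_of_mem (hx s ⟨hs.1.le, hs.2⟩)]
    · simp [hx]
  calc ∫⁻ x in segmentSet A w, ENNReal.ofReal (g x ^ 2)
      ≤ ∫⁻ x in segmentSet A w, 512 * ∫⁻ s in Ioc (0 : ℝ) 1, F (x + s • w) :=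
        lintegral_mono_ae hpt
    _ = 512 * ∫⁻ x in segmentSet A w, ∫⁻ s in Ioc (0 : ℝ) 1, F (x + s • w) :=
        lintegral_const_mul' _ _ (by simp)
    _ = 512 * ∫⁻ s in Ioc (0 : ℝ) 1, ∫⁻ x in segmentSet A w, F (x + s • w) := by
        rw [lintegral_lintegral_swap]
        exact (hFm.comp (by fun_prop)).aemeasurable
    _ ≤ 512 * ∫⁻ s in Ioc (0 : ℝ) 1, ∫⁻ x in A, F x := by
        gcongr 512 * ?_
        exact setLIntegral_mono' measurableSet_Ioc hslice
    _ = 512 * ∫⁻ x in A, F x := by simp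

/-- Reduction to the measurable case: the functions are replaced by Borel representatives that
vanish off `A`, hence lie in `L²` of the whole space. -/
theorem lintegral_sq_deriv_le {n : ℕ} {A : Set (E n)} (hA : IsOpen A) {w : E n}
    {u g c : E n → ℝ} (hug : IsWeakDirDeriv A w u g) (hgc : IsWeakDirDeriv A w g c)
    (hu : MemLp u 2 (volume.restrict A)) (hg : MemLp g 2 (volume.restrict A))
    (hc : MemLp c 2 (volume.restrict A)) :
    ∫⁻ x in segmentSet A w, ENNReal.ofReal (g x ^ 2) ≤
      512 * ∫⁻ x in A, ENNReal.ofReal ((|u x| - 1) ^ 2 + c x ^ 2) := by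
  have hrep : ∀ h : E n → ℝ, MemLp h 2 (volume.restrict A) → ∃ h' : E n → ℝ, Measurable h' ∧
      MemLp h' 2 volume ∧ h =ᵐ[volume.restrict A] h' := by
    intro h hh
    have e : h =ᵐ[volume.restrict A] A.indicator (hh.1.mk h) := by
      filter_upwards [hh.1.ae_eq_mk, ae_restrict_mem hA.measurableSet] with x hx hxA
      rw [indicator_of_mem hxA, hx]
    refine ⟨A.indicator (hh.1.mk h), hh.1.stronglyMeasurable_mk.measurable.indicator
      hA.measurableSet, ?_, e⟩
    rw [memLp_indicator_iff_restrict hA.measurableSet]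
    exact (memLp_congr_ae hh.1.ae_eq_mk).1 hh
  obtain ⟨u', um, uL, ue⟩ := hrep u hu
  obtain ⟨g', gm, gL, ge⟩ := hrep g hg
  obtain ⟨c', cm, cL, ce⟩ := hrep c hc
  have htrans : ∀ {a b a' b' : E n → ℝ}, IsWeakDirDeriv A w a b → a =ᵐ[volume.restrict A] a' →
      b =ᵐ[volume.restrict A] b' → IsWeakDirDeriv A w a' b' := by
    intro a b a' b' hab ha hb φ h1 h2 h3
    have key : ∀ {p p' ψ : E n → ℝ}, p =ᵐ[volume.restrict A] p' → (∀ x, x ∉ A → ψ x = 0) →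
        ∫ x, p' x * ψ x = ∫ x, p x * ψ x := by
      intro p p' ψ hp h0
      have hz : ∀ h : E n → ℝ, ∫ x in A, h x * ψ x = ∫ x, h x * ψ x := fun h =>
        setIntegral_eq_integral_of_forall_compl_eq_zero fun x hx => by simp [h0 x hx]
      rw [← hz, ← hz]
      exact integral_congr_ae (hp.mono fun x hx => by simp only [hx])
    rw [key ha fun x hx => ?_, key hb fun x hx => ?_]
    · exact hab φ h1 h2 h3
    · exact image_eq_zero_of_notMem_tsupport fun h => hx (h3 h)
    · have : fderiv ℝ φ x = 0 := by
        by_contra h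
        exact hx (h3 (support_fderiv_subset ℝ h))
      simp [this]
  have main := lintegral_sq_deriv_le_of_measurable hA (htrans hug ue ge) (htrans hgc ge ce)
    uL gL cL um gm cm
  have hsub : segmentSet A w ⊆ A := fun x hx => by simpa using hx 0 ⟨le_rfl, zero_le_one⟩
  have e1 : ∫⁻ x in segmentSet A w, ENNReal.ofReal (g x ^ 2)
      = ∫⁻ x in segmentSet A w, ENNReal.ofReal (g' x ^ 2) := by
    refine lintegral_congr_ae ?_
    filter_upwards [ae_mono (Measure.restrict_mono hsub le_rfl) ge] with x hx
    rw [hx]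
  have e2 : ∫⁻ x in A, ENNReal.ofReal ((|u x| - 1) ^ 2 + c x ^ 2)
      = ∫⁻ x in A, ENNReal.ofReal ((|u' x| - 1) ^ 2 + c' x ^ 2) := by
    refine lintegral_congr_ae ?_
    filter_upwards [ue, ce] with x hx hx'
    rw [hx, hx']
  rw [e1, e2]
  exact main

theorem fderiv_apply_eq_sum {n : ℕ} (φ : E n → ℝ) (x w : E n) :
    fderiv ℝ φ x w = ∑ i, w i * partialDeriv i φ x := by
  conv_lhs => rw [← (EuclideanSpace.basisFun (Fin n) ℝ).sum_repr w]
  simp [partialDeriv, map_sum]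

theorem isWeakDirDeriv_sum {n : ℕ} {A : Set (E n)} {u : E n → ℝ} {g : Fin n → E n → ℝ} (w : E n)
    (h : ∀ i, IsWeakPartial A i u (g i)) (hu : MemLp u 2 (volume.restrict A))
    (hg : ∀ i, MemLp (g i) 2 (volume.restrict A)) :
    IsWeakDirDeriv A w u (fun x => ∑ i, w i * g i x) := by
  intro φ h1 h2 h3
  have hdc : ∀ i, HasCompactSupport (partialDeriv i φ) := fun i =>
    h2.mono' ((subset_tsupport _).trans (tsupport_partialDeriv_subset φ i))
  have hds := fun i => (tsupport_partialDeriv_subset φ i).trans h3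
  simp_rw [fderiv_apply_eq_sum, Finset.mul_sum, Finset.sum_mul]
  rw [integral_finsetSum, integral_finsetSum, ← Finset.sum_neg_distrib]
  · refine Finset.sum_congr rfl fun i _ => ?_
    have := isWeakPartial_iff.1 (h i) φ h1 h2 h3
    have e1 : ∫ x, u x * (w i * partialDeriv i φ x) = w i * ∫ x, u x * partialDeriv i φ x := by
      rw [← integral_const_mul]; congr 1; ext x; ring
    have e2 : ∫ x, w i * g i x * φ x = w i * ∫ x, g i x * φ x := by
      rw [← integral_const_mul]; congr 1; ext x; ring
    rw [e1, e2, this]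
    ring
  · intro i _
    have := (integrable_mul_of_tsupport_subset (hg i) h1.continuous h2 h3).const_mul (w i)
    simpa only [mul_assoc] using this
  · intro i _
    have := (integrable_mul_of_tsupport_subset hu (contDiff_partialDeriv h1 i).continuous
      (hdc i) (hds i)).const_mul (w i)
    simpa only [mul_left_comm] using this

theorem IsWeakDirDeriv.sum {n : ℕ} {A : Set (E n)} {w : E n} {v h : Fin n → E n → ℝ}
    (a : Fin n → ℝ) (hvh : ∀ i, IsWeakDirDeriv A w (v i) (h i))
    (hv : ∀ i, MemLp (v i) 2 (volume.restrict A)) (hh : ∀ i, MemLp (h i) 2 (volume.restrict A)) :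
    IsWeakDirDeriv A w (fun x => ∑ i, a i * v i x) (fun x => ∑ i, a i * h i x) := by
  intro φ h1 h2 h3
  have hdc : Continuous fun x => fderiv ℝ φ x w :=
    (h1.continuous_fderiv (by simp)).clm_apply continuous_const
  have hds : HasCompactSupport fun x => fderiv ℝ φ x w :=
    (h2.fderiv ℝ).comp_left (g := fun L : E n →L[ℝ] ℝ => L w) rfl
  have hdt : tsupport (fun x => fderiv ℝ φ x w) ⊆ A := by
    refine (closure_minimal (fun x hx => ?_) (isClosed_tsupport φ)).trans h3
    refine support_fderiv_subset ℝ (f := φ) fun h => hx ?_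
    simp [h]
  simp_rw [Finset.sum_mul, mul_assoc]
  rw [integral_finsetSum, integral_finsetSum, ← Finset.sum_neg_distrib]
  · refine Finset.sum_congr rfl fun i _ => ?_
    rw [integral_const_mul, integral_const_mul, hvh i φ h1 h2 h3]
    ring
  · exact fun i _ => (integrable_mul_of_tsupport_subset (hh i) h1.continuous h2 h3).const_mul _
  · exact fun i _ => (integrable_mul_of_tsupport_subset (hv i) hdc hds hdt).const_mul _

theorem sq_sum_mul_le {ι : Type*} [Fintype ι] (a b : ι → ℝ) :
    (∑ i, a i * b i) ^ 2 ≤ (∑ i, a i ^ 2) * ∑ i, b i ^ 2 :=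
  Finset.sum_mul_sq_le_sq_mul_sq _ _ _

theorem sq_hess_apply_le {n : ℕ} (w : E n) (M : Mat n) :
    (∑ i, w i * ∑ j, w j * M (i, j)) ^ 2 ≤ (‖w‖ ^ 2) ^ 2 * ‖M‖ ^ 2 := by
  have h1 : ∑ i, (∑ j, w j * M (i, j)) ^ 2 ≤ ‖w‖ ^ 2 * ‖M‖ ^ 2 := by
    rw [EuclideanSpace.real_norm_sq_eq M, Fintype.sum_prod_type, Finset.mul_sum]
    refine Finset.sum_le_sum fun i _ => ?_
    rw [EuclideanSpace.real_norm_sq_eq w]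
    exact sq_sum_mul_le _ _
  refine (sq_sum_mul_le _ _).trans ?_
  rw [← EuclideanSpace.real_norm_sq_eq w, sq (‖w‖ ^ 2), mul_assoc]
  exact mul_le_mul_of_nonneg_left h1 (sq_nonneg _)

/-- The second derivative along `w` is quadratic in `w`, so its square scales like `‖w‖ ^ 4`. For
`w` of length of order `ε` this produces the factor `ε ^ 4` of the functional. -/
theorem IsW22With.lintegral_sq_deriv_le {n : ℕ} {A : Set (E n)} (hA : IsOpen A) {u : E n → ℝ}
    {G : E n → E n} {H : E n → Mat n} (h : IsW22With A u G H) (w : E n) :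
    ∫⁻ x in segmentSet A w, ENNReal.ofReal ((∑ i, w i * G x i) ^ 2) ≤
      512 * ∫⁻ x in A, ENNReal.ofReal ((|u x| - 1) ^ 2 + (‖w‖ ^ 2) ^ 2 * ‖H x‖ ^ 2) := by
  have hG := fun i => h.memLp_grad.eval_piLp i
  have hH := fun p => h.memLp_hess.eval_piLp p
  have hsum : ∀ {v : Fin n → E n → ℝ} (a : Fin n → ℝ),
      (∀ i, MemLp (v i) 2 (volume.restrict A)) →
      MemLp (fun x => ∑ i, a i * v i x) 2 (volume.restrict A) := fun a hv =>
    memLp_finsetSum _ fun i _ => (hv i).const_mul (a i)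
  have d1 := isWeakDirDeriv_sum w h.grad h.memLp hG
  have d2 := fun i => isWeakDirDeriv_sum w (h.hess i) (hG i) fun j => hH (i, j)
  have m2 := fun i => hsum (v := fun j x => H x (i, j)) (fun j => w j) fun j => hH (i, j)
  have d3 := IsWeakDirDeriv.sum (fun i => w i) d2 hG m2
  refine (PhaseTransition.lintegral_sq_deriv_le hA d1 d3 h.memLp (hsum _ hG) (hsum _ m2)).trans ?_
  gcongr 512 * ?_
  refine lintegral_mono fun x => ENNReal.ofReal_le_ofReal ?_
  gcongr
  exact sq_hess_apply_le w (H x)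

/-! ### Fans of directions -/

/-- The sign `±1` of a truth value. -/
def boolSign (b : Bool) : ℝ := if b then 1 else -1

theorem boolSign_true : boolSign true = 1 := rfl

theorem boolSign_false : boolSign false = -1 := rfl

theorem boolSign_mul_self (b : Bool) : boolSign b * boolSign b = 1 := by
  cases b <;> simp [boolSign]

/-- Directions in the orthant with signs `σ`. -/
noncomputable def fanDir {n : ℕ} (σ : Fin n → Bool) (o : Option (Fin n)) : E n :=
  WithLp.toLp 2 fun i => 1 / 8 * boolSign (σ i) * (1 + if o = some i then 1 else 0)

theorem norm_fanDir_sq_le {n : ℕ} (σ : Fin n → Bool) (o : Option (Fin n)) :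
    ‖fanDir σ o‖ ^ 2 ≤ n := by
  rw [EuclideanSpace.real_norm_sq_eq]
  calc ∑ i, (fanDir σ o i) ^ 2 ≤ ∑ _i : Fin n, (1 : ℝ) := by
        refine Finset.sum_le_sum fun i _ => ?_
        simp only [fanDir, mul_pow]
        rw [sq (boolSign _), boolSign_mul_self]
        split_ifs <;> norm_num
    _ = n := by simp

/-- From each point of `A`, the segments of some fan of directions stay in `A`. -/
def HasFans {n : ℕ} (A : Set (E n)) (ε : ℝ) (e : E n ≃ₗᵢ[ℝ] E n) : Prop :=
  ∀ x ∈ A, ∃ σ : Fin n → Bool, ∀ o, x ∈ segmentSet A (ε • e (fanDir σ o))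

/-- The direction `some j` differs from the direction `none` by `± 1/8` of the `j`-th unit vector,
so each coordinate of `p` is `± 8` times a difference of two inner products. The constant is `128 =
2 · 8²`; the factor `n` arises because the `none` term serves all coordinates. -/
theorem norm_sq_le_sum_fan {n : ℕ} (hn : 1 ≤ n) (σ : Fin n → Bool) (p : E n) :
    ‖p‖ ^ 2 ≤ 128 * n * ∑ o : Option (Fin n), (inner ℝ (fanDir σ o) p) ^ 2 := by
  set a : Option (Fin n) → ℝ := fun o => inner ℝ (fanDir σ o) p with ha
  have hexp : ∀ o, a o = ∑ i, 1 / 8 * boolSign (σ i) * (1 + if o = some i then 1 else 0) * p i := by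
    intro o
    simp only [ha, PiLp.inner_apply, fanDir]
    refine Finset.sum_congr rfl fun i _ => ?_
    simp [mul_comm]
  have hdiff : ∀ j, p j = 8 * boolSign (σ j) * (a (some j) - a none) := by
    intro j
    have h1 : a (some j) - a none = 1 / 8 * boolSign (σ j) * p j := by
      rw [hexp, hexp, ← Finset.sum_sub_distrib, Finset.sum_eq_single j]
      · simp; ring
      · intro b _ hb
        simp [hb.symm]
      · simp
    rw [h1]
    have := boolSign_mul_self (σ j)
    linear_combination -(p j) * this
  have hsq : ∀ j, p j ^ 2 ≤ 128 * a (some j) ^ 2 + 128 * a none ^ 2 := by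
    intro j
    rw [hdiff j, mul_pow, mul_pow, sq (boolSign _), boolSign_mul_self]
    nlinarith [sq_nonneg (a (some j) + a none)]
  have hn' : (1 : ℝ) ≤ n := by exact_mod_cast hn
  have hS : 0 ≤ ∑ j, a (some j) ^ 2 := Finset.sum_nonneg fun _ _ => sq_nonneg _
  calc ‖p‖ ^ 2 = ∑ j, p j ^ 2 := EuclideanSpace.real_norm_sq_eq p
    _ ≤ ∑ j, (128 * a (some j) ^ 2 + 128 * a none ^ 2) := Finset.sum_le_sum fun j _ => hsq j
    _ = 128 * (∑ j, a (some j) ^ 2) + 128 * n * a none ^ 2 := by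
        rw [Finset.sum_add_distrib, ← Finset.mul_sum]; simp; ring
    _ ≤ 128 * n * ∑ o, a o ^ 2 := by
        rw [Fintype.sum_option]
        nlinarith

/-- The number of directions in all fans. -/
noncomputable def fanConst (n : ℕ) : ℝ :=
  1 / (128 * n * (Fintype.card ((Fin n → Bool) × Option (Fin n))) * 512 * n ^ 2)

theorem fanConst_pos {n : ℕ} (hn : 1 ≤ n) : 0 < fanConst n := by
  have : 0 < n := hn
  unfold fanConst
  have : 0 < Fintype.card ((Fin n → Bool) × Option (Fin n)) := Fintype.card_pos
  positivity

/-- Which fan fits into `A` varies with the point. Summing over all sign patterns, each term cut off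
to its own segment set, always includes a complete fitting fan; every term is bounded by the
directional estimate, and `fanConst` is the inverse of the product of the constants. -/
theorem HasFans.lintegral_grad_le {n : ℕ} (hn : 1 ≤ n) {A : Set (E n)} (hA : IsOpen A) {ε : ℝ}
    {e : E n ≃ₗᵢ[ℝ] E n} (hfan : HasFans A ε e) {u : E n → ℝ} {G : E n → E n}
    {H : E n → Mat n} (h : IsW22With A u G H) :
    ENNReal.ofReal (fanConst n) * ∫⁻ x in A, ENNReal.ofReal (ε ^ 2 * ‖G x‖ ^ 2) ≤
      ∫⁻ x in A, ENNReal.ofReal ((|u x| - 1) ^ 2 + ε ^ 4 * ‖H x‖ ^ 2) := by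
  classical
  have hn0 : (0 : ℝ) < n := by exact_mod_cast hn
  have hn1 : (1 : ℝ) ≤ n := by exact_mod_cast hn
  set ι := (Fin n → Bool) × Option (Fin n) with hι
  set w : ι → E n := fun i => ε • e (fanDir i.1 i.2) with hw
  set R := ∫⁻ x in A, ENNReal.ofReal ((|u x| - 1) ^ 2 + ε ^ 4 * ‖H x‖ ^ 2) with hR
  have hwn : ∀ i, (‖w i‖ ^ 2) ^ 2 ≤ n ^ 2 * ε ^ 4 := by
    intro i
    have h1 := norm_fanDir_sq_le i.1 i.2
    have h2 : ‖w i‖ ^ 2 = ε ^ 2 * ‖fanDir i.1 i.2‖ ^ 2 := by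
      simp [hw, norm_smul, mul_pow]
    rw [h2, mul_pow]
    calc (ε ^ 2) ^ 2 * (‖fanDir i.1 i.2‖ ^ 2) ^ 2 ≤ (ε ^ 2) ^ 2 * (n : ℝ) ^ 2 := by gcongr
      _ = _ := by ring
  have hi : ∀ i, ∫⁻ x in segmentSet A (w i), ENNReal.ofReal ((∑ k, w i k * G x k) ^ 2) ≤
      512 * (ENNReal.ofReal (n ^ 2) * R) := by
    intro i
    refine (h.lintegral_sq_deriv_le hA (w i)).trans ?_
    gcongr 512 * ?_
    rw [hR, ← lintegral_const_mul' _ _ ENNReal.ofReal_ne_top]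
    refine lintegral_mono fun x => ?_
    rw [← ENNReal.ofReal_mul (by positivity)]
    refine ENNReal.ofReal_le_ofReal ?_
    have h1 := mul_le_mul_of_nonneg_right (hwn i) (sq_nonneg ‖H x‖)
    have h2 : (1 : ℝ) ≤ (n : ℝ) ^ 2 := one_le_pow₀ hn1
    nlinarith [sq_nonneg (|u x| - 1)]
  have hpt : ∀ x ∈ A, ENNReal.ofReal (ε ^ 2 * ‖G x‖ ^ 2) ≤ ENNReal.ofReal (128 * n) *
      ∑ i : ι, (segmentSet A (w i)).indicator
        (fun x => ENNReal.ofReal ((∑ k, w i k * G x k) ^ 2)) x := by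
    intro x hx
    obtain ⟨σ, hσ⟩ := hfan x hx
    have h1 := norm_sq_le_sum_fan hn σ (e.symm (G x))
    have h2 : ∀ o, (∑ k, w (σ, o) k * G x k) = ε * inner ℝ (fanDir σ o) (e.symm (G x)) := by
      intro o
      rw [← e.inner_map_map, e.apply_symm_apply, ← real_inner_smul_left, PiLp.inner_apply]
      refine Finset.sum_congr rfl fun i _ => ?_
      simp [hw, mul_comm]
    calc ENNReal.ofReal (ε ^ 2 * ‖G x‖ ^ 2)
        ≤ ENNReal.ofReal (128 * n * ∑ o, (∑ k, w (σ, o) k * G x k) ^ 2) := by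
          refine ENNReal.ofReal_le_ofReal ?_
          simp_rw [h2, mul_pow]
          rw [← Finset.mul_sum]
          rw [LinearIsometryEquiv.norm_map] at h1
          nlinarith [mul_le_mul_of_nonneg_left h1 (sq_nonneg ε)]
      _ = ENNReal.ofReal (128 * n) * ∑ o, (segmentSet A (w (σ, o))).indicator
          (fun x => ENNReal.ofReal ((∑ k, w (σ, o) k * G x k) ^ 2)) x := by
          rw [ENNReal.ofReal_mul (by positivity),
            ENNReal.ofReal_sum_of_nonneg fun _ _ => sq_nonneg _]
          congr 1
          exact Finset.sum_congr rfl fun o _ => by rw [indicator_of_mem (hσ o)]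
      _ ≤ _ := by
          gcongr
          rw [Fintype.sum_prod_type]
          exact Finset.single_le_sum (f := fun σ => ∑ o, (segmentSet A (w (σ, o))).indicator
            (fun x => ENNReal.ofReal ((∑ k, w (σ, o) k * G x k) ^ 2)) x)
            (fun _ _ => zero_le) (Finset.mem_univ σ)
  have hmeas : ∀ i, AEMeasurable ((segmentSet A (w i)).indicator
      (fun x => ENNReal.ofReal ((∑ k, w i k * G x k) ^ 2))) (volume.restrict A) := by
    intro i
    refine AEMeasurable.indicator ?_ (isOpen_segmentSet hA _).measurableSet
    refine AEMeasurable.ennreal_ofReal (AEMeasurable.pow_const ?_ 2)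
    exact Finset.aemeasurable_fun_sum _ fun k _ =>
      (h.memLp_grad.eval_piLp k).1.aemeasurable.const_mul _
  have hmain : ∫⁻ x in A, ENNReal.ofReal (ε ^ 2 * ‖G x‖ ^ 2) ≤
      ENNReal.ofReal (128 * n) * (Fintype.card ι * (512 * (ENNReal.ofReal (n ^ 2) * R))) := by
    calc ∫⁻ x in A, ENNReal.ofReal (ε ^ 2 * ‖G x‖ ^ 2)
        ≤ ∫⁻ x in A, ENNReal.ofReal (128 * n) * ∑ i : ι, (segmentSet A (w i)).indicator
            (fun x => ENNReal.ofReal ((∑ k, w i k * G x k) ^ 2)) x :=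
          setLIntegral_mono' hA.measurableSet hpt
      _ = ENNReal.ofReal (128 * n) * ∑ i : ι, ∫⁻ x in A, (segmentSet A (w i)).indicator
            (fun x => ENNReal.ofReal ((∑ k, w i k * G x k) ^ 2)) x := by
          rw [lintegral_const_mul' _ _ ENNReal.ofReal_ne_top,
            lintegral_finsetSum' _ fun i _ => hmeas i]
      _ ≤ ENNReal.ofReal (128 * n) * ∑ _i : ι, (512 * (ENNReal.ofReal (n ^ 2) * R)) := by
          gcongr with i
          refine (lintegral_mono' Measure.restrict_le_self le_rfl).trans ?_
          rw [lintegral_indicator (isOpen_segmentSet hA _).measurableSet]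
          exact hi i
      _ = _ := by simp [Finset.sum_const, nsmul_eq_mul]
  have hcard : (0 : ℝ) < Fintype.card ι := by exact_mod_cast Fintype.card_pos
  calc ENNReal.ofReal (fanConst n) * ∫⁻ x in A, ENNReal.ofReal (ε ^ 2 * ‖G x‖ ^ 2)
      ≤ ENNReal.ofReal (fanConst n) * (ENNReal.ofReal (128 * n) *
          (Fintype.card ι * (512 * (ENNReal.ofReal (n ^ 2) * R)))) := by gcongr
    _ = ENNReal.ofReal (fanConst n * (128 * n * (Fintype.card ι * (512 * n ^ 2)))) * R := by
        rw [ENNReal.ofReal_mul (fanConst_pos hn).le,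
          ENNReal.ofReal_mul (p := 128 * (n : ℝ)) (by positivity),
          ENNReal.ofReal_mul (p := (Fintype.card ι : ℝ)) (by positivity),
          ENNReal.ofReal_mul (p := (512 : ℝ)) (by positivity),
          ENNReal.ofReal_natCast, ENNReal.ofReal_ofNat]
        ring
    _ = R := by
        have : fanConst n * (128 * n * (Fintype.card ι * (512 * n ^ 2))) = 1 := by
          unfold fanConst
          field_simp
          rfl
        rw [this]; simp

/-- The bound `(|s| - 1)² ≤ W s` turns the geometric estimate into one for `W`; if `W(u)` is not
integrable the functional is `⊤`. -/
theorem HasFans.Mminus_nonneg {n : ℕ} (hn : 1 ≤ n) {W : ℝ → ℝ} (hW : IsDoubleWell W)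
    {A : Set (E n)} (hA : IsOpen A) {ε : ℝ} (hε : 0 < ε) {e : E n ≃ₗᵢ[ℝ] E n}
    (hfan : HasFans A ε e) {u : E n → ℝ} (hu : MemW22 A u) {q : ℝ} (hq : q ≤ fanConst n) :
    0 ≤ Mminus W q ε u A := by
  obtain ⟨G, H, h⟩ := hu
  by_cases hi : IntegrableOn (fun x => W (u x)) A
  swap
  · rw [Mminus_eq_top hA h hW.continuous hW.nonneg q hε hi]
    exact le_top
  rw [Mminus_nonneg_iff hA h q hε hi]
  have iG := h.memLp_grad.integrable_norm_sq
  have iH := h.memLp_hess.integrable_norm_sq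
  have key := hfan.lintegral_grad_le hn hA h
  have hRle : ∫⁻ x in A, ENNReal.ofReal ((|u x| - 1) ^ 2 + ε ^ 4 * ‖H x‖ ^ 2) ≤
      ENNReal.ofReal ((∫ x in A, W (u x)) + ε ^ 4 * ∫ x in A, ‖H x‖ ^ 2) := by
    have hs : Integrable (fun x => W (u x) + ε ^ 4 * ‖H x‖ ^ 2) (volume.restrict A) :=
      Integrable.add hi (iH.const_mul _)
    rw [← integral_const_mul, ← integral_add hi (iH.const_mul _),
      ofReal_integral_eq_lintegral_ofReal hs (Eventually.of_forall fun x => by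
          have := hW.nonneg (u x); simp only [Pi.zero_apply]; positivity)]
    refine lintegral_mono fun x => ENNReal.ofReal_le_ofReal ?_
    have := hW.lower (u x)
    linarith
  have hL : ∫⁻ x in A, ENNReal.ofReal (ε ^ 2 * ‖G x‖ ^ 2) =
      ENNReal.ofReal (ε ^ 2 * ∫ x in A, ‖G x‖ ^ 2) := by
    rw [← integral_const_mul, ofReal_integral_eq_lintegral_ofReal (iG.const_mul _)
      (Eventually.of_forall fun x => by simp only [Pi.zero_apply]; positivity)]
  have h0 : 0 ≤ ∫ x in A, ‖G x‖ ^ 2 := integral_nonneg fun _ => sq_nonneg _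
  have h1 : 0 ≤ ∫ x in A, ‖H x‖ ^ 2 := integral_nonneg fun _ => sq_nonneg _
  have h2 : 0 ≤ ∫ x in A, W (u x) := integral_nonneg fun _ => hW.nonneg _
  rw [hL, ← ENNReal.ofReal_mul (fanConst_pos hn).le] at key
  have := (ENNReal.ofReal_le_ofReal_iff (by positivity)).1 (key.trans hRle)
  exact (mul_le_mul_of_nonneg_right hq (by positivity)).trans this

/-! ### Charts of `C¹` domains -/

/-- `A` is a `C¹` subgraph near `x`. -/
def HasC1Chart {n : ℕ} (A : Set (E n)) (x : E n) : Prop :=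
  ∃ ν : E n, ‖ν‖ = 1 ∧
    ∃ γ : ((Submodule.span ℝ {ν})ᗮ : Submodule ℝ (E n)) → ℝ, ContDiff ℝ 1 γ ∧
      ∃ r : ℝ, 0 < r ∧ ∀ y ∈ Metric.ball x r,
        (y ∈ A ↔ inner ℝ ν y < γ ((Submodule.span ℝ {ν})ᗮ.orthogonalProjectionOnto y))

theorem HasC1Chart.congr {n : ℕ} {A A' : Set (E n)} {x : E n} (h : HasC1Chart A x)
    (hA : ∀ᶠ y in 𝓝 x, (y ∈ A' ↔ y ∈ A)) : HasC1Chart A' x := by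
  obtain ⟨ν, hν, γ, hγ, r, hr, hc⟩ := h
  obtain ⟨r', hr', h'⟩ := Metric.eventually_nhds_iff_ball.1 hA
  refine ⟨ν, hν, γ, hγ, min r r', lt_min hr hr', fun y hy => ?_⟩
  rw [h' y (Metric.ball_subset_ball (min_le_right _ _) hy)]
  exact hc y (Metric.ball_subset_ball (min_le_left _ _) hy)

/-- `g` is the height above the graph. That it grows at unit rate along `ν` is the transversality
exploited wherever a chart is used below. -/
theorem HasC1Chart.exists_defining {n : ℕ} {A : Set (E n)} {x : E n} (h : HasC1Chart A x) :
    ∃ (g : E n → ℝ) (ν : E n), ContDiff ℝ 1 g ∧ ν ≠ 0 ∧ (∀ y (t : ℝ), g (y + t • ν) = g y + t) ∧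
      ∀ᶠ y in 𝓝 x, (y ∈ A ↔ g y < 0) := by
  obtain ⟨ν, hν, γ, hγ, r, hr, hc⟩ := h
  set P := (Submodule.span ℝ {ν})ᗮ.orthogonalProjectionOnto with hP
  refine ⟨fun y => inner ℝ ν y - γ (P y), ν, ?_, fun h0 => by simp [h0] at hν, ?_, ?_⟩
  · exact (contDiff_const.inner ℝ contDiff_id).sub (hγ.comp P.contDiff)
  · intro y t
    have h0 : P ν = 0 := by
      rw [hP, Submodule.orthogonalProjectionOnto_eq_zero_iff, Submodule.orthogonal_orthogonal]
      exact Submodule.mem_span_singleton_self ν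
    simp only [map_add, map_smul, h0, smul_zero, add_zero, inner_add_right, inner_smul_right,
      real_inner_self_eq_norm_sq, hν]
    ring
  · filter_upwards [Metric.ball_mem_nhds x hr] with y hy
    rw [hc y hy, sub_neg]

theorem defining_zero_of_mem_frontier {n : ℕ} {A : Set (E n)} (hA : IsOpen A) {x : E n}
    {g : E n → ℝ} (hg : ContDiff ℝ 1 g) (hAg : ∀ᶠ y in 𝓝 x, (y ∈ A ↔ g y < 0)) :
    ∀ᶠ y in 𝓝 x, y ∈ frontier A → g y = 0 := by
  filter_upwards [eventually_eventually_nhds.2 hAg] with y hy hyf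
  rcases lt_trichotomy (g y) 0 with h | h | h
  · have : y ∈ A := hy.self_of_nhds.2 h
    rw [hA.frontier_eq] at hyf
    exact absurd this hyf.2
  · exact h
  · exfalso
    have hev : ∀ᶠ z in 𝓝 y, z ∉ A := by
      filter_upwards [hy, hg.continuous.continuousAt.eventually (lt_mem_nhds h)] with z hz hz'
      rw [hz]
      exact not_lt.2 (le_of_lt hz')
    have : y ∉ closure A := by
      rw [mem_closure_iff_frequently]
      simpa using hev
    exact this (frontier_subset_closure hyf)

theorem IsC1Domain.chart {n : ℕ} {A : Set (E n)} (hA : IsC1Domain A) {x : E n}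
    (hx : x ∈ frontier A) : HasC1Chart A x := hA.boundary x hx

-- Locally the frontier lies in `{g = 0}`. The translates of this set by `ν / (k + 1)` lie on the
-- distinct levels `1 / (k + 1)`, hence are disjoint; infinitely many disjoint translates by bounded
-- vectors force measure zero.
open scoped Pointwise in
theorem IsC1Domain.volume_frontier {n : ℕ} {A : Set (E n)} (hA : IsC1Domain A) :
    volume (frontier A) = 0 := by
  have hcpt : IsCompact (frontier A) :=
    Metric.isCompact_of_isClosed_isBounded isClosed_frontier
      (hA.isBounded.closure.subset frontier_subset_closure)
  refine hcpt.measure_zero_of_nhdsWithin fun x hx => ?_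
  obtain ⟨g, ν, hg, hν, hgν, hAg⟩ := (hA.chart hx).exists_defining
  have h0 := defining_zero_of_mem_frontier hA.isOpen hg hAg
  obtain ⟨U, hU, hUx⟩ := eventually_iff_exists_mem.1 h0
  refine ⟨frontier A ∩ U, inter_mem self_mem_nhdsWithin (mem_nhdsWithin_of_mem_nhds hU), ?_⟩
  refine measure_mono_null (t := {y : E n | g y = 0}) (fun y hy => hUx y hy.2 hy.1) ?_
  refine Measure.addHaar_eq_zero_of_disjoint_translates volume
    (u := fun k : ℕ => ((1 : ℝ) / (k + 1)) • ν) ?_ ?_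
    (isClosed_eq hg.continuous continuous_const).measurableSet
  · refine isBounded_iff_forall_norm_le.2 ⟨‖ν‖, ?_⟩
    rintro _ ⟨k, rfl⟩
    simp only
    rw [norm_smul, Real.norm_of_nonneg (by positivity)]
    refine mul_le_of_le_one_left (norm_nonneg _) ?_
    rw [div_le_one (by positivity)]
    linarith [(Nat.cast_nonneg k : (0 : ℝ) ≤ k)]
  · have hval : ∀ (k : ℕ) (z : E n), z ∈ ({((1 : ℝ) / (k + 1)) • ν} : Set (E n)) + {y : E n | g y = 0} →
        g z = 1 / (k + 1) := by
      rintro k z ⟨a, rfl, y, hy, rfl⟩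
      have : g y = 0 := hy
      simp only
      rw [add_comm, hgν, this, zero_add]
    intro i j hij
    rw [Function.onFun, Set.disjoint_left]
    intro z hz hz'
    have h1 := (hval i z hz).symm.trans (hval j z hz')
    rw [one_div, one_div, inv_inj] at h1
    exact hij (by exact_mod_cast add_right_cancel h1)

/-! ### Fans in rectangles and in `C¹` domains; existence of a threshold constant. -/

theorem IsLargeRectangle.exists_hasFans {n : ℕ} {R : Set (E n)} (hR : IsLargeRectangle R) :
    IsOpen R ∧ ∃ e, HasFans R 1 e := by
  obtain ⟨e, a, b, hab, rfl⟩ := hR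
  constructor
  · refine e.toHomeomorph.isOpenMap _ ?_
    have hc : ∀ i, Continuous fun y : E n => y i := fun i => by fun_prop
    rw [Set.ofPred_forall]
    refine isOpen_iInter_of_finite fun i => ?_
    exact (isOpen_lt continuous_const (hc i)).inter (isOpen_lt (hc i) continuous_const)
  · refine ⟨e, ?_⟩
    rintro _ ⟨y, hy, rfl⟩
    -- In each coordinate the fan points to the farther face, at distance at least `1/2`, and moves
    -- by at most `1/4`.
    refine ⟨fun i => decide (y i ≤ (a i + b i) / 2), fun o s hs => ?_⟩
    refine ⟨y + s • fanDir (fun i => decide (y i ≤ (a i + b i) / 2)) o, fun i => ?_,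
      by simp [map_add, map_smul]⟩
    have h1 := hy i
    have h2 := hab i
    have hs0 := hs.1
    have hs1 := hs.2
    by_cases h : y i ≤ (a i + b i) / 2
    · simp only [PiLp.add_apply, PiLp.smul_apply, smul_eq_mul, fanDir, h, decide_true,
        boolSign_true]
      split_ifs <;> constructor <;> nlinarith
    · simp only [PiLp.add_apply, PiLp.smul_apply, smul_eq_mul, fanDir, decide_eq_false h, boolSign_false]
      push Not at h
      split_ifs <;> constructor <;> nlinarith

/-- With signs opposite to those of the partial derivatives of `g` at `x`, every direction of the
fan decreases the linearization at rate at least `c`, which is positive because `L ν = 1`. Strict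
differentiability transfers this to all nearby base points with a uniform length `ρ`. -/
theorem HasC1Chart.exists_fan {n : ℕ} {A : Set (E n)} {x : E n} (h : HasC1Chart A x) :
    ∃ U ∈ 𝓝 x, ∃ ρ : ℝ, 0 < ρ ∧ ∀ y ∈ A ∩ U, ∃ σ : Fin n → Bool, ∀ o, ∀ t ∈ Icc (0 : ℝ) ρ,
      y + t • fanDir σ o ∈ A := by
  obtain ⟨g, ν, hg, hν, hgν, hAg⟩ := h.exists_defining
  set L := fderiv ℝ g x with hL
  have hstrict : HasStrictFDerivAt g L x := hg.contDiffAt.hasStrictFDerivAt (by norm_num)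
  have hLν : L ν = 1 := by
    have h1 : HasDerivAt (fun t : ℝ => g (x + t • ν)) (L ν) 0 := by
      have hin : HasDerivAt (fun t : ℝ => x + t • ν) ν 0 := by
        simpa using ((hasDerivAt_id (0 : ℝ)).smul_const ν).const_add x
      have : HasFDerivAt g L (x + (0 : ℝ) • ν) := by simpa using hstrict.hasFDerivAt
      exact this.comp_hasDerivAt 0 hin
    have h2 : HasDerivAt (fun t : ℝ => g (x + t • ν)) 1 0 := by
      simp_rw [hgν]
      exact (hasDerivAt_id (0 : ℝ)).const_add _
    exact h1.unique h2
  set σ : Fin n → Bool := fun i => decide (L (EuclideanSpace.single i 1) ≤ 0) with hσ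
  set c : ℝ := 1 / 8 * ∑ i, |L (EuclideanSpace.single i 1)| with hc
  have hLfan : ∀ o, L (fanDir σ o) ≤ -c := by
    intro o
    have e1 : L (fanDir σ o) = ∑ i, fanDir σ o i * L (EuclideanSpace.single i 1) := by
      conv_lhs => rw [← (EuclideanSpace.basisFun (Fin n) ℝ).sum_repr (fanDir σ o)]
      simp [map_sum]
    rw [e1, hc, Finset.mul_sum, ← Finset.sum_neg_distrib]
    refine Finset.sum_le_sum fun i _ => ?_
    by_cases h : L (EuclideanSpace.single i 1) ≤ 0
    · simp only [fanDir, hσ, h, decide_true, boolSign_true, abs_of_nonpos h]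
      split_ifs <;> nlinarith
    · simp only [fanDir, hσ, decide_eq_false h, boolSign_false]
      push Not at h
      rw [abs_of_pos h]
      split_ifs <;> nlinarith
  have hcpos : 0 < c := by
    have h0 : 0 ≤ c := by positivity
    refine lt_of_le_of_ne h0 fun hc0 => ?_
    have h1 : ∑ i, |L (EuclideanSpace.single i 1)| = 0 := by
      rw [hc] at hc0
      linarith
    have h2 := (Finset.sum_eq_zero_iff_of_nonneg fun i _ => abs_nonneg _).1 h1
    have e1 : L ν = ∑ i, ν i * L (EuclideanSpace.single i 1) := by
      conv_lhs => rw [← (EuclideanSpace.basisFun (Fin n) ℝ).sum_repr ν]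
      simp [map_sum]
    rw [e1, Finset.sum_eq_zero] at hLν
    · exact zero_ne_one hLν
    · intro i hi
      rw [abs_eq_zero.1 (h2 i hi), mul_zero]
  have hfn : ∀ o, ‖fanDir σ o‖ ≤ n + 1 := by
    intro o
    have := norm_fanDir_sq_le σ o
    have hn0 : (0 : ℝ) ≤ n := Nat.cast_nonneg n
    nlinarith [norm_nonneg (fanDir σ o)]
  -- Fan directions have norm at most `n + 1`, so this tolerance keeps the error below half of the
  -- decrease `c * t`.
  have hη : 0 < c / (2 * (n + 1)) := by positivity
  have hev := hstrict.isLittleO.def hη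
  rw [nhds_prod_eq, ← nhds_prod_eq] at hev
  obtain ⟨r, hr, hball⟩ := Metric.eventually_nhds_iff_ball.1 hev
  obtain ⟨r', hr', hball'⟩ := Metric.eventually_nhds_iff_ball.1 hAg
  set d := min r r' with hd
  have hdpos : 0 < d := lt_min hr hr'
  refine ⟨Metric.ball x (d / 2), Metric.ball_mem_nhds x (by positivity), d / (4 * (n + 1)),
    by positivity, fun y hy => ⟨σ, fun o t ht => ?_⟩⟩
  have hyd : dist y x < d / 2 := hy.2
  have htn : t * ‖fanDir σ o‖ ≤ d / 4 := by
    calc t * ‖fanDir σ o‖ ≤ d / (4 * (n + 1)) * (n + 1) :=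
          mul_le_mul ht.2 (hfn o) (norm_nonneg _) (by positivity)
      _ = d / 4 := by field_simp
  have hzd : dist (y + t • fanDir σ o) x < d := by
    have : dist (y + t • fanDir σ o) y ≤ d / 4 := by
      rw [dist_eq_norm, add_sub_cancel_left, norm_smul, Real.norm_of_nonneg ht.1]
      exact htn
    linarith [dist_triangle (y + t • fanDir σ o) y x]
  have hyA : g y < 0 := (hball' y (lt_of_lt_of_le (by linarith) (min_le_right r r'))).1 hy.1
  rw [hball' _ (lt_of_lt_of_le hzd (min_le_right r r'))]
  have hpair : (y + t • fanDir σ o, y) ∈ Metric.ball (x, x) r := by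
    rw [Metric.mem_ball, Prod.dist_eq]
    exact max_lt (lt_of_lt_of_le hzd (min_le_left _ _))
      (lt_of_lt_of_le (by linarith) (min_le_left r r'))
  have hest := hball _ hpair
  simp only [add_sub_cancel_left, map_smul, smul_eq_mul, norm_smul, Real.norm_of_nonneg ht.1]
    at hest
  have h1 := (abs_le.1 hest).2
  have h2 : c / (2 * (n + 1)) * (t * ‖fanDir σ o‖) ≤ c / 2 * t := by
    calc c / (2 * (n + 1)) * (t * ‖fanDir σ o‖) ≤ c / (2 * (n + 1)) * (t * (n + 1)) := by
          gcongr
          · exact ht.1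
          · exact hfn o
      _ = c / 2 * t := by field_simp
  have h3 := mul_le_mul_of_nonneg_left (hLfan o) ht.1
  nlinarith [mul_nonneg ht.1 hcpos.le]

/-- Compactness of `closure A` makes the segment length uniform. At interior points any short fan
works; at the frontier a chart provides one. -/
theorem IsC1Domain.exists_hasFans {n : ℕ} {A : Set (E n)} (hA : IsC1Domain A) :
    ∃ ε₀ : ℝ, 0 < ε₀ ∧ ∀ ε, 0 < ε → ε < ε₀ → HasFans A ε (LinearIsometryEquiv.refl ℝ (E n)) := by
  have hcpt : IsCompact (closure A) := hA.isBounded.isCompact_closure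
  have main : ∃ ρ : ℝ, 0 < ρ ∧ ∀ y ∈ A ∩ closure A, ∃ σ : Fin n → Bool, ∀ o,
      ∀ t ∈ Icc (0 : ℝ) ρ, y + t • fanDir σ o ∈ A := by
    refine hcpt.induction_on (p := fun S => ∃ ρ : ℝ, 0 < ρ ∧ ∀ y ∈ A ∩ S, ∃ σ : Fin n → Bool,
      ∀ o, ∀ t ∈ Icc (0 : ℝ) ρ, y + t • fanDir σ o ∈ A) ⟨1, one_pos, by simp⟩ ?_ ?_ ?_
    · rintro S T hST ⟨ρ, hρ, h⟩
      exact ⟨ρ, hρ, fun y hy => h y ⟨hy.1, hST hy.2⟩⟩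
    · rintro S T ⟨ρ, hρ, h⟩ ⟨ρ', hρ', h'⟩
      refine ⟨min ρ ρ', lt_min hρ hρ', fun y hy => ?_⟩
      rcases hy.2 with hyS | hyT
      · obtain ⟨σ, hσ⟩ := h y ⟨hy.1, hyS⟩
        exact ⟨σ, fun o t ht => hσ o t ⟨ht.1, ht.2.trans (min_le_left _ _)⟩⟩
      · obtain ⟨σ, hσ⟩ := h' y ⟨hy.1, hyT⟩
        exact ⟨σ, fun o t ht => hσ o t ⟨ht.1, ht.2.trans (min_le_right _ _)⟩⟩
    · intro x hx
      by_cases hxA : x ∈ A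
      · obtain ⟨r, hr, hball⟩ := Metric.isOpen_iff.1 hA.isOpen x hxA
        refine ⟨Metric.ball x (r / 2), mem_nhdsWithin_of_mem_nhds
          (Metric.ball_mem_nhds x (by positivity)), r / (2 * (n + 1)), by positivity,
          fun y hy => ⟨fun _ => true, fun o t ht => hball ?_⟩⟩
        have hfn : ‖fanDir (fun _ : Fin n => true) o‖ ≤ n + 1 := by
          have := norm_fanDir_sq_le (fun _ : Fin n => true) o
          have hn0 : (0 : ℝ) ≤ n := Nat.cast_nonneg n
          nlinarith [norm_nonneg (fanDir (fun _ : Fin n => true) o)]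
        have hd : dist (y + t • fanDir (fun _ => true) o) y ≤ r / 2 := by
          rw [dist_eq_norm, add_sub_cancel_left, norm_smul, Real.norm_of_nonneg ht.1]
          calc t * ‖fanDir (fun _ : Fin n => true) o‖ ≤ r / (2 * (n + 1)) * (n + 1) :=
                mul_le_mul ht.2 hfn (norm_nonneg _) (by positivity)
            _ = r / 2 := by field_simp
        have hy2 : dist y x < r / 2 := hy.2
        rw [Metric.mem_ball]
        linarith [dist_triangle (y + t • fanDir (fun _ => true) o) y x]
      · have hxf : x ∈ frontier A := by
          rw [hA.isOpen.frontier_eq]; exact ⟨hx, hxA⟩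
        obtain ⟨U, hU, ρ, hρ, h⟩ := (hA.chart hxf).exists_fan
        exact ⟨U, mem_nhdsWithin_of_mem_nhds hU, ρ, hρ, h⟩
  obtain ⟨ρ, hρ, h⟩ := main
  refine ⟨ρ, hρ, fun ε hε hερ x hx => ?_⟩
  obtain ⟨σ, hσ⟩ := h x ⟨hx, subset_closure hx⟩
  refine ⟨σ, fun o s hs => ?_⟩
  rw [LinearIsometryEquiv.coe_refl, id, smul_smul]
  exact hσ o (s * ε) ⟨by have := hs.1; positivity, by nlinarith [hs.1, hs.2]⟩

/-- The witness is `n` times `fanConst n`, since the definition compares `q` with `qs / n`. -/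
theorem exists_isThreshold {n : ℕ} (hn : 1 ≤ n) {W : ℝ → ℝ} (hW : IsDoubleWell W) :
    ∃ qs : ℝ, IsThreshold n W qs := by
  have hn0 : (0 : ℝ) < n := by exact_mod_cast hn
  have hdiv : fanConst n * n / n = fanConst n := by field_simp
  refine ⟨fanConst n * n, mul_pos (fanConst_pos hn) hn0, ?_, ?_⟩
  · intro q hq R hR u hu
    rw [hdiv] at hq
    obtain ⟨hO, e, he⟩ := hR.exists_hasFans
    exact he.Mminus_nonneg hn hW hO one_pos hu hq.le
  · intro q hq A hA
    rw [hdiv] at hq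
    obtain ⟨ε₀, hε₀, h⟩ := hA.exists_hasFans
    exact ⟨ε₀, hε₀, fun ε hε hεε u hu => (h ε hε hεε).Mminus_nonneg hn hW hA.isOpen hε hu hq.le⟩

/-! ### Charts of sublevel sets by the inverse function theorem; complements and differences of `C¹`
domains. -/

theorem coe_projection_orthogonal_singleton {n : ℕ} {ν : E n} (hν : ‖ν‖ = 1) (y : E n) :
    ((Submodule.span ℝ {ν})ᗮ.orthogonalProjectionOnto y : E n) = y - (inner ℝ ν y : ℝ) • ν := by
  rw [Submodule.orthogonalProjectionOnto_orthogonal]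
  simp [Submodule.starProjection_unit_singleton ℝ hν]

/-- A chart asks for a graph function that is `C¹` on the entire hyperplane, while the inverse
function theorem yields only a local one; multiplication by a bump function repairs this. -/
theorem exists_contDiff_eventuallyEq {F : Type*} [NormedAddCommGroup F] [InnerProductSpace ℝ F]
    [FiniteDimensional ℝ F] {g : F → ℝ} {z : F} (hg : ContDiffAt ℝ 1 g z) :
    ∃ γ : F → ℝ, ContDiff ℝ 1 γ ∧ γ =ᶠ[𝓝 z] g := by
  obtain ⟨r, hr, hball⟩ := Metric.eventually_nhds_iff_ball.1 (hg.eventually (by simp))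
  let f : ContDiffBump z := ⟨r / 4, r / 2, by positivity, by linarith⟩
  refine ⟨fun y => f y * g y, contDiff_iff_contDiffAt.2 fun y => ?_, ?_⟩
  · by_cases hy : y ∈ Metric.ball z r
    · exact f.contDiff.contDiffAt.mul (hball y hy)
    · have hyt : y ∉ tsupport f := by
        rw [f.tsupport_eq, Metric.mem_closedBall]
        rw [Metric.mem_ball] at hy
        show ¬ dist y z ≤ r / 2
        push Not at hy ⊢
        linarith
      refine (contDiffAt_const (c := (0 : ℝ))).congr_of_eventuallyEq ?_
      filter_upwards [(isClosed_tsupport f).isOpen_compl.mem_nhds hyt] with w hw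
      rw [image_eq_zero_of_notMem_tsupport hw, zero_mul]
  · filter_upwards [f.eventuallyEq_one] with y hy
    rw [hy, Pi.one_apply, one_mul]

/-- Sublevel sets of `C¹` functions have `C¹` charts at regular points. -/
theorem hasC1Chart_sublevel {n : ℕ} {h : E n → ℝ} (hh : ContDiff ℝ 1 h) {x : E n}
    (hx0 : h x = 0) (hx : fderiv ℝ h x ≠ 0) : HasC1Chart {y | h y < 0} x := by
  set L := fderiv ℝ h x with hL
  set a : E n := (InnerProductSpace.toDual ℝ (E n)).symm L with ha
  have hLa : ∀ y, L y = inner ℝ a y := fun y => by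
    rw [ha, InnerProductSpace.toDual_symm_apply]
  set c : ℝ := ‖a‖ with hc
  have hcpos : 0 < c := by
    rw [hc, norm_pos_iff, ha]
    exact fun h0 => hx ((LinearIsometryEquiv.map_eq_zero_iff _).1 h0)
  set ν : E n := c⁻¹ • a with hνdef
  have hν : ‖ν‖ = 1 := by
    rw [hνdef, norm_smul, Real.norm_of_nonneg (by positivity)]
    exact inv_mul_cancel₀ hcpos.ne'
  have hLν : ∀ y, L y = c * inner ℝ ν y := fun y => by
    rw [hLa, hνdef, real_inner_smul_left, mul_inv_cancel_left₀ hcpos.ne']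
  have hνν : (inner ℝ ν ν : ℝ) = 1 := by rw [real_inner_self_eq_norm_sq, hν, one_pow]
  have hstrict : HasStrictFDerivAt h L x := hh.contDiffAt.hasStrictFDerivAt (by norm_num)
  set P := (Submodule.span ℝ {ν})ᗮ.orthogonalProjectionOnto with hP
  have hPc : ∀ y, (P y : E n) = y - (inner ℝ ν y : ℝ) • ν :=
    coe_projection_orthogonal_singleton hν
  -- straightening map
  set F : E n → E n := fun y => y + (c⁻¹ * h y - inner ℝ ν y) • ν with hF
  have hFc : ContDiff ℝ 1 F :=
    contDiff_id.add (((contDiff_const.mul hh).sub (contDiff_const.inner ℝ contDiff_id)).smul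
      contDiff_const)
  -- Since `L y = c ⟪ν, y⟫`, the correction term has zero derivative at `x`.
  have hF' : HasFDerivAt F ((ContinuousLinearEquiv.refl ℝ (E n) : E n ≃L[ℝ] E n) :
      E n →L[ℝ] E n) x := by
    have h1 := (hasFDerivAt_id x).add (((hstrict.hasFDerivAt.const_mul c⁻¹).sub
      ((innerSL ℝ ν).hasFDerivAt (x := x))).smul_const ν)
    refine h1.congr_fderiv ?_
    ext1 y
    simp [hLν, inv_mul_cancel_left₀ hcpos.ne']
  have hFat : ContDiffAt ℝ 1 F x := hFc.contDiffAt
  have hFs : HasStrictFDerivAt F ((ContinuousLinearEquiv.refl ℝ (E n) : E n ≃L[ℝ] E n) :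
      E n →L[ℝ] E n) x := hFat.hasStrictFDerivAt' hF' (by norm_num)
  set Φ := hFs.localInverse F _ x with hΦ
  have hΦc : ContDiffAt ℝ 1 Φ (F x) := hFat.to_localInverse hF' (by norm_num)
  have hΦr : ∀ᶠ z in 𝓝 (F x), F (Φ z) = z := hFs.eventually_right_inverse
  have hΦt : Tendsto Φ (𝓝 (F x)) (𝓝 x) := hFs.localInverse_tendsto
  have hFx : F x = P x := by
    rw [hPc, hF]
    simp [hx0, sub_eq_add_neg]
  -- `F` replaces the height of a point by `h / c`, so it maps the zero set into the hyperplane; the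
  -- height of `Φ z` is then that of the zero set above `z`.
  obtain ⟨γ, hγ, hγe⟩ := exists_contDiff_eventuallyEq
    (g := fun z : ((Submodule.span ℝ {ν})ᗮ : Submodule ℝ (E n)) => (inner ℝ ν (Φ z) : ℝ))
    (z := P x) (by
      refine contDiffAt_const.inner ℝ ?_
      have h1 : ContDiffAt ℝ 1 Φ (Submodule.subtypeL _ (P x)) := by
        rw [Submodule.subtypeL_apply, ← hFx]; exact hΦc
      exact h1.comp (P x) ((Submodule.span ℝ {ν})ᗮ : Submodule ℝ (E n)).subtypeL.contDiff.contDiffAt)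
  refine ⟨ν, hν, γ, hγ, ?_⟩
  have hPt : Tendsto (fun y => (P y : E n)) (𝓝 x) (𝓝 (F x)) := by
    rw [hFx]
    exact (continuous_subtype_val.comp P.continuous).tendsto x
  have hpair : Tendsto (fun y => (y, Φ (P y))) (𝓝 x) (𝓝 (x, x)) := by
    rw [nhds_prod_eq]
    exact tendsto_id.prodMk (hΦt.comp hPt)
  have hest := hpair.eventually (hstrict.isLittleO.def (half_pos hcpos))
  have hmain : ∀ᶠ y in 𝓝 x, (y ∈ {y | h y < 0} ↔ inner ℝ ν y < γ (P y)) := by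
    filter_upwards [hest, hPt.eventually hΦr, (P.continuous.tendsto x).eventually hγe]
      with y h1 h2 h3
    -- `p` is the zero of `h` on the line through `y` parallel to `ν`, so `y - p = τ • ν`. Strict
    -- differentiability with tolerance `c / 2` gives `|h y - c τ| ≤ (c / 2) |τ|`, whence `h y` and
    -- `τ` have the same sign.
    set p := Φ (P y) with hp
    set τ : ℝ := inner ℝ ν y - γ (P y) with hτ
    have hγp : γ (P y) = inner ℝ ν p := h3
    have hzν : (inner ℝ ν (P y : E n) : ℝ) = 0 := by
      rw [hPc, inner_sub_right, inner_smul_right, hνν]; ring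
    have hFp : p + (c⁻¹ * h p - inner ℝ ν p) • ν = P y := h2
    have hp0 : h p = 0 := by
      have := congrArg (fun z => (inner ℝ ν z : ℝ)) hFp
      simp only [inner_add_right, inner_smul_right, hνν, hzν] at this
      have h4 : c⁻¹ * h p = 0 := by linarith
      rcases mul_eq_zero.1 h4 with h5 | h5
      · exact absurd h5 (inv_pos.2 hcpos).ne'
      · exact h5
    have hyp : y - p = τ • ν := by
      have e1 : y = P y + (inner ℝ ν y : ℝ) • ν := by rw [hPc]; simp
      have e2 : p = P y + (inner ℝ ν p : ℝ) • ν := by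
        rw [← hFp, hp0]
        module
      rw [hτ, hγp]
      nth_rewrite 1 [e1]
      nth_rewrite 1 [e2]
      module
    simp only [hp0, hyp, norm_smul, hν, hLν, inner_smul_right, hνν, mul_one, sub_zero,
      Real.norm_eq_abs] at h1
    have h4 := abs_le.1 h1
    have : inner ℝ ν y < γ (P y) ↔ τ < 0 := by rw [hτ, sub_neg]
    rw [this]
    change h y < 0 ↔ τ < 0
    constructor
    · intro h5
      by_contra! h6
      rw [abs_of_nonneg h6] at h4
      nlinarith [h4.1]
    · intro h5
      rw [abs_of_neg h5] at h4
      nlinarith [h4.2]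
  obtain ⟨r, hr, hball⟩ := Metric.eventually_nhds_iff_ball.1 hmain
  exact ⟨r, hr, hball⟩

/-- Near `x` the closure is `{g ≤ 0}`: a point with `g = 0` is the limit of points moved slightly
along `-ν`. The exterior is therefore the sublevel set of `-g`, whose derivative along `ν` is `-1`.
-/
theorem HasC1Chart.compl_closure {n : ℕ} {A : Set (E n)} {x : E n} (hx : x ∈ frontier A)
    (hA : IsOpen A) (h : HasC1Chart A x) : HasC1Chart (closure A)ᶜ x := by
  obtain ⟨g, ν, hg, hν, hgν, hAg⟩ := h.exists_defining
  have hgx : g x = 0 := (defining_zero_of_mem_frontier hA hg hAg).self_of_nhds hx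
  have hfd : fderiv ℝ (fun y => -g y) x ≠ 0 := by
    intro h0
    have hneg : fderiv ℝ (fun y => -g y) x = -fderiv ℝ g x := fderiv_neg
    have h1 : HasDerivAt (fun t : ℝ => g (x + t • ν)) (fderiv ℝ g x ν) 0 := by
      have hin : HasDerivAt (fun t : ℝ => x + t • ν) ν 0 := by
        simpa using ((hasDerivAt_id (0 : ℝ)).smul_const ν).const_add x
      have : HasFDerivAt g (fderiv ℝ g x) (x + (0 : ℝ) • ν) := by
        simpa using (hg.differentiable (by norm_num) x).hasFDerivAt
      exact this.comp_hasDerivAt 0 hin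
    have h2 : HasDerivAt (fun t : ℝ => g (x + t • ν)) 1 0 := by
      simp_rw [hgν]
      exact (hasDerivAt_id (0 : ℝ)).const_add _
    have h3 := h1.unique h2
    rw [hneg, neg_eq_zero] at h0
    rw [h0] at h3
    simp at h3
  refine (hasC1Chart_sublevel hg.neg (by simp [hgx]) hfd).congr ?_
  filter_upwards [eventually_eventually_nhds.2 hAg] with y hy
  change y ∉ closure A ↔ -g y < 0
  rw [neg_lt_zero, ← not_le, not_iff_not]
  constructor
  · intro hyc
    by_contra! hgy
    rw [mem_closure_iff_frequently] at hyc
    refine hyc ?_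
    filter_upwards [hy, hg.continuous.continuousAt.eventually (lt_mem_nhds hgy)] with z hz hz'
    rw [hz]
    exact not_lt.2 (le_of_lt hz')
  · intro hgy
    have ht : Tendsto (fun t : ℝ => y + t • ν) (𝓝[<] 0) (𝓝 y) := by
      have hc : Continuous fun t : ℝ => y + t • ν := by fun_prop
      have := hc.tendsto 0
      simp only [zero_smul, add_zero] at this
      exact this.mono_left nhdsWithin_le_nhds
    refine mem_closure_of_tendsto ht ?_
    filter_upwards [ht.eventually hy, self_mem_nhdsWithin] with t ht' ht0
    rw [ht', hgν]
    have : t < 0 := ht0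
    linarith

/-- As `closure A ⊆ A'`, the two boundary pieces are disjoint, and near each boundary point only one
of the two sets matters. -/
theorem IsC1Domain.diff_closure {n : ℕ} {A A' : Set (E n)} (hA : IsC1Domain A)
    (hA' : IsC1Domain A') (h : closure A ⊆ A') : IsC1Domain (A' \ closure A) where
  isOpen := hA'.isOpen.sdiff isClosed_closure
  isBounded := hA'.isBounded.subset Set.sdiff_subset
  boundary x hx := by
    have hO : IsOpen (A' \ closure A) := hA'.isOpen.sdiff isClosed_closure
    rw [hO.frontier_eq] at hx
    by_cases hxA : x ∈ closure A
    · have hxf : x ∈ frontier A := by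
        rw [hA.isOpen.frontier_eq]
        refine ⟨hxA, fun hxA' => ?_⟩
        obtain ⟨y, hy1, hy2⟩ := mem_closure_iff.1 hx.1 A hA.isOpen hxA'
        exact hy2.2 (subset_closure hy1)
      refine ((hA.chart hxf).compl_closure hxf hA.isOpen).congr ?_
      filter_upwards [hA'.isOpen.mem_nhds (h hxA)] with y hy
      simp [hy]
    · have hxf : x ∈ frontier A' := by
        rw [hA'.isOpen.frontier_eq]
        exact ⟨closure_mono Set.sdiff_subset hx.1, fun h' => hx.2 ⟨h', hxA⟩⟩
      refine (hA'.chart hxf).congr ?_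
      filter_upwards [isClosed_closure.isOpen_compl.mem_nhds hxA] with y hy
      simp only [Set.mem_sdiff, and_iff_left_iff_imp]
      exact fun _ => hy

/-! ### Cut-off profiles with few critical values -/

/-- `η` is a smooth profile between `A` and `A'`, with countably many critical values in
`(1/4, 3/4)`. -/
structure IsProfile {n : ℕ} (A A' : Set (E n)) (η : E n → ℝ) : Prop where
  contDiff : ContDiff ℝ ∞ η
  hasCompactSupport : HasCompactSupport η
  superlevel : ∀ x, 1 / 4 ≤ η x → x ∈ A'
  gt_of_mem : ∀ x ∈ closure A, 3 / 4 < η x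
  countable : {t : ℝ | t ∈ Ioo (1 / 4 : ℝ) (3 / 4) ∧ ∃ x, η x = t ∧ fderiv ℝ η x = 0}.Countable

/-- The equidimensional case of Sard's theorem for the gradient map: almost every `a` is a regular
value. For such `a` the solutions of `∇η = a` are isolated, and a discrete subset of Euclidean space
is countable. -/
theorem exists_small_nondegenerate {n : ℕ} {η : E n → ℝ} (hη : ContDiff ℝ ∞ η) {δ : ℝ}
    (hδ : 0 < δ) : ∃ a : E n, ‖a‖ < δ ∧
      {x | (InnerProductSpace.toDual ℝ (E n)).symm (fderiv ℝ η x) = a}.Countable := by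
  set F : E n → E n := fun x => (InnerProductSpace.toDual ℝ (E n)).symm (fderiv ℝ η x) with hF
  have hFd : Differentiable ℝ F := by
    have h1 : ContDiff ℝ 1 (fderiv ℝ η) := hη.fderiv_right (m := 1) (by norm_cast)
    have h2 : Differentiable ℝ fun L : E n →L[ℝ] ℝ =>
        (InnerProductSpace.toDual ℝ (E n)).symm L :=
      ((InnerProductSpace.toDual ℝ (E n)).symm.toContinuousLinearEquiv :
        (E n →L[ℝ] ℝ) ≃L[ℝ] E n).differentiable
    exact h2.comp (h1.differentiable (by norm_num))
  set Z := {x | (fderiv ℝ F x).det = 0} with hZ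
  have hnull : volume (F '' Z) = 0 :=
    addHaar_image_eq_zero_of_det_fderivWithin_eq_zero volume
      (fun x _ => (hFd x).hasFDerivAt.hasFDerivWithinAt) fun x hx => hx
  obtain ⟨a, ha, haZ⟩ : ∃ a ∈ Metric.ball (0 : E n) δ, a ∉ F '' Z := by
    by_contra! hcon
    have h1 : volume (Metric.ball (0 : E n) δ) = 0 := measure_mono_null hcon hnull
    exact (Metric.measure_ball_pos volume (0 : E n) hδ).ne' h1
  refine ⟨a, by simpa using ha, ?_⟩
  have hdisc : DiscreteTopology {x | F x = a} := by
    rw [discreteTopology_subtype_iff]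
    intro x hx
    have hdet : (fderiv ℝ F x).det ≠ 0 := fun h0 => haZ ⟨x, h0, hx⟩
    have hanti : ∃ C, AntilipschitzWith C (fderiv ℝ F x) := by
      exact ⟨_, ((fderiv ℝ F x).toContinuousLinearEquivOfDetNeZero hdet).antilipschitz⟩
    have hev := (hFd x).hasFDerivAt.eventually_ne (c := a) hanti
    rw [← disjoint_iff, disjoint_principal_right]
    filter_upwards [hev] with z hz using hz
  exact countable_coe_iff.1 (countable_of_Lindelof_of_discrete (X := {x | F x = a}))

/-- A smooth Urysohn function `f` is tilted by the small linear function `⟪a, x⟫`, truncated by `ρ`.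
Where the tilt is untruncated, critical points are solutions of `∇f = a`, countably many for a
suitable `a`. -/
theorem exists_isProfile {n : ℕ} {A A' : Set (E n)} (hA' : IsOpen A')
    (hb : Bornology.IsBounded A') (h : closure A ⊆ A') : ∃ η, IsProfile A A' η := by
  obtain ⟨f, hf0, hf1, hf01⟩ := exists_contMDiffMap_zero_one_of_isClosed (n := ⊤)
    (modelWithCornersSelf ℝ (E n)) hA'.isClosed_compl (isClosed_closure (s := A))
    (disjoint_left.2 fun x hx hx' => hx (h hx'))
  have hfs : ContDiff ℝ ∞ f := f.contMDiff.contDiff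
  obtain ⟨R, hR, hball⟩ : ∃ R > 0, A' ⊆ Metric.ball (0 : E n) R := by
    obtain ⟨R, hR⟩ := hb.subset_ball 0
    exact ⟨max R 1, by positivity, hR.trans (Metric.ball_subset_ball (le_max_left _ _))⟩
  let ρ : ContDiffBump (0 : E n) := ⟨R, R + 1, hR, by linarith⟩
  -- `ρ` vanishes outside the ball of radius `R + 1`, so the tilt is everywhere smaller than `1/8`.
  obtain ⟨a, ha, hcount⟩ := exists_small_nondegenerate hfs (δ := 1 / (8 * (R + 1)))
    (by positivity)
  have hsmall : ∀ x, |ρ x * inner ℝ a x| < 1 / 8 := by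
    intro x
    by_cases hx : x ∈ Metric.ball (0 : E n) (R + 1)
    · have h1 : ‖x‖ < R + 1 := by simpa using hx
      have h2 : |(inner ℝ a x : ℝ)| ≤ ‖a‖ * ‖x‖ := abs_real_inner_le_norm a x
      have h3 : ‖a‖ * ‖x‖ < 1 / (8 * (R + 1)) * (R + 1) :=
        mul_lt_mul'' ha h1 (norm_nonneg _) (norm_nonneg _)
      have h4 : 1 / (8 * (R + 1)) * (R + 1) = 1 / 8 := by field_simp
      rw [abs_mul, abs_of_nonneg ρ.nonneg]
      calc ρ x * |(inner ℝ a x : ℝ)| ≤ 1 * |(inner ℝ a x : ℝ)| :=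
            mul_le_mul_of_nonneg_right ρ.le_one (abs_nonneg _)
        _ < 1 / 8 := by linarith
    · have : ρ x = 0 := by
        have h1 : x ∉ Function.support ρ := by rw [ρ.support_eq]; exact hx
        simpa using h1
      rw [this]; norm_num
  have hη : ContDiff ℝ ∞ fun x => f x - ρ x * inner ℝ a x :=
    hfs.sub (ρ.contDiff.mul (contDiff_const.inner ℝ contDiff_id))
  have hsup : ∀ x, 1 / 4 ≤ f x - ρ x * inner ℝ a x → x ∈ A' := by
    intro x hx
    by_contra hxA
    have h1 : f x = 0 := hf0 hxA
    have := (abs_lt.1 (hsmall x)).1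
    linarith
  refine ⟨fun x => f x - ρ x * inner ℝ a x, hη, ?_, hsup, ?_, ?_⟩
  · refine HasCompactSupport.intro (isCompact_closedBall (0 : E n) (R + 1)) fun x hx => ?_
    have h1 : ‖x‖ > R + 1 := by simpa using hx
    have hxA : x ∉ A' := fun h' => by
      have : ‖x‖ < R := by simpa using hball h'
      linarith
    have h2 : f x = 0 := hf0 hxA
    have h3 : ρ x = 0 := by
      have h4 : x ∉ Function.support ρ := by
        rw [ρ.support_eq, Metric.mem_ball, dist_zero_right]
        exact not_lt.2 (le_of_lt h1)
      simpa using h4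
    simp [h2, h3]
  · intro x hx
    have h1 : f x = 1 := hf1 hx
    have := (abs_lt.1 (hsmall x)).2
    linarith
  · refine (hcount.image fun x => f x - ρ x * inner ℝ a x).mono ?_
    rintro t ⟨ht, x, hxt, hx⟩
    refine ⟨x, ?_, hxt⟩
    -- Levels above `1/4` occur only in `A'`, near whose points `ρ = 1` and the tilt is exactly
    -- linear.
    have hxA : x ∈ A' := hsup x (by rw [hxt]; exact ht.1.le)
    have hev : (fun y => f y - ρ y * inner ℝ a y) =ᶠ[𝓝 x] fun y => f y - inner ℝ a y := by
      filter_upwards [Metric.isOpen_ball.mem_nhds (hball hxA)] with y hy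
      rw [ρ.one_of_mem_closedBall (Metric.ball_subset_closedBall hy), one_mul]
    have hd : HasFDerivAt (fun y => f y - (inner ℝ a y : ℝ)) (fderiv ℝ f x - innerSL ℝ a) x :=
      (hfs.differentiable (by simp) x).hasFDerivAt.sub ((innerSL ℝ a).hasFDerivAt)
    rw [hev.fderiv_eq, hd.fderiv, sub_eq_zero] at hx
    show (InnerProductSpace.toDual ℝ (E n)).symm (fderiv ℝ f x) = a
    rw [hx, LinearIsometryEquiv.symm_apply_eq]
    rfl

/-- `t` is a regular value of `η`. -/
def IsRegularValue {n : ℕ} (η : E n → ℝ) (t : ℝ) : Prop := ∀ x, η x = t → fderiv ℝ η x ≠ 0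

/-- The boundary consists of a piece of the frontier of `A'` with `η < t` and a piece of the regular
level set, which lies inside `A'`; the two do not meet. -/
theorem IsProfile.isC1Domain_outer {n : ℕ} {A A' : Set (E n)} {η : E n → ℝ}
    (h : IsProfile A A' η) (hA' : IsC1Domain A') {t : ℝ} (ht : t ∈ Ioo (1 / 4 : ℝ) (3 / 4))
    (hreg : IsRegularValue η t) : IsC1Domain (A' ∩ {x | η x < t}) where
  isOpen := hA'.isOpen.inter (isOpen_lt h.contDiff.continuous continuous_const)
  isBounded := hA'.isBounded.subset inter_subset_left
  boundary x hx := by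
    have hηc := h.contDiff.continuous
    have hO : IsOpen (A' ∩ {x | η x < t}) :=
      hA'.isOpen.inter (isOpen_lt hηc continuous_const)
    rw [hO.frontier_eq] at hx
    have hle : η x ≤ t := by
      have : closure (A' ∩ {x | η x < t}) ⊆ {x | η x ≤ t} :=
        closure_minimal (fun y hy => show η y ≤ t from le_of_lt hy.2) (isClosed_le hηc continuous_const)
      exact this hx.1
    rcases hle.lt_or_eq with hlt | heq
    · have hxf : x ∈ frontier A' := by
        rw [hA'.isOpen.frontier_eq]
        exact ⟨closure_mono inter_subset_left hx.1, fun h' => hx.2 ⟨h', hlt⟩⟩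
      refine (hA'.chart hxf).congr ?_
      filter_upwards [(isOpen_lt hηc continuous_const).mem_nhds hlt] with y hy
      simp only [mem_inter_iff, and_iff_left_iff_imp]
      exact fun _ => hy
    · have hxA : x ∈ A' := h.superlevel x (by rw [heq]; exact ht.1.le)
      have hs := hasC1Chart_sublevel (h := fun y => η y - t) (x := x)
        ((h.contDiff.of_le (by norm_cast)).sub contDiff_const) (by simp [heq])
        (by rw [fderiv_sub_const]; exact hreg x heq)
      refine hs.congr ?_
      filter_upwards [hA'.isOpen.mem_nhds hxA] with y hy
      simp [hy]

/-- For `1/4 < t < 3/4` the level set lies in `A' \ closure A`, hence inside `B`, so again the two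
boundary pieces are separate. -/
theorem IsProfile.isC1Domain_inner {n : ℕ} {A A' B : Set (E n)} {η : E n → ℝ}
    (h : IsProfile A A' η) (hB : IsC1Domain B) (hAB : A' \ closure A ⊆ B) {t : ℝ}
    (ht : t ∈ Ioo (1 / 4 : ℝ) (3 / 4)) (hreg : IsRegularValue η t) :
    IsC1Domain (B ∩ {x | t < η x}) where
  isOpen := hB.isOpen.inter (isOpen_lt continuous_const h.contDiff.continuous)
  isBounded := hB.isBounded.subset inter_subset_left
  boundary x hx := by
    have hηc := h.contDiff.continuous
    have hO : IsOpen (B ∩ {x | t < η x}) :=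
      hB.isOpen.inter (isOpen_lt continuous_const hηc)
    rw [hO.frontier_eq] at hx
    have hle : t ≤ η x := by
      have : closure (B ∩ {x | t < η x}) ⊆ {x | t ≤ η x} :=
        closure_minimal (fun y hy => show t ≤ η y from le_of_lt hy.2) (isClosed_le continuous_const hηc)
      exact this hx.1
    rcases hle.lt_or_eq with hlt | heq
    · have hxf : x ∈ frontier B := by
        rw [hB.isOpen.frontier_eq]
        exact ⟨closure_mono inter_subset_left hx.1, fun h' => hx.2 ⟨h', hlt⟩⟩
      refine (hB.chart hxf).congr ?_
      filter_upwards [(isOpen_lt continuous_const hηc).mem_nhds hlt] with y hy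
      simp only [mem_inter_iff, and_iff_left_iff_imp]
      exact fun _ => hy
    · have hxB : x ∈ B := by
        refine hAB ⟨h.superlevel x (by rw [← heq]; exact ht.1.le), fun hx' => ?_⟩
        have := h.gt_of_mem x hx'
        rw [← heq] at this
        exact absurd ht.2 (not_lt.2 this.le)
      have hs := hasC1Chart_sublevel (h := fun y => t - η y) (x := x)
        (contDiff_const.sub (h.contDiff.of_le (by norm_cast))) (by simp [heq])
        (by
          rw [fderiv_const_sub, neg_ne_zero]
          exact hreg x heq.symm)
      refine hs.congr ?_
      filter_upwards [hB.isOpen.mem_nhds hxB] with y hy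
      simp [hy]

/-! ### The potential along segments -/

/-- The largest value of `W` between `a` and `b`. -/
noncomputable def hullPot (W : ℝ → ℝ) (a b : ℝ) : ℝ :=
  sSup ((fun θ => W (θ * a + (1 - θ) * b)) '' Icc (0 : ℝ) 1)

/-- Needed for the measurability of `x ↦ hullPot W (u x) (v x)`. -/
theorem continuous_hullPot {W : ℝ → ℝ} (hW : Continuous W) :
    Continuous fun p : ℝ × ℝ => hullPot W p.1 p.2 :=
  isCompact_Icc.continuous_sSup (f := fun (p : ℝ × ℝ) θ => W (θ * p.1 + (1 - θ) * p.2))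
    (hW.comp (by fun_prop))

theorem le_hullPot {W : ℝ → ℝ} (hW : Continuous W) (a b : ℝ) {θ : ℝ} (hθ : θ ∈ Icc (0 : ℝ) 1) :
    W (θ * a + (1 - θ) * b) ≤ hullPot W a b := by
  refine le_csSup ?_ (mem_image_of_mem _ hθ)
  exact (isCompact_Icc.image (hW.comp (by fun_prop))).bddAbove

theorem hullPot_le {W : ℝ → ℝ} {a b M : ℝ}
    (h : ∀ θ ∈ Icc (0 : ℝ) 1, W (θ * a + (1 - θ) * b) ≤ M) : hullPot W a b ≤ M := by
  refine csSup_le ⟨_, mem_image_of_mem _ (left_mem_Icc.2 zero_le_one)⟩ ?_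
  rintro _ ⟨θ, hθ, rfl⟩
  exact h θ hθ

theorem hullPot_nonneg {W : ℝ → ℝ} (hW : Continuous W) (h0 : ∀ s, 0 ≤ W s) (a b : ℝ) :
    0 ≤ hullPot W a b :=
  (h0 _).trans (le_hullPot hW a b (left_mem_Icc.2 zero_le_one))

theorem hullPot_self_le {W : ℝ → ℝ} (a : ℝ) : hullPot W a a ≤ W a :=
  hullPot_le fun θ _ => by
    have : θ * a + (1 - θ) * a = a := by ring
    rw [this]

/-- A point between `a` and `b` has modulus at most the larger of `|a|` and `|b|`, so almost
monotonicity applies with that endpoint. -/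
theorem hullPot_le_add {W : ℝ → ℝ} (hW0 : ∀ s, 0 ≤ W s) {c₀ : ℝ} (hc₀ : 0 ≤ c₀)
    (h : ∀ s t : ℝ, |s| ≤ |t| → W s ≤ c₀ * W t + c₀) (a b : ℝ) :
    hullPot W a b ≤ c₀ * (W a + W b) + c₀ := by
  refine hullPot_le fun θ hθ => ?_
  have h1 : |θ * a + (1 - θ) * b| ≤ θ * |a| + (1 - θ) * |b| := by
    refine (abs_add_le _ _).trans ?_
    rw [abs_mul, abs_mul, abs_of_nonneg hθ.1, abs_of_nonneg (sub_nonneg.2 hθ.2)]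
  have ha := mul_nonneg hc₀ (hW0 a)
  have hb := mul_nonneg hc₀ (hW0 b)
  have h0 := hθ.1
  have h2 := hθ.2
  rcases le_total |a| |b| with hab | hab
  · have := h (θ * a + (1 - θ) * b) b (h1.trans (by nlinarith))
    linarith
  · have := h (θ * a + (1 - θ) * b) a (h1.trans (by nlinarith))
    linarith

theorem IsDoubleWell.exists_small {W : ℝ → ℝ} (hW : IsDoubleWell W) {σ : ℝ} (hσ : 0 < σ) :
    ∃ δ > 0, ∀ s, |(|s| - 1)| < δ → W s < σ := by
  have h1 : W 1 = 0 := (hW.zero_iff 1).2 (Or.inr rfl)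
  have h2 : W (-1) = 0 := (hW.zero_iff (-1)).2 (Or.inl rfl)
  obtain ⟨δ₁, hδ₁, hd₁⟩ := Metric.continuous_iff.1 hW.continuous 1 σ hσ
  obtain ⟨δ₂, hδ₂, hd₂⟩ := Metric.continuous_iff.1 hW.continuous (-1) σ hσ
  refine ⟨min δ₁ δ₂, lt_min hδ₁ hδ₂, fun s hs => ?_⟩
  rcases le_total 0 s with h | h
  · rw [abs_of_nonneg h] at hs
    have := hd₁ s (by rw [Real.dist_eq]; exact lt_of_lt_of_le hs (min_le_left _ _))
    rw [h1, Real.dist_eq, sub_zero] at this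
    exact (le_abs_self _).trans_lt this
  · rw [abs_of_nonpos h] at hs
    have := hd₂ s (by
      rw [Real.dist_eq, ← abs_neg]
      refine lt_of_lt_of_le ?_ (min_le_right δ₁ δ₂)
      rwa [neg_sub, show -1 - s = -s - 1 by ring])
    rw [h2, Real.dist_eq, sub_zero] at this
    exact (le_abs_self _).trans_lt this

/-- If `W a + W b + |a - b|²` is small, then `a` is near a well and `b` near `a`, so the whole
segment stays near that well and `W ≤ σ` there. Otherwise the additive constant `c₀` of the growth
bound is absorbed by a large multiple of this sum. -/
theorem IsDoubleWell.exists_hullPot_le {W : ℝ → ℝ} (hW : IsDoubleWell W) {σ : ℝ} (hσ : 0 < σ) :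
    ∃ Cσ : ℝ, 0 ≤ Cσ ∧ ∀ a b, hullPot W a b ≤ σ + Cσ * (W a + W b + |a - b| ^ 2) := by
  obtain ⟨δ, hδ, hsmall⟩ := hW.exists_small hσ
  obtain ⟨c₀, hc₀, hmono⟩ := hW.almost_mono
  refine ⟨c₀ + c₀ / (δ / 2) ^ 2, by positivity, fun a b => ?_⟩
  have hWa := hW.nonneg a
  have hWb := hW.nonneg b
  have hsq := sq_nonneg |a - b|
  by_cases hm : W a + W b + |a - b| ^ 2 < (δ / 2) ^ 2
  · have h1 : hullPot W a b ≤ σ := by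
      refine hullPot_le fun θ hθ => (hsmall _ ?_).le
      have ha : |(|a| - 1)| < δ / 2 :=
        abs_lt_of_sq_lt_sq (by nlinarith [hW.lower a]) (by positivity)
      have hab : |a - b| < δ / 2 := by
        have := abs_lt_of_sq_lt_sq (show |a - b| ^ 2 < (δ / 2) ^ 2 by nlinarith) (by positivity)
        rwa [abs_abs] at this
      have h2 : |(|θ * a + (1 - θ) * b| - |a|)| ≤ |a - b| := by
        refine (abs_abs_sub_abs_le _ _).trans ?_
        have : θ * a + (1 - θ) * b - a = (1 - θ) * (b - a) := by ring
        rw [this, abs_mul, abs_of_nonneg (sub_nonneg.2 hθ.2), abs_sub_comm b a]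
        exact mul_le_of_le_one_left (abs_nonneg _) (by linarith [hθ.1])
      have h3 := abs_add_le (|θ * a + (1 - θ) * b| - |a|) (|a| - 1)
      rw [sub_add_sub_cancel] at h3
      linarith
    have : 0 ≤ (c₀ + c₀ / (δ / 2) ^ 2) * (W a + W b + |a - b| ^ 2) := by positivity
    linarith
  · push Not at hm
    have h1 := hullPot_le_add hW.nonneg (by linarith : (0 : ℝ) ≤ c₀) hmono a b
    have h2 : c₀ ≤ c₀ / (δ / 2) ^ 2 * (W a + W b + |a - b| ^ 2) := by
      rw [div_mul_eq_mul_div, le_div_iff₀ (by positivity)]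
      exact mul_le_mul_of_nonneg_left hm (by linarith)
    have h3 : 0 ≤ c₀ * |a - b| ^ 2 := by positivity
    nlinarith

/-! ### Selection of a layer -/

/-- By Fubini the layer measures integrate to `ε μ(univ)` over all levels, since each point lies in
the layers of an interval of levels of length `ε`. If all levels of `T` exceeded the bound, Markov's
inequality would contradict this. `T` need not be measurable. -/
theorem exists_mem_measure_layer_le {α : Type*} [MeasurableSpace α] (μ : Measure α)
    [IsFiniteMeasure μ] {η : α → ℝ} (hη : Measurable η) {ε : ℝ} (hε : 0 < ε) {T : Set ℝ}
    (hT : ENNReal.ofReal (1 / 8) < volume T) :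
    ∃ t ∈ T, μ {x | t ≤ η x ∧ η x ≤ t + ε} ≤ ENNReal.ofReal (8 * ε) * μ univ := by
  by_contra! hcon
  set h : ℝ → ℝ≥0∞ := fun t => μ {x | t ≤ η x ∧ η x ≤ t + ε} with hh
  have hset : MeasurableSet {p : ℝ × α | p.1 ≤ η p.2 ∧ η p.2 ≤ p.1 + ε} :=
    (measurableSet_le measurable_fst (hη.comp measurable_snd)).inter
      (measurableSet_le (hη.comp measurable_snd) (measurable_fst.add_const ε))
  have hm : Measurable h := measurable_measure_prodMk_left hset
  have htot : ∫⁻ t, h t = ENNReal.ofReal ε * μ univ := by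
    have h1 : ∫⁻ t, h t = (volume.prod μ) {p : ℝ × α | p.1 ≤ η p.2 ∧ η p.2 ≤ p.1 + ε} :=
      (Measure.prod_apply hset).symm
    rw [h1, Measure.prod_apply_symm hset]
    have h2 : ∀ x, volume ((fun t => (t, x)) ⁻¹' {p : ℝ × α | p.1 ≤ η p.2 ∧ η p.2 ≤ p.1 + ε})
        = ENNReal.ofReal ε := by
      intro x
      have : (fun t => (t, x)) ⁻¹' {p : ℝ × α | p.1 ≤ η p.2 ∧ η p.2 ≤ p.1 + ε}
          = Icc (η x - ε) (η x) := by
        ext t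
        simp only [mem_preimage, mem_ofPred_eq, mem_Icc]
        constructor
        · rintro ⟨h1, h2⟩; exact ⟨by linarith, h1⟩
        · rintro ⟨h1, h2⟩; exact ⟨h2, by linarith⟩
      rw [this, Real.volume_Icc]
      congr 1; ring
    simp_rw [h2]
    rw [lintegral_const]
  obtain ⟨t₀, ht₀⟩ : T.Nonempty := by
    rw [nonempty_iff_ne_empty]
    rintro rfl
    simp at hT
  have hpos : μ univ ≠ 0 := by
    intro h0
    have h1 := hcon t₀ ht₀
    rw [h0, mul_zero] at h1
    exact absurd (h1.trans_le (measure_mono (subset_univ _))) (by simp [h0])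
  have hfin : μ univ ≠ ⊤ := measure_ne_top μ univ
  have hmk := mul_meas_ge_le_lintegral (μ := volume) hm (ENNReal.ofReal (8 * ε) * μ univ)
  have hTle : volume T ≤ volume {t | ENNReal.ofReal (8 * ε) * μ univ ≤ h t} :=
    measure_mono fun t ht => (hcon t ht).le
  have hcpos : ENNReal.ofReal ε * μ univ ≠ 0 :=
    mul_ne_zero (by simpa using hε) hpos
  have hcfin : ENNReal.ofReal ε * μ univ ≠ ⊤ := ENNReal.mul_ne_top ENNReal.ofReal_ne_top hfin
  have h8 : ENNReal.ofReal (8 * ε) * μ univ * ENNReal.ofReal (1 / 8) = ENNReal.ofReal ε * μ univ := by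
    rw [mul_right_comm, ← ENNReal.ofReal_mul (by positivity)]
    congr 2; ring
  have hlt : ENNReal.ofReal (8 * ε) * μ univ * ENNReal.ofReal (1 / 8) <
      ENNReal.ofReal (8 * ε) * μ univ * volume T := by
    refine (ENNReal.mul_lt_mul_iff_right ?_ ?_).2 hT
    · exact mul_ne_zero (by simpa using hε) hpos
    · exact ENNReal.mul_ne_top ENNReal.ofReal_ne_top hfin
  rw [h8, ← htot] at hlt
  refine absurd hlt (not_lt.2 ?_)
  exact le_trans (by gcongr) hmk

/-- The levels at which both sides of the layer satisfy the lower bound below scale `δ`. -/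
def goodLevels {n : ℕ} (W : ℝ → ℝ) (q : ℝ) (A' B : Set (E n)) (η : E n → ℝ) (δ : ℝ) : Set ℝ :=
  {t | t ∈ Ioo (1 / 4 : ℝ) (1 / 2) ∧ ∀ ε, 0 < ε → ε < δ →
    (∀ u, MemW22 (A' ∩ {x | η x < t}) u → 0 ≤ Mminus W q ε u (A' ∩ {x | η x < t})) ∧
    ∀ v, MemW22 (B ∩ {x | t < η x}) v → 0 ≤ Mminus W q ε v (B ∩ {x | t < η x})}

/-- The threshold inequality gives an `ε₀` for each regular level with no uniformity in the level.
The good levels at scale `1 / (k + 1)` increase with `k` and exhaust almost all of `(1/4, 1/2)`, so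
some scale captures more than half of its length `1/4`. -/
theorem IsProfile.exists_goodLevels {n : ℕ} {W : ℝ → ℝ} {qs q : ℝ} (hqs : IsThreshold n W qs)
    (hq : q < qs / n) {A A' B : Set (E n)} {η : E n → ℝ} (h : IsProfile A A' η)
    (hA' : IsC1Domain A') (hB : IsC1Domain B) (hAB : A' \ closure A ⊆ B) :
    ∃ δ : ℝ, 0 < δ ∧ ENNReal.ofReal (1 / 8) < volume (goodLevels W q A' B η δ) := by
  set T : ℕ → Set ℝ := fun k => goodLevels W q A' B η (1 / (k + 1)) with hT
  have hmono : Monotone T := by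
    intro k l hkl t ht
    refine ⟨ht.1, fun ε hε hεl => ht.2 ε hε (lt_of_lt_of_le hεl ?_)⟩
    exact one_div_le_one_div_of_le (by positivity) (by gcongr)
  set N := {t : ℝ | t ∈ Ioo (1 / 4 : ℝ) (3 / 4) ∧ ∃ x, η x = t ∧ fderiv ℝ η x = 0} with hN
  have hcov : Ioo (1 / 4 : ℝ) (1 / 2) \ N ⊆ ⋃ k, T k := by
    rintro t ⟨ht, htN⟩
    have ht' : t ∈ Ioo (1 / 4 : ℝ) (3 / 4) := ⟨ht.1, ht.2.trans (by norm_num)⟩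
    have hreg : IsRegularValue η t := fun x hx hx0 => htN ⟨ht', x, hx, hx0⟩
    obtain ⟨ε₁, hε₁, h₁⟩ := hqs.domain q hq _ (h.isC1Domain_outer hA' ht' hreg)
    obtain ⟨ε₂, hε₂, h₂⟩ := hqs.domain q hq _ (h.isC1Domain_inner hB hAB ht' hreg)
    obtain ⟨k, hk⟩ := exists_nat_one_div_lt (lt_min hε₁ hε₂)
    refine mem_iUnion.2 ⟨k, ht, fun ε hε hεk => ⟨fun u hu => ?_, fun v hv => ?_⟩⟩
    · exact h₁ ε hε ((hεk.trans hk).trans_le (min_le_left _ _)) u hu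
    · exact h₂ ε hε ((hεk.trans hk).trans_le (min_le_right _ _)) v hv
  have hvol : ENNReal.ofReal (1 / 8) < volume (⋃ k, T k) := by
    refine lt_of_lt_of_le ?_ (measure_mono hcov)
    rw [measure_sdiff_null (h.countable.measure_zero volume), Real.volume_Ioo]
    exact (ENNReal.ofReal_lt_ofReal_iff (by norm_num)).2 (by norm_num)
  -- Continuity from below holds for increasing sequences of arbitrary sets, so measurability of the
  -- good levels is not an issue.
  rw [hmono.measure_iUnion, lt_iSup_iff] at hvol
  obtain ⟨k, hk⟩ := hvol
  exact ⟨1 / (k + 1), by positivity, hk⟩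

/-! ### Cut-off functions in a layer -/

/-- The cut-off function which increases from `0` to `1` in the layer `t ≤ η ≤ t + ε`. -/
noncomputable def layerCutoff {n : ℕ} (η : E n → ℝ) (t ε : ℝ) (x : E n) : ℝ :=
  Real.smoothTransition ((η x - t) / ε)

theorem contDiff_layerCutoff {n : ℕ} {η : E n → ℝ} (hη : ContDiff ℝ ∞ η) (t ε : ℝ) :
    ContDiff ℝ ∞ (layerCutoff η t ε) :=
  Real.smoothTransition.contDiff.comp ((hη.sub contDiff_const).div_const ε)

theorem layerCutoff_mem_Icc {n : ℕ} (η : E n → ℝ) (t ε : ℝ) (x : E n) :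
    layerCutoff η t ε x ∈ Icc (0 : ℝ) 1 :=
  ⟨Real.smoothTransition.nonneg _, Real.smoothTransition.le_one _⟩

theorem layerCutoff_eq_zero {n : ℕ} {η : E n → ℝ} {t ε : ℝ} (hε : 0 < ε) {x : E n}
    (hx : η x ≤ t) : layerCutoff η t ε x = 0 :=
  Real.smoothTransition.zero_of_nonpos (div_nonpos_of_nonpos_of_nonneg (by linarith) hε.le)

theorem layerCutoff_eq_one {n : ℕ} {η : E n → ℝ} {t ε : ℝ} (hε : 0 < ε) {x : E n}
    (hx : t + ε ≤ η x) : layerCutoff η t ε x = 1 :=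
  Real.smoothTransition.one_of_one_le (by rw [le_div_iff₀ hε]; linarith)

theorem tsupport_layerCutoff_subset {n : ℕ} {η : E n → ℝ} (hη : Continuous η) {t ε : ℝ}
    (hε : 0 < ε) : tsupport (layerCutoff η t ε) ⊆ {x | t ≤ η x} := by
  refine closure_minimal (fun x hx => ?_) (isClosed_le continuous_const hη)
  by_contra h
  exact hx (layerCutoff_eq_zero hε (not_le.1 h).le)

theorem tsupport_one_sub_layerCutoff_subset {n : ℕ} {η : E n → ℝ} (hη : Continuous η) {t ε : ℝ}
    (hε : 0 < ε) : tsupport (fun x => 1 - layerCutoff η t ε x) ⊆ {x | η x ≤ t + ε} := by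
  refine closure_minimal (fun x hx => ?_) (isClosed_le hη continuous_const)
  by_contra h
  refine hx ?_
  simp only
  rw [layerCutoff_eq_one hε (not_le.1 h).le, sub_self]

theorem partialDeriv_comp_profile {n : ℕ} {η : E n → ℝ} (hη : ContDiff ℝ ∞ η) {ψ : ℝ → ℝ}
    (hψ : Differentiable ℝ ψ) (t ε : ℝ) (i : Fin n) (x : E n) :
    partialDeriv i (fun y => ψ ((η y - t) / ε)) x
      = deriv ψ ((η x - t) / ε) * (partialDeriv i η x / ε) := by
  have h1 : HasFDerivAt (fun y => (η y - t) / ε) (ε⁻¹ • fderiv ℝ η x) x := by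
    have := (((hη.differentiable (by simp) x).hasFDerivAt).sub_const t).const_mul ε⁻¹
    simpa only [div_eq_inv_mul] using this
  have h2 := (hψ ((η x - t) / ε)).hasDerivAt.comp_hasFDerivAt x h1
  have h3 : fderiv ℝ (fun y => ψ ((η y - t) / ε)) x = _ := h2.fderiv
  simp only [partialDeriv]
  rw [h3]
  simp [div_eq_inv_mul]

theorem exists_bound_of_hasCompactSupport {α : Type*} [TopologicalSpace α] {f : α → ℝ}
    (hf : Continuous f) (hc : HasCompactSupport f) : ∃ M : ℝ, 0 ≤ M ∧ ∀ x, |f x| ≤ M := by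
  obtain ⟨M, hM⟩ := hc.exists_bound_of_continuous hf
  exact ⟨max M 0, le_max_right _ _, fun x => (hM x).trans (le_max_left _ _)⟩

theorem exists_bound_partialDeriv {n : ℕ} {η : E n → ℝ} (hη : ContDiff ℝ ∞ η)
    (hc : HasCompactSupport η) : ∃ M : ℝ, 0 ≤ M ∧ (∀ i x, |partialDeriv i η x| ≤ M) ∧
      ∀ i j x, |partialDeriv j (partialDeriv i η) x| ≤ M := by
  have hs : ∀ {f : E n → ℝ} (i : Fin n), HasCompactSupport f →
      HasCompactSupport (partialDeriv i f) := fun {f} i h =>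
    h.mono' ((subset_tsupport _).trans (tsupport_partialDeriv_subset f i))
  choose a ha0 ha using fun i => exists_bound_of_hasCompactSupport
    (contDiff_partialDeriv hη i).continuous (hs i hc)
  choose b hb0 hb using fun i j => exists_bound_of_hasCompactSupport
    (contDiff_partialDeriv (contDiff_partialDeriv hη i) j).continuous (hs j (hs i hc))
  have hA : ∀ i, a i ≤ ∑ i, a i := fun i =>
    Finset.single_le_sum (f := a) (fun i _ => ha0 i) (Finset.mem_univ i)
  have hB : ∀ i j, b i j ≤ ∑ i, ∑ j, b i j := fun i j =>
    (Finset.single_le_sum (f := b i) (fun j _ => hb0 i j) (Finset.mem_univ j)).trans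
      (Finset.single_le_sum (f := fun i => ∑ j, b i j)
        (fun i _ => Finset.sum_nonneg fun j _ => hb0 i j) (Finset.mem_univ i))
  have hA0 : 0 ≤ ∑ i, a i := Finset.sum_nonneg fun i _ => ha0 i
  have hB0 : 0 ≤ ∑ i, ∑ j, b i j :=
    Finset.sum_nonneg fun i _ => Finset.sum_nonneg fun j _ => hb0 i j
  exact ⟨(∑ i, a i) + ∑ i, ∑ j, b i j, by positivity,
    fun i x => (ha i x).trans (by linarith [hA i]),
    fun i j x => (hb i j x).trans (by linarith [hB i j])⟩

theorem exists_bound_deriv_smoothTransition : ∃ M : ℝ, 0 ≤ M ∧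
    (∀ r, |deriv Real.smoothTransition r| ≤ M) ∧
      ∀ r, |deriv (deriv Real.smoothTransition) r| ≤ M := by
  have hs : ContDiff ℝ ∞ Real.smoothTransition := Real.smoothTransition.contDiff
  have hc : HasCompactSupport (deriv Real.smoothTransition) := by
    refine HasCompactSupport.intro (isCompact_Icc (a := (0 : ℝ)) (b := 1)) fun r hr => ?_
    rw [mem_Icc, not_and_or, not_le, not_le] at hr
    rcases hr with hr | hr
    · have : Real.smoothTransition =ᶠ[𝓝 r] fun _ => 0 := by
        filter_upwards [gt_mem_nhds hr] with y hy
        exact Real.smoothTransition.zero_of_nonpos (le_of_lt hy)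
      rw [this.deriv_eq, deriv_const]
    · have : Real.smoothTransition =ᶠ[𝓝 r] fun _ => 1 := by
        filter_upwards [lt_mem_nhds hr] with y hy
        exact Real.smoothTransition.one_of_one_le (le_of_lt hy)
      rw [this.deriv_eq, deriv_const]
  have h1 : ContDiff ℝ 1 (deriv Real.smoothTransition) :=
    ((contDiff_infty_iff_deriv.1 hs).2).of_le (by norm_cast)
  obtain ⟨M, hM0, hM⟩ := exists_bound_of_hasCompactSupport h1.continuous hc
  obtain ⟨M', hM0', hM'⟩ := exists_bound_of_hasCompactSupport
    (h1.continuous_deriv (by norm_num)) hc.deriv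
  exact ⟨M + M', by positivity, fun r => (hM r).trans (by linarith),
    fun r => (hM' r).trans (by linarith)⟩

/-- Each derivative of the cut-off costs a factor `1 / ε`, exactly compensated by the scaling of the
energy. The bound is uniform in `t`, because `t` only shifts the argument of the one-dimensional
transition function. -/
theorem exists_bound_layerCutoff {n : ℕ} {η : E n → ℝ} (hη : ContDiff ℝ ∞ η)
    (hc : HasCompactSupport η) : ∃ K : ℝ, 1 ≤ K ∧ ∀ t ε : ℝ, 0 < ε → ε ≤ 1 →
      (∀ i x, |ε * partialDeriv i (layerCutoff η t ε) x| ≤ K) ∧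
      ∀ i j x, |ε ^ 2 * partialDeriv j (partialDeriv i (layerCutoff η t ε)) x| ≤ K := by
  obtain ⟨M, hM0, hM1, hM2⟩ := exists_bound_partialDeriv hη hc
  obtain ⟨N, hN0, hN1, hN2⟩ := exists_bound_deriv_smoothTransition
  have hs : ContDiff ℝ ∞ Real.smoothTransition := Real.smoothTransition.contDiff
  have hs' : ContDiff ℝ ∞ (deriv Real.smoothTransition) := (contDiff_infty_iff_deriv.1 hs).2
  refine ⟨1 + (N * M + N * M * M), by nlinarith [mul_nonneg hN0 hM0, mul_nonneg (mul_nonneg hN0 hM0) hM0],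
    fun t ε hε hε1 => ?_⟩
  have hNM := mul_nonneg hN0 hM0
  have hNMM := mul_nonneg hNM hM0
  have e1 : ∀ i, partialDeriv i (layerCutoff η t ε) = fun x =>
      deriv Real.smoothTransition ((η x - t) / ε) * (ε⁻¹ * partialDeriv i η x) := by
    intro i
    ext x
    rw [← div_eq_inv_mul]
    exact partialDeriv_comp_profile hη (hs.differentiable (by simp)) t ε i x
  constructor
  · intro i x
    rw [e1]
    have : ε * (deriv Real.smoothTransition ((η x - t) / ε) * (ε⁻¹ * partialDeriv i η x))
        = deriv Real.smoothTransition ((η x - t) / ε) * partialDeriv i η x := by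
      field_simp
    rw [this, abs_mul]
    have := mul_le_mul (hN1 ((η x - t) / ε)) (hM1 i x) (abs_nonneg _) hN0
    linarith
  · intro i j x
    have hin : ContDiff ℝ ∞ fun x => (η x - t) / ε := (hη.sub contDiff_const).div_const ε
    have hdi := contDiff_partialDeriv hη i
    have hconst : partialDeriv j (fun y => ε⁻¹ * partialDeriv i η y) x
        = ε⁻¹ * partialDeriv j (partialDeriv i η) x := by
      rw [partialDeriv, fderiv_const_mul (hdi.differentiable (by simp) x)]
      rfl
    rw [e1, partialDeriv_mul (φ := fun x => deriv Real.smoothTransition ((η x - t) / ε))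
      (ψ := fun x => ε⁻¹ * partialDeriv i η x) (hs'.comp hin) (contDiff_const.mul hdi), hconst,
      partialDeriv_comp_profile hη (hs'.differentiable (by simp))]
    set p := deriv Real.smoothTransition ((η x - t) / ε) with hp
    set p' := deriv (deriv Real.smoothTransition) ((η x - t) / ε) with hp'
    have : ε ^ 2 * (p * (ε⁻¹ * partialDeriv j (partialDeriv i η) x) +
        ε⁻¹ * partialDeriv i η x * (p' * (partialDeriv j η x / ε)))
        = ε * (p * partialDeriv j (partialDeriv i η) x)
          + p' * partialDeriv i η x * partialDeriv j η x := by
      field_simp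
    rw [this]
    refine (abs_add_le _ _).trans ?_
    rw [abs_mul, abs_mul, abs_mul, abs_mul, abs_of_pos hε]
    have h1 := mul_le_mul (hN1 ((η x - t) / ε)) (hM2 i j x) (abs_nonneg _) hN0
    have h2 := mul_le_mul (mul_le_mul (hN2 ((η x - t) / ε)) (hM1 i x) (abs_nonneg _) hN0)
      (hM1 j x) (abs_nonneg _) hNM
    have h3 : ε * (|p| * |partialDeriv j (partialDeriv i η) x|) ≤ N * M := by
      refine le_trans ?_ h1
      exact mul_le_of_le_one_left (by positivity) hε1
    linarith

theorem partialDeriv_one_sub {n : ℕ} (φ : E n → ℝ) (i : Fin n) :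
    partialDeriv i (fun x => 1 - φ x) = fun x => -partialDeriv i φ x := by
  ext x
  simp [partialDeriv, fderiv_const_sub]

theorem partialDeriv_neg {n : ℕ} (φ : E n → ℝ) (i : Fin n) :
    partialDeriv i (fun x => -φ x) = fun x => -partialDeriv i φ x := by
  ext x
  simp [partialDeriv, fderiv_fun_neg]

/-- The gradient of the interpolation `φ u + (1 - φ) v`. -/
noncomputable def interpGrad {n : ℕ} (φ u v : E n → ℝ) (Gu Gv : E n → E n) (x : E n) : E n :=
  mulGrad φ u Gu x + mulGrad (fun y => 1 - φ y) v Gv x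

/-- The Hessian of the interpolation `φ u + (1 - φ) v`. -/
noncomputable def interpHess {n : ℕ} (φ u v : E n → ℝ) (Gu Gv : E n → E n) (Hu Hv : E n → Mat n)
    (x : E n) : Mat n :=
  mulHess φ u Gu Hu x + mulHess (fun y => 1 - φ y) v Gv Hv x

theorem interpGrad_apply {n : ℕ} (φ u v : E n → ℝ) (Gu Gv : E n → E n) (x : E n) (i : Fin n) :
    interpGrad φ u v Gu Gv x i = φ x * Gu x i + (1 - φ x) * Gv x i
      + (u x - v x) * partialDeriv i φ x := by
  simp only [interpGrad, mulGrad, PiLp.add_apply, partialDeriv_one_sub]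
  ring

theorem interpHess_apply {n : ℕ} (φ u v : E n → ℝ) (Gu Gv : E n → E n) (Hu Hv : E n → Mat n)
    (x : E n) (p : Fin n × Fin n) :
    interpHess φ u v Gu Gv Hu Hv x p = φ x * Hu x p + (1 - φ x) * Hv x p
      + (Gu x p.1 - Gv x p.1) * partialDeriv p.2 φ x
      + (Gu x p.2 - Gv x p.2) * partialDeriv p.1 φ x
      + (u x - v x) * partialDeriv p.2 (partialDeriv p.1 φ) x := by
  simp only [interpHess, mulHess, PiLp.add_apply, partialDeriv_one_sub, partialDeriv_neg]
  ring

theorem interp_eq_left {n : ℕ} {φ : E n → ℝ} (u v : E n → ℝ) (Gu Gv : E n → E n)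
    (Hu Hv : E n → Mat n) {x : E n} (hx : x ∉ tsupport fun y => 1 - φ y) :
    interpGrad φ u v Gu Gv x = Gu x ∧ interpHess φ u v Gu Gv Hu Hv x = Hu x := by
  have h0 : φ x = 1 := by
    have : 1 - φ x = 0 := image_eq_zero_of_notMem_tsupport (f := fun y => 1 - φ y) hx
    linarith
  have h1 : ∀ i, partialDeriv i φ x = 0 := fun i => by
    have := partialDeriv_eq_zero hx i
    rwa [partialDeriv_one_sub, neg_eq_zero] at this
  have h2 : ∀ i j, partialDeriv j (partialDeriv i φ) x = 0 := fun i j => by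
    have := partialDeriv_eq_zero (fun h => hx (tsupport_partialDeriv_subset _ i h)) j
    rwa [partialDeriv_one_sub, partialDeriv_neg, neg_eq_zero] at this
  constructor
  · ext i
    rw [interpGrad_apply, h0, h1]; ring
  · ext p
    rw [interpHess_apply, h0, h1, h1, h2]; ring

theorem interp_eq_right {n : ℕ} {φ : E n → ℝ} (u v : E n → ℝ) (Gu Gv : E n → E n)
    (Hu Hv : E n → Mat n) {x : E n} (hx : x ∉ tsupport φ) :
    interpGrad φ u v Gu Gv x = Gv x ∧ interpHess φ u v Gu Gv Hu Hv x = Hv x := by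
  have h0 : φ x = 0 := image_eq_zero_of_notMem_tsupport hx
  have h1 : ∀ i, partialDeriv i φ x = 0 := fun i => partialDeriv_eq_zero hx i
  have h2 : ∀ i j, partialDeriv j (partialDeriv i φ) x = 0 := fun i j =>
    partialDeriv_eq_zero (fun h => hx (tsupport_partialDeriv_subset _ i h)) j
  constructor
  · ext i
    rw [interpGrad_apply, h0, h1]; ring
  · ext p
    rw [interpHess_apply, h0, h1, h1, h2]; ring

theorem sq_add_three_le (a b c : ℝ) : (a + b + c) ^ 2 ≤ 3 * (a ^ 2 + b ^ 2 + c ^ 2) := by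
  nlinarith [sq_nonneg (a - b), sq_nonneg (b - c), sq_nonneg (a - c)]

theorem sq_mul_le_of_abs_le_one {r a : ℝ} (hr : |r| ≤ 1) : (r * a) ^ 2 ≤ a ^ 2 := by
  rw [mul_pow]
  exact mul_le_of_le_one_left (sq_nonneg a) ((sq_le_one_iff_abs_le_one r).2 hr)

theorem norm_interpGrad_sq_le {n : ℕ} (hn : 1 ≤ n) {φ u v : E n → ℝ} {Gu Gv : E n → E n} {x : E n}
    {ε K : ℝ} (hK : 1 ≤ K) (hφ : φ x ∈ Icc (0 : ℝ) 1) (h1 : ∀ i, |ε * partialDeriv i φ x| ≤ K) :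
    ‖ε • interpGrad φ u v Gu Gv x‖ ^ 2 ≤
      3 * n * K ^ 2 * (‖ε • Gu x‖ ^ 2 + ‖ε • Gv x‖ ^ 2 + |u x - v x| ^ 2) := by
  have hn' : (1 : ℝ) ≤ n := by exact_mod_cast hn
  have hφ1 : |φ x| ≤ 1 := abs_le.2 ⟨by linarith [hφ.1], hφ.2⟩
  have hφ2 : |1 - φ x| ≤ 1 := abs_le.2 ⟨by linarith [hφ.2], by linarith [hφ.1]⟩
  have hi : ∀ i, (ε • interpGrad φ u v Gu Gv x) i ^ 2 ≤
      3 * ((ε • Gu x) i ^ 2 + (ε • Gv x) i ^ 2 + K ^ 2 * |u x - v x| ^ 2) := by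
    intro i
    have e : (ε • interpGrad φ u v Gu Gv x) i = φ x * (ε • Gu x) i + (1 - φ x) * (ε • Gv x) i
        + (ε * partialDeriv i φ x) * (u x - v x) := by
      simp only [PiLp.smul_apply, smul_eq_mul, interpGrad_apply]
      ring
    rw [e]
    refine (sq_add_three_le _ _ _).trans ?_
    have := sq_mul_le_of_abs_le_one (a := (ε • Gu x) i) hφ1
    have := sq_mul_le_of_abs_le_one (a := (ε • Gv x) i) hφ2
    have : (ε * partialDeriv i φ x * (u x - v x)) ^ 2 ≤ K ^ 2 * |u x - v x| ^ 2 := by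
      rw [mul_pow, sq_abs]
      exact mul_le_mul_of_nonneg_right (sq_le_sq' (by linarith [(abs_le.1 (h1 i)).1])
        (abs_le.1 (h1 i)).2) (sq_nonneg _)
    linarith
  rw [EuclideanSpace.real_norm_sq_eq (ε • interpGrad φ u v Gu Gv x)]
  refine (Finset.sum_le_sum fun i _ => hi i).trans ?_
  rw [← Finset.mul_sum, Finset.sum_add_distrib, Finset.sum_add_distrib,
    ← EuclideanSpace.real_norm_sq_eq, ← EuclideanSpace.real_norm_sq_eq]
  simp only [Finset.sum_const, Finset.card_univ, Fintype.card_fin, nsmul_eq_mul]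
  have hK2 : (1 : ℝ) ≤ K ^ 2 := one_le_pow₀ hK
  have hnK : (1 : ℝ) ≤ n * K ^ 2 := by nlinarith
  have := mul_le_mul_of_nonneg_right hnK (sq_nonneg ‖ε • Gu x‖)
  have := mul_le_mul_of_nonneg_right hnK (sq_nonneg ‖ε • Gv x‖)
  linarith

theorem sq_add_five_le (a b c d e : ℝ) :
    (a + b + c + d + e) ^ 2 ≤ 5 * (a ^ 2 + b ^ 2 + c ^ 2 + d ^ 2 + e ^ 2) := by
  nlinarith [sq_nonneg (a - b), sq_nonneg (a - c), sq_nonneg (a - d), sq_nonneg (a - e),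
    sq_nonneg (b - c), sq_nonneg (b - d), sq_nonneg (b - e), sq_nonneg (c - d), sq_nonneg (c - e),
    sq_nonneg (d - e)]

/-- The Hessian has five summands, which gives the factor 5. The two mixed terms `(∇u - ∇v) ⊗ ∇φ`
cost another `2 · 2`, whence 20. -/
theorem norm_interpHess_sq_le {n : ℕ} (hn : 1 ≤ n) {φ u v : E n → ℝ} {Gu Gv : E n → E n}
    {Hu Hv : E n → Mat n} {x : E n} {ε K : ℝ} (hK : 1 ≤ K) (hφ : φ x ∈ Icc (0 : ℝ) 1)
    (h1 : ∀ i, |ε * partialDeriv i φ x| ≤ K)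
    (h2 : ∀ i j, |ε ^ 2 * partialDeriv j (partialDeriv i φ) x| ≤ K) :
    ‖ε ^ 2 • interpHess φ u v Gu Gv Hu Hv x‖ ^ 2 ≤
      20 * n ^ 2 * K ^ 2 * ((‖ε • Gu x‖ ^ 2 + ‖ε • Gv x‖ ^ 2 + |u x - v x| ^ 2) +
        (‖ε ^ 2 • Hu x‖ ^ 2 + ‖ε ^ 2 • Hv x‖ ^ 2)) := by
  have hn' : (1 : ℝ) ≤ n := by exact_mod_cast hn
  have hφ1 : |φ x| ≤ 1 := abs_le.2 ⟨by linarith [hφ.1], hφ.2⟩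
  have hφ2 : |1 - φ x| ≤ 1 := abs_le.2 ⟨by linarith [hφ.2], by linarith [hφ.1]⟩
  have hKs : ∀ {r a : ℝ}, |r| ≤ K → (r * a) ^ 2 ≤ K ^ 2 * a ^ 2 := fun {r a} hr => by
    rw [mul_pow]
    exact mul_le_mul_of_nonneg_right (sq_le_sq' (by linarith [(abs_le.1 hr).1]) (abs_le.1 hr).2)
      (sq_nonneg _)
  set g : Fin n → ℝ := fun i => 2 * ((ε • Gu x) i ^ 2 + (ε • Gv x) i ^ 2) with hg
  have hgs : ∀ i, (ε * (Gu x i - Gv x i)) ^ 2 ≤ g i := by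
    intro i
    simp only [hg, PiLp.smul_apply, smul_eq_mul]
    nlinarith [sq_nonneg (ε * Gu x i + ε * Gv x i)]
  have hi : ∀ p : Fin n × Fin n, (ε ^ 2 • interpHess φ u v Gu Gv Hu Hv x) p ^ 2 ≤
      5 * ((ε ^ 2 • Hu x) p ^ 2 + (ε ^ 2 • Hv x) p ^ 2 + K ^ 2 * g p.1 + K ^ 2 * g p.2
        + K ^ 2 * |u x - v x| ^ 2) := by
    intro p
    have e : (ε ^ 2 • interpHess φ u v Gu Gv Hu Hv x) p =
        φ x * (ε ^ 2 • Hu x) p + (1 - φ x) * (ε ^ 2 • Hv x) p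
        + (ε * partialDeriv p.2 φ x) * (ε * (Gu x p.1 - Gv x p.1))
        + (ε * partialDeriv p.1 φ x) * (ε * (Gu x p.2 - Gv x p.2))
        + (ε ^ 2 * partialDeriv p.2 (partialDeriv p.1 φ) x) * (u x - v x) := by
      simp only [PiLp.smul_apply, smul_eq_mul, interpHess_apply]
      ring
    rw [e]
    refine (sq_add_five_le _ _ _ _ _).trans ?_
    have a1 := sq_mul_le_of_abs_le_one (a := (ε ^ 2 • Hu x) p) hφ1
    have a2 := sq_mul_le_of_abs_le_one (a := (ε ^ 2 • Hv x) p) hφ2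
    have a3 := (hKs (a := ε * (Gu x p.1 - Gv x p.1)) (h1 p.2)).trans
      (mul_le_mul_of_nonneg_left (hgs p.1) (sq_nonneg K))
    have a4 := (hKs (a := ε * (Gu x p.2 - Gv x p.2)) (h1 p.1)).trans
      (mul_le_mul_of_nonneg_left (hgs p.2) (sq_nonneg K))
    have a5 := hKs (a := u x - v x) (h2 p.1 p.2)
    rw [← sq_abs (u x - v x)] at a5
    linarith
  have hgsum : ∑ i, g i = 2 * (‖ε • Gu x‖ ^ 2 + ‖ε • Gv x‖ ^ 2) := by
    rw [EuclideanSpace.real_norm_sq_eq (ε • Gu x), EuclideanSpace.real_norm_sq_eq (ε • Gv x),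
      ← Finset.sum_add_distrib, Finset.mul_sum]
  have hg1 : ∑ p : Fin n × Fin n, g p.1 = n * (2 * (‖ε • Gu x‖ ^ 2 + ‖ε • Gv x‖ ^ 2)) := by
    rw [Fintype.sum_prod_type, ← hgsum, Finset.mul_sum]
    simp
  have hg2 : ∑ p : Fin n × Fin n, g p.2 = n * (2 * (‖ε • Gu x‖ ^ 2 + ‖ε • Gv x‖ ^ 2)) := by
    rw [Fintype.sum_prod_type_right, ← hgsum, Finset.mul_sum]
    simp
  clear_value g
  rw [EuclideanSpace.real_norm_sq_eq (ε ^ 2 • interpHess φ u v Gu Gv Hu Hv x)]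
  refine (Finset.sum_le_sum fun p _ => hi p).trans ?_
  rw [← Finset.mul_sum, Finset.sum_add_distrib, Finset.sum_add_distrib, Finset.sum_add_distrib,
    Finset.sum_add_distrib, ← EuclideanSpace.real_norm_sq_eq, ← EuclideanSpace.real_norm_sq_eq,
    ← Finset.mul_sum, ← Finset.mul_sum, hg1, hg2]
  simp only [Finset.sum_const, Finset.card_univ, Fintype.card_prod, Fintype.card_fin, nsmul_eq_mul,
    Nat.cast_mul]
  have hK2 : (1 : ℝ) ≤ K ^ 2 := one_le_pow₀ hK
  have hnK : (1 : ℝ) ≤ n ^ 2 * K ^ 2 := by nlinarith [one_le_pow₀ hn' (n := 2)]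
  have hnn : (n : ℝ) * K ^ 2 ≤ n ^ 2 * K ^ 2 := by
    have : (n : ℝ) ≤ n ^ 2 := by nlinarith
    exact mul_le_mul_of_nonneg_right this (by positivity)
  have b1 := mul_le_mul_of_nonneg_right hnK (sq_nonneg ‖ε ^ 2 • Hu x‖)
  have b2 := mul_le_mul_of_nonneg_right hnK (sq_nonneg ‖ε ^ 2 • Hv x‖)
  have b3 := mul_le_mul_of_nonneg_right hnn
    (add_nonneg (sq_nonneg ‖ε • Gu x‖) (sq_nonneg ‖ε • Gv x‖))
  have b4 : 0 ≤ (n : ℝ) ^ 2 * K ^ 2 * |u x - v x| ^ 2 := by positivity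
  have b5 := sq_nonneg ‖ε ^ 2 • Hu x‖
  have b6 := sq_nonneg ‖ε ^ 2 • Hv x‖
  linarith

/-! ### The energy of the interpolation -/

/-- The sum of the potential and of the rescaled squares of the derivatives. -/
noncomputable def pot {n : ℕ} (W : ℝ → ℝ) (ε : ℝ) (u : E n → ℝ) (G : E n → E n) (H : E n → Mat n)
    (x : E n) : ℝ :=
  W (u x) + ‖ε • G x‖ ^ 2 + ‖ε ^ 2 • H x‖ ^ 2

/-- The quantity that controls the energy of the interpolation in the transition layer. -/
noncomputable def layerPot {n : ℕ} (W : ℝ → ℝ) (ε : ℝ) (u v : E n → ℝ) (Gu Gv : E n → E n)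
    (Hu Hv : E n → Mat n) (x : E n) : ℝ :=
  hullPot W (u x) (v x) + |u x - v x| ^ 2 + (pot W ε u Gu Hu x + pot W ε v Gv Hv x)

theorem pot_nonneg {n : ℕ} {W : ℝ → ℝ} (hW0 : ∀ s, 0 ≤ W s) (ε : ℝ) (u : E n → ℝ) (G : E n → E n)
    (H : E n → Mat n) (x : E n) : 0 ≤ pot W ε u G H x := by
  have := hW0 (u x)
  rw [pot]
  positivity

theorem layerPot_nonneg {n : ℕ} {W : ℝ → ℝ} (hW : Continuous W) (hW0 : ∀ s, 0 ≤ W s) (ε : ℝ)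
    (u v : E n → ℝ) (Gu Gv : E n → E n) (Hu Hv : E n → Mat n) (x : E n) :
    0 ≤ layerPot W ε u v Gu Gv Hu Hv x := by
  have h1 := pot_nonneg hW0 ε u Gu Hu x
  have h2 := pot_nonneg hW0 ε v Gv Hv x
  have h3 := hullPot_nonneg hW hW0 (u x) (v x)
  rw [layerPot]
  positivity

theorem IsW22With.integrableOn_pot {n : ℕ} {Ω : Set (E n)} {u : E n → ℝ} {G : E n → E n}
    {H : E n → Mat n} (h : IsW22With Ω u G H) {W : ℝ → ℝ} (ε : ℝ)
    (hi : IntegrableOn (fun x => W (u x)) Ω) : IntegrableOn (pot W ε u G H) Ω :=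
  (hi.add (h.memLp_grad.const_smul ε).integrable_norm_sq).add
    (h.memLp_hess.const_smul (ε ^ 2)).integrable_norm_sq

theorem integrableOn_hullPot {n : ℕ} {Ω : Set (E n)} (hΩ : volume Ω ≠ ⊤) {W : ℝ → ℝ}
    (hW : IsDoubleWell W) {u v : E n → ℝ} (hu : AEStronglyMeasurable u (volume.restrict Ω))
    (hv : AEStronglyMeasurable v (volume.restrict Ω)) (hiu : IntegrableOn (fun x => W (u x)) Ω)
    (hiv : IntegrableOn (fun x => W (v x)) Ω) :
    IntegrableOn (fun x => hullPot W (u x) (v x)) Ω := by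
  obtain ⟨c₀, hc₀, hmono⟩ := hW.almost_mono
  have hfin : IsFiniteMeasure (volume.restrict Ω) := ⟨by simpa using hΩ.lt_top⟩
  refine Integrable.mono' (((hiu.add hiv).const_mul c₀).add (integrable_const c₀))
    ((continuous_hullPot hW.continuous).comp_aestronglyMeasurable (hu.prodMk hv))
    (Eventually.of_forall fun x => ?_)
  rw [Real.norm_of_nonneg (hullPot_nonneg hW.continuous hW.nonneg _ _)]
  exact hullPot_le_add hW.nonneg (by linarith) hmono (u x) (v x)

theorem integrableOn_layerPot {n : ℕ} {Ω : Set (E n)} (hΩ : volume Ω ≠ ⊤) {W : ℝ → ℝ}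
    (hW : IsDoubleWell W) {u v : E n → ℝ} {Gu Gv : E n → E n} {Hu Hv : E n → Mat n}
    (hu : IsW22With Ω u Gu Hu) (hv : IsW22With Ω v Gv Hv) (ε : ℝ)
    (hiu : IntegrableOn (fun x => W (u x)) Ω) (hiv : IntegrableOn (fun x => W (v x)) Ω) :
    IntegrableOn (layerPot W ε u v Gu Gv Hu Hv) Ω :=
  ((integrableOn_hullPot hΩ hW hu.memLp.1 hv.memLp.1 hiu hiv).add
    (hu.memLp.sub hv.memLp).integrable_norm_sq).add
    ((hu.integrableOn_pot ε hiu).add (hv.integrableOn_pot ε hiv))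

/-- Only the gradient term of the lower growth bound is negative, and `pot` contains it; this limits
the negative energy that can sit in the layer. -/
theorem IsDensity.neg_le {n : ℕ} {W : ℝ → ℝ} (hW0 : ∀ s, 0 ≤ W s) {c₁ c₂ q : ℝ} (hc₁ : 0 < c₁)
    (hq : 0 < q) {f : E n → ℝ → E n → Mat n → ℝ} (hf : IsDensity W c₁ c₂ q f) (ε : ℝ) (u : E n → ℝ)
    (G : E n → E n) (H : E n → Mat n) (x : E n) :
    -(c₁ * q * pot W ε u G H x) ≤ f x (u x) (ε • G x) (ε ^ 2 • H x) := by
  refine le_trans ?_ (hf.lower x _ _ _)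
  have h1 := mul_nonneg hc₁.le (hW0 (u x))
  have h2 := mul_nonneg hc₁.le (sq_nonneg ‖ε ^ 2 • H x‖)
  have h3 := mul_nonneg hq.le h1
  have h4 := mul_nonneg hq.le h2
  rw [pot]
  linarith

theorem IsDensity.interp_le {n : ℕ} (hn : 1 ≤ n) {W : ℝ → ℝ} (hW : Continuous W)
    (hW0 : ∀ s, 0 ≤ W s) {c₁ c₂ q : ℝ} (hc₂ : 0 ≤ c₂) (hq : 0 < q)
    {f : E n → ℝ → E n → Mat n → ℝ} (hf : IsDensity W c₁ c₂ q f) {φ u v : E n → ℝ}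
    {Gu Gv : E n → E n} {Hu Hv : E n → Mat n} {x : E n} {ε K : ℝ} (hK : 1 ≤ K)
    (hφ : φ x ∈ Icc (0 : ℝ) 1) (h1 : ∀ i, |ε * partialDeriv i φ x| ≤ K)
    (h2 : ∀ i j, |ε ^ 2 * partialDeriv j (partialDeriv i φ) x| ≤ K) :
    f x (φ x * u x + (1 - φ x) * v x) (ε • interpGrad φ u v Gu Gv x)
      (ε ^ 2 • interpHess φ u v Gu Gv Hu Hv x) ≤
      c₂ * (1 + 3 * q * n * K ^ 2 + 20 * n ^ 2 * K ^ 2) * layerPot W ε u v Gu Gv Hu Hv x := by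
  refine (hf.upper _ _ _ _).trans ?_
  rw [mul_assoc]
  refine mul_le_mul_of_nonneg_left ?_ hc₂
  have e0 := le_hullPot hW (u x) (v x) hφ
  have e1 := norm_interpGrad_sq_le hn (u := u) (v := v) (Gu := Gu) (Gv := Gv) hK hφ h1
  have e2 := norm_interpHess_sq_le hn (u := u) (v := v) (Gu := Gu) (Gv := Gv) (Hu := Hu) (Hv := Hv)
    hK hφ h1 h2
  have a0 := hullPot_nonneg hW hW0 (u x) (v x)
  have a1 := hW0 (u x)
  have a2 := hW0 (v x)
  have b0 : W (φ x * u x + (1 - φ x) * v x) ≤ layerPot W ε u v Gu Gv Hu Hv x := by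
    refine e0.trans ?_
    rw [layerPot, pot, pot]
    have : 0 ≤ |u x - v x| ^ 2 + (W (u x) + ‖ε • Gu x‖ ^ 2 + ‖ε ^ 2 • Hu x‖ ^ 2 +
        (W (v x) + ‖ε • Gv x‖ ^ 2 + ‖ε ^ 2 • Hv x‖ ^ 2)) := by positivity
    linarith
  have b1 : ‖ε • Gu x‖ ^ 2 + ‖ε • Gv x‖ ^ 2 + |u x - v x| ^ 2 ≤ layerPot W ε u v Gu Gv Hu Hv x := by
    rw [layerPot, pot, pot]
    linarith [sq_nonneg ‖ε ^ 2 • Hu x‖, sq_nonneg ‖ε ^ 2 • Hv x‖]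
  have b2 : (‖ε • Gu x‖ ^ 2 + ‖ε • Gv x‖ ^ 2 + |u x - v x| ^ 2) +
      (‖ε ^ 2 • Hu x‖ ^ 2 + ‖ε ^ 2 • Hv x‖ ^ 2) ≤ layerPot W ε u v Gu Gv Hu Hv x := by
    rw [layerPot, pot, pot]
    linarith
  have d1 := mul_le_mul_of_nonneg_left
    (e1.trans (mul_le_mul_of_nonneg_left b1 (by positivity))) hq.le
  have d2 := e2.trans (mul_le_mul_of_nonneg_left b2 (by positivity))
  linarith

theorem IsDensity.le_integral {n : ℕ} {W : ℝ → ℝ} (hW : Continuous W) (hW0 : ∀ s, 0 ≤ W s)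
    {c₁ c₂ q : ℝ} (hc₁ : 0 < c₁) {f : E n → ℝ → E n → Mat n → ℝ} (hf : IsDensity W c₁ c₂ q f)
    {Ω : Set (E n)} {u : E n → ℝ} {G : E n → E n} {H : E n → Mat n} (h : IsW22With Ω u G H) (ε : ℝ)
    (hi : IntegrableOn (fun x => W (u x)) Ω) :
    c₁ * ((∫ x in Ω, W (u x)) - q * (ε ^ 2 * ∫ x in Ω, ‖G x‖ ^ 2)
      + ε ^ 4 * ∫ x in Ω, ‖H x‖ ^ 2) ≤ ∫ x in Ω, f x (u x) (ε • G x) (ε ^ 2 • H x) := by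
  have i1 := (h.memLp_grad.integrable_norm_sq.const_mul (ε ^ 2)).const_mul q
  have i2 := h.memLp_hess.integrable_norm_sq.const_mul (ε ^ 4)
  have i3 : Integrable (fun x => W (u x) - q * (ε ^ 2 * ‖G x‖ ^ 2)) (volume.restrict Ω) :=
    Integrable.sub hi i1
  have e : c₁ * ((∫ x in Ω, W (u x)) - q * (ε ^ 2 * ∫ x in Ω, ‖G x‖ ^ 2)
      + ε ^ 4 * ∫ x in Ω, ‖H x‖ ^ 2)
      = ∫ x in Ω, c₁ * (W (u x) - q * (ε ^ 2 * ‖G x‖ ^ 2) + ε ^ 4 * ‖H x‖ ^ 2) := by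
    rw [integral_const_mul, integral_add i3 i2, integral_sub hi i1,
      integral_const_mul, integral_const_mul, integral_const_mul]
  rw [e]
  refine integral_mono ((i3.add i2).const_mul c₁)
    ((hf.integrableOn_iff hW hW0 hc₁ h ε).2 hi) fun x => ?_
  refine le_trans (le_of_eq ?_) (hf.lower x _ _ _)
  rw [norm_smul, norm_smul, mul_pow, mul_pow, Real.norm_eq_abs, Real.norm_eq_abs, sq_abs, sq_abs]
  ring

/-- The density may be negative pointwise, but its integral dominates `c₁ ε` times the functional
`Mminus` with the same `q`. -/
theorem IsDensity.integral_nonneg {n : ℕ} {W : ℝ → ℝ} (hW : Continuous W) (hW0 : ∀ s, 0 ≤ W s)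
    {c₁ c₂ q : ℝ} (hc₁ : 0 < c₁) {f : E n → ℝ → E n → Mat n → ℝ} (hf : IsDensity W c₁ c₂ q f)
    {Ω : Set (E n)} (hΩ : IsOpen Ω) {u : E n → ℝ} {G : E n → E n} {H : E n → Mat n}
    (h : IsW22With Ω u G H) {ε : ℝ} (hε : 0 < ε) (hi : IntegrableOn (fun x => W (u x)) Ω)
    (hM : 0 ≤ Mminus W q ε u Ω) : 0 ≤ ∫ x in Ω, f x (u x) (ε • G x) (ε ^ 2 • H x) := by
  refine le_trans ?_ (hf.le_integral hW hW0 hc₁ h ε hi)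
  have := (Mminus_nonneg_iff hΩ h q hε hi).1 hM
  exact mul_nonneg hc₁.le (by linarith)

theorem energy_ne_bot {n : ℕ} {Ω : Set (E n)} (hΩ : IsOpen Ω) {W : ℝ → ℝ}
    (hW : Continuous W) (hW0 : ∀ s, 0 ≤ W s) {c₁ c₂ q : ℝ} (hc₁ : 0 < c₁)
    {f : E n → ℝ → E n → Mat n → ℝ} (hf : IsDensity W c₁ c₂ q f) (u : E n → ℝ) {ε : ℝ}
    (hε : 0 < ε) : energy f ε u Ω ≠ ⊥ := by
  by_cases h : MemW22 Ω u
  · obtain ⟨G, H, h⟩ := h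
    by_cases hi : IntegrableOn (fun x => W (u x)) Ω
    · rw [energy_of_integrable hΩ hW hW0 hc₁ hf h ε hi]
      exact EReal.coe_ne_bot _
    · rw [energy_eq_top hΩ hW hW0 hc₁ hf h hε hi]
      simp
  · rw [energy, if_neg h]
    simp

section Layer

variable {n : ℕ} {A A' B : Set (E n)} {η : E n → ℝ} {t ε : ℝ}

theorem IsProfile.tsupport_layerCutoff_subset (h : IsProfile A A' η) (ht : 1 / 4 < t)
    (hε : 0 < ε) : tsupport (layerCutoff η t ε) ⊆ A' :=
  (PhaseTransition.tsupport_layerCutoff_subset h.contDiff.continuous hε).trans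
    fun x hx => h.superlevel x (ht.le.trans hx)

theorem IsProfile.mem_of_le (h : IsProfile A A' η) (hte : t + ε < 3 / 4) {x : E n}
    (hx : x ∈ A ∪ B) (hxt : η x ≤ t + ε) : x ∈ B :=
  hx.resolve_left fun hA => by linarith [h.gt_of_mem x (subset_closure hA)]

theorem IsProfile.isW22With_interp (h : IsProfile A A' η) (hA : IsOpen A) (hA' : IsOpen A')
    (hB : IsOpen B) (ht : t ∈ Ioo (1 / 4 : ℝ) (1 / 2)) (hε : 0 < ε) (hε1 : ε ≤ 1 / 4)
    {u v : E n → ℝ} {Gu Gv : E n → E n} {Hu Hv : E n → Mat n} (hu : IsW22With A' u Gu Hu)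
    (hv : IsW22With B v Gv Hv) :
    IsW22With (A ∪ B) (fun x => layerCutoff η t ε x * u x + (1 - layerCutoff η t ε x) * v x)
      (interpGrad (layerCutoff η t ε) u v Gu Gv)
      (interpHess (layerCutoff η t ε) u v Gu Gv Hu Hv) := by
  obtain ⟨K, hK, hb⟩ := exists_bound_layerCutoff h.contDiff h.hasCompactSupport
  obtain ⟨hb1, hb2⟩ := hb t ε hε (by linarith)
  have hφ := contDiff_layerCutoff h.contDiff t ε
  have hφI := layerCutoff_mem_Icc η t ε
  set φ := layerCutoff η t ε with hφdef
  have hε2 : 0 < ε ^ 2 := by positivity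
  have hle : ε ^ 2 ≤ ε := by nlinarith
  -- For fixed `ε` only boundedness of the cut-off and its derivatives is needed; as `ε ≤ 1`, the
  -- constant `K / ε ^ 2` bounds all orders at once.
  have hK1 : 1 ≤ K / ε ^ 2 := by
    rw [le_div_iff₀ hε2]
    nlinarith
  have k0 : ∀ x, |φ x| ≤ K / ε ^ 2 := fun x =>
    (abs_le.2 ⟨by linarith [(hφI x).1], (hφI x).2⟩).trans hK1
  have k0' : ∀ x, |1 - φ x| ≤ K / ε ^ 2 := fun x =>
    (abs_le.2 ⟨by linarith [(hφI x).2], by linarith [(hφI x).1]⟩).trans hK1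
  have k1 : ∀ i x, |partialDeriv i φ x| ≤ K / ε ^ 2 := fun i x => by
    have := hb1 i x
    rw [abs_mul, abs_of_pos hε] at this
    rw [le_div_iff₀ hε2]
    nlinarith [abs_nonneg (partialDeriv i φ x)]
  have k2 : ∀ i j x, |partialDeriv j (partialDeriv i φ) x| ≤ K / ε ^ 2 := fun i j x => by
    have := hb2 i j x
    rw [abs_mul, abs_of_pos hε2] at this
    rw [le_div_iff₀ hε2]
    linarith
  have hs : tsupport φ ∩ (A ∪ B) ⊆ A' :=
    inter_subset_left.trans (h.tsupport_layerCutoff_subset ht.1 hε)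
  have hs' : tsupport (fun x => 1 - φ x) ∩ (A ∪ B) ⊆ B := fun x hx =>
    h.mem_of_le (by linarith [ht.2]) hx.2
      (tsupport_one_sub_layerCutoff_subset h.contDiff.continuous hε hx.1)
  refine (hu.mul (hA.union hB) hA' hφ hs k0 k1 k2).add
    (hv.mul (hA.union hB) hB (contDiff_const.sub hφ) hs' k0' ?_ ?_)
  · intro i x
    rw [partialDeriv_one_sub, abs_neg]
    exact k1 i x
  · intro i j x
    rw [partialDeriv_one_sub, partialDeriv_neg, abs_neg]
    exact k2 i j x

theorem IsProfile.isCutoffInterpolation (h : IsProfile A A' η) (ht : t ∈ Ioo (1 / 4 : ℝ) (1 / 2))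
    (hε : 0 < ε) (hε1 : ε ≤ 1 / 4) (u v : E n → ℝ) :
    IsCutoffInterpolation A A' B u v
      (fun x => layerCutoff η t ε x * u x + (1 - layerCutoff η t ε x) * v x) := by
  have hs := h.tsupport_layerCutoff_subset ht.1 hε
  refine ⟨layerCutoff η t ε, contDiff_layerCutoff h.contDiff t ε, ?_, hs,
    layerCutoff_mem_Icc η t ε, fun x hx => layerCutoff_eq_one hε ?_, ae_eq_rfl⟩
  · refine h.hasCompactSupport.of_isClosed_subset (isClosed_tsupport _) ?_
    refine (PhaseTransition.tsupport_layerCutoff_subset h.contDiff.continuous hε).trans ?_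
    refine fun x hx => subset_tsupport _ fun h0 => ?_
    have : t ≤ η x := hx
    linarith [ht.1]
  · linarith [h.gt_of_mem x (subset_closure hx), ht.2]

end Layer

/-! ### Comparison of the energies in the layer -/

section Layer

variable {n : ℕ} {A A' B : Set (E n)} {η : E n → ℝ} {t ε : ℝ}

theorem IsProfile.layer_subset (h : IsProfile A A' η) (ht : t ∈ Ioo (1 / 4 : ℝ) (1 / 2))
    (hε1 : ε ≤ 1 / 4) : {x | t ≤ η x ∧ η x ≤ t + ε} ⊆ A' \ closure A := fun x hx =>
  ⟨h.superlevel x (ht.1.le.trans hx.1), fun hA => by linarith [h.gt_of_mem x hA, hx.2, ht.2]⟩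

/-- The zones are: outside everything, below, in, and above the layer. The frontier of `A` has to be
excluded because `A ∪ B` need not contain it, although `A'` does. -/
theorem IsProfile.interp_cases (h : IsProfile A A' η)
    (hAB : A' \ closure A ⊆ B) (ht : t ∈ Ioo (1 / 4 : ℝ) (1 / 2)) (hε : 0 < ε)
    (hε1 : ε ≤ 1 / 4) {x : E n} (hx : x ∉ frontier A) :
    (x ∉ A ∪ B ∧ x ∉ A') ∨ (x ∈ B ∧ x ∉ A ∧ η x < t) ∨
      (x ∈ A' ∧ x ∈ B ∧ t ≤ η x ∧ η x ≤ t + ε) ∨ (x ∈ A ∪ B ∧ x ∈ A' ∧ t + ε < η x) := by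
  have hmem : x ∈ A' → x ∈ A ∪ B := fun hA' => by
    by_cases hA : x ∈ closure A
    · by_contra hAB'
      exact hx ⟨hA, fun hi => hAB' (Or.inl (interior_subset hi))⟩
    · exact Or.inr (hAB ⟨hA', hA⟩)
  rcases lt_or_ge (η x) t with h1 | h1
  · by_cases hAB' : x ∈ A ∪ B
    · refine Or.inr (Or.inl ⟨h.mem_of_le (t := t) (ε := ε) (by linarith [ht.2]) hAB' (by linarith),
        fun hA => ?_, h1⟩)
      linarith [h.gt_of_mem x (subset_closure hA), ht.2]
    · exact Or.inl ⟨hAB', fun h' => hAB' (hmem h')⟩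
  · have hA' := h.superlevel x (ht.1.le.trans h1)
    rcases le_or_gt (η x) (t + ε) with h2 | h2
    · exact Or.inr (Or.inr (Or.inl ⟨hA', h.mem_of_le (by linarith [ht.2]) (hmem hA') h2, h1, h2⟩))
    · exact Or.inr (Or.inr (Or.inr ⟨hmem hA', hA', h2⟩))

theorem IsProfile.integrableOn_interp (h : IsProfile A A' η) (hA : IsC1Domain A)
    (hA' : IsC1Domain A') (hB : IsC1Domain B) (hAB : A' \ closure A ⊆ B)
    (ht : t ∈ Ioo (1 / 4 : ℝ) (1 / 2)) (hε : 0 < ε) (hε1 : ε ≤ 1 / 4) {W : ℝ → ℝ}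
    (hW : IsDoubleWell W) {u v : E n → ℝ} {Gu Gv : E n → E n} {Hu Hv : E n → Mat n}
    (hu : IsW22With A' u Gu Hu) (hv : IsW22With B v Gv Hv)
    (hiu : IntegrableOn (fun x => W (u x)) A') (hiv : IntegrableOn (fun x => W (v x)) B) :
    IntegrableOn
      (fun x => W (layerCutoff η t ε x * u x + (1 - layerCutoff η t ε x) * v x)) (A ∪ B) := by
  have hS : A' \ closure A ⊆ A' := sdiff_subset
  have hLS := h.layer_subset ht hε1
  have hηm : Measurable η := h.contDiff.continuous.measurable
  have hLm : MeasurableSet {x | t ≤ η x ∧ η x ≤ t + ε} :=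
    (measurableSet_le measurable_const hηm).inter (measurableSet_le hηm measurable_const)
  have hfin : volume (A' \ closure A) ≠ ⊤ :=
    (hA'.isBounded.subset hS).measure_lt_top.ne
  have hhull := (integrableOn_hullPot hfin hW (hu.mono hS).memLp.1 (hv.mono hAB).memLp.1
    (hiu.mono_set hS) (hiv.mono_set hAB)).mono_set hLS
  have hw := h.isW22With_interp hA.isOpen hA'.isOpen hB.isOpen ht hε hε1 hu hv
  have hb : Integrable (A'.indicator (fun x => W (u x)) + B.indicator (fun x => W (v x))
      + {x | t ≤ η x ∧ η x ≤ t + ε}.indicator (fun x => hullPot W (u x) (v x))) :=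
    ((hiu.integrable_indicator hA'.isOpen.measurableSet).add
      (hiv.integrable_indicator hB.isOpen.measurableSet)).add (hhull.integrable_indicator hLm)
  refine Integrable.mono' (hb.integrableOn (s := A ∪ B))
    (hw.aestronglyMeasurable_comp hW.continuous) ?_
  have hfr : ∀ᵐ x ∂(volume.restrict (A ∪ B)), x ∉ frontier A :=
    ae_restrict_of_ae (measure_eq_zero_iff_ae_notMem.1 hA.volume_frontier)
  filter_upwards [hfr, ae_restrict_mem (hA.isOpen.union hB.isOpen).measurableSet] with x hx hxAB
  rw [Real.norm_of_nonneg (hW.nonneg _)]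
  have p1 : ∀ (s : Set (E n)) (g : E n → ℝ), (∀ x, 0 ≤ g x) → 0 ≤ s.indicator g x :=
    fun s g hg => indicator_nonneg (fun y _ => hg y) x
  have q1 := p1 A' (fun x => W (u x)) fun x => hW.nonneg _
  have q2 := p1 B (fun x => W (v x)) fun x => hW.nonneg _
  have q3 := p1 {x | t ≤ η x ∧ η x ≤ t + ε} (fun x => hullPot W (u x) (v x)) fun x =>
    hullPot_nonneg hW.continuous hW.nonneg _ _
  simp only [Pi.add_apply]
  rcases h.interp_cases hAB ht hε hε1 hx with hc | hc | hc | hc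
  · exact absurd hxAB hc.1
  · rw [layerCutoff_eq_zero hε hc.2.2.le]
    rw [indicator_of_mem hc.1] at q2 ⊢
    simp only [zero_mul, sub_zero, one_mul, zero_add]
    linarith
  · rw [indicator_of_mem (show x ∈ {x | t ≤ η x ∧ η x ≤ t + ε} from hc.2.2)]
    have := le_hullPot hW.continuous (u x) (v x) (layerCutoff_mem_Icc η t ε x)
    linarith
  · rw [layerCutoff_eq_one hε hc.2.2.le]
    rw [indicator_of_mem hc.2.1] at q1 ⊢
    simp only [one_mul, sub_self, zero_mul, add_zero]
    linarith

/-- The factor in front of the controlling quantity in the transition layer. -/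
noncomputable def layerFactor (n : ℕ) (c₁ c₂ q K : ℝ) : ℝ :=
  c₂ * (1 + 3 * q * n * K ^ 2 + 20 * n ^ 2 * K ^ 2) + c₁ * q

/-- Outside the layer `w` coincides with `u` or `v`, and the discarded energies over `A' ∩ {η < t}`
and `B ∩ {t < η}` are nonnegative by hypothesis. The second set contains the layer up to `{η = t}`,
so mainly the energy of `u` is kept there; its possible negativity accounts for the summand `c₁ * q`
of `layerFactor`. -/
theorem IsProfile.integral_interp_le (hn : 1 ≤ n) (h : IsProfile A A' η) (hA : IsC1Domain A)
    (hA' : IsC1Domain A') (hB : IsC1Domain B) (hAB : A' \ closure A ⊆ B)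
    (ht : t ∈ Ioo (1 / 4 : ℝ) (1 / 2)) (hε : 0 < ε) (hε1 : ε ≤ 1 / 4) {W : ℝ → ℝ}
    (hW : IsDoubleWell W) {c₁ c₂ q : ℝ} (hc₁ : 0 < c₁) (hc₂ : 0 ≤ c₂) (hq : 0 < q)
    {f : E n → ℝ → E n → Mat n → ℝ} (hf : IsDensity W c₁ c₂ q f) {K : ℝ} (hK : 1 ≤ K)
    (hb1 : ∀ i x, |ε * partialDeriv i (layerCutoff η t ε) x| ≤ K)
    (hb2 : ∀ i j x, |ε ^ 2 * partialDeriv j (partialDeriv i (layerCutoff η t ε)) x| ≤ K)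
    {u v : E n → ℝ} {Gu Gv : E n → E n} {Hu Hv : E n → Mat n}
    (hu : IsW22With A' u Gu Hu) (hv : IsW22With B v Gv Hv)
    (hiu : IntegrableOn (fun x => W (u x)) A') (hiv : IntegrableOn (fun x => W (v x)) B)
    (hMu : 0 ≤ Mminus W q ε u (A' ∩ {x | η x < t}))
    (hMv : 0 ≤ Mminus W q ε v (B ∩ {x | t < η x})) :
    ∫ x in A ∪ B, f x (layerCutoff η t ε x * u x + (1 - layerCutoff η t ε x) * v x)
      (ε • interpGrad (layerCutoff η t ε) u v Gu Gv x)
      (ε ^ 2 • interpHess (layerCutoff η t ε) u v Gu Gv Hu Hv x) ≤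
      (∫ x in A', f x (u x) (ε • Gu x) (ε ^ 2 • Hu x)) +
      (∫ x in B, f x (v x) (ε • Gv x) (ε ^ 2 • Hv x)) +
      layerFactor n c₁ c₂ q K *
        ∫ x in {x | t ≤ η x ∧ η x ≤ t + ε}, layerPot W ε u v Gu Gv Hu Hv x := by
  have hηc : Continuous η := h.contDiff.continuous
  have hS : A' \ closure A ⊆ A' := sdiff_subset
  have hLS := h.layer_subset ht hε1
  have hLm : MeasurableSet {x | t ≤ η x ∧ η x ≤ t + ε} :=
    (measurableSet_le measurable_const hηc.measurable).inter
      (measurableSet_le hηc.measurable measurable_const)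
  have hfin : volume (A' \ closure A) ≠ ⊤ :=
    (hA'.isBounded.subset hS).measure_lt_top.ne
  have hO1 : IsOpen (A' ∩ {x | η x < t}) := hA'.isOpen.inter (isOpen_lt hηc continuous_const)
  have hO2 : IsOpen (B ∩ {x | t < η x}) := hB.isOpen.inter (isOpen_lt continuous_const hηc)
  have hw := h.isW22With_interp hA.isOpen hA'.isOpen hB.isOpen ht hε hε1 hu hv
  have hiw := h.integrableOn_interp hA hA' hB hAB ht hε hε1 hW hu hv hiu hiv
  have hiL := ((integrableOn_layerPot hfin hW (hu.mono hS) (hv.mono hAB) ε (hiu.mono_set hS)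
    (hiv.mono_set hAB)).mono_set hLS).const_mul (layerFactor n c₁ c₂ q K)
  have hfw := (hf.integrableOn_iff hW.continuous hW.nonneg hc₁ hw ε).2 hiw
  have hfu := (hf.integrableOn_iff hW.continuous hW.nonneg hc₁ hu ε).2 hiu
  have hfv := (hf.integrableOn_iff hW.continuous hW.nonneg hc₁ hv ε).2 hiv
  have n1 := hf.integral_nonneg hW.continuous hW.nonneg hc₁ hO1 (hu.mono inter_subset_left) hε
    (hiu.mono_set inter_subset_left) hMu
  have n2 := hf.integral_nonneg hW.continuous hW.nonneg hc₁ hO2 (hv.mono inter_subset_left) hε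
    (hiv.mono_set inter_subset_left) hMv
  have hlow : ∀ (g : E n → ℝ) (G : E n → E n) (H : E n → Mat n) (x : E n),
      -(c₁ * q * pot W ε g G H x) ≤ f x (g x) (ε • G x) (ε ^ 2 • H x) := fun g G H x =>
    hf.neg_le hW.nonneg hc₁ hq ε g G H x
  have hup : ∀ x, f x (layerCutoff η t ε x * u x + (1 - layerCutoff η t ε x) * v x)
      (ε • interpGrad (layerCutoff η t ε) u v Gu Gv x)
      (ε ^ 2 • interpHess (layerCutoff η t ε) u v Gu Gv Hu Hv x) ≤
      c₂ * (1 + 3 * q * n * K ^ 2 + 20 * n ^ 2 * K ^ 2) * layerPot W ε u v Gu Gv Hu Hv x :=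
    fun x => hf.interp_le hn hW.continuous hW.nonneg hc₂ hq hK (layerCutoff_mem_Icc η t ε x)
      (fun i => hb1 i x) (fun i j => hb2 i j x)
  have heq1 : ∀ x, t + ε < η x → f x (layerCutoff η t ε x * u x + (1 - layerCutoff η t ε x) * v x)
      (ε • interpGrad (layerCutoff η t ε) u v Gu Gv x)
      (ε ^ 2 • interpHess (layerCutoff η t ε) u v Gu Gv Hu Hv x)
      = f x (u x) (ε • Gu x) (ε ^ 2 • Hu x) := fun x hx => by
    obtain ⟨e1, e2⟩ := interp_eq_left (φ := layerCutoff η t ε) u v Gu Gv Hu Hv (x := x)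
      fun hx' => absurd (tsupport_one_sub_layerCutoff_subset hηc hε hx') (not_le.2 hx)
    rw [e1, e2, layerCutoff_eq_one hε hx.le]
    simp
  have heq0 : ∀ x, η x < t → f x (layerCutoff η t ε x * u x + (1 - layerCutoff η t ε x) * v x)
      (ε • interpGrad (layerCutoff η t ε) u v Gu Gv x)
      (ε ^ 2 • interpHess (layerCutoff η t ε) u v Gu Gv Hu Hv x)
      = f x (v x) (ε • Gv x) (ε ^ 2 • Hv x) := fun x hx => by
    obtain ⟨e1, e2⟩ := interp_eq_right (φ := layerCutoff η t ε) u v Gu Gv Hu Hv (x := x)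
      fun hx' => absurd (PhaseTransition.tsupport_layerCutoff_subset hηc hε hx') (not_le.2 hx)
    rw [e1, e2, layerCutoff_eq_zero hε hx.le]
    simp
  set L := {x | t ≤ η x ∧ η x ≤ t + ε} with hLdef
  set fw : E n → ℝ := fun x => f x (layerCutoff η t ε x * u x + (1 - layerCutoff η t ε x) * v x)
      (ε • interpGrad (layerCutoff η t ε) u v Gu Gv x)
      (ε ^ 2 • interpHess (layerCutoff η t ε) u v Gu Gv Hu Hv x) with hfwdef
  set fu : E n → ℝ := fun x => f x (u x) (ε • Gu x) (ε ^ 2 • Hu x) with hfudef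
  set fv : E n → ℝ := fun x => f x (v x) (ε • Gv x) (ε ^ 2 • Hv x) with hfvdef
  set g : E n → ℝ := fun x => layerFactor n c₁ c₂ q K * layerPot W ε u v Gu Gv Hu Hv x with hgdef
  have hiL' : IntegrableOn g L := hiL
  -- With all integrals extended to the whole space by indicators, the balance can be checked
  -- pointwise in the four zones; `n1` and `n2` then remove the subtracted terms.
  have key : ∫ x, (A ∪ B).indicator fw x ≤ ∫ x, (A'.indicator fu x + B.indicator fv x
      - (A' ∩ {x | η x < t}).indicator fu x - (B ∩ {x | t < η x}).indicator fv x
      + L.indicator g x) := by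
    refine integral_mono_ae
      (hfw.integrable_indicator (hA.isOpen.union hB.isOpen).measurableSet)
      (((((hfu.integrable_indicator hA'.isOpen.measurableSet).add
      (hfv.integrable_indicator hB.isOpen.measurableSet)).sub
      ((hfu.mono_set inter_subset_left).integrable_indicator hO1.measurableSet)).sub
      ((hfv.mono_set inter_subset_left).integrable_indicator hO2.measurableSet)).add
      (hiL'.integrable_indicator hLm)) ?_
    filter_upwards [measure_eq_zero_iff_ae_notMem.1 hA.volume_frontier] with x hx
    rcases h.interp_cases hAB ht hε hε1 hx with hc | hc | hc | hc
    · have hB' : x ∉ B := fun h' => hc.1 (Or.inr h')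
      have hL' : x ∉ L := fun h' => hc.2 (hLS h').1
      rw [indicator_of_notMem hc.1, indicator_of_notMem hc.2, indicator_of_notMem hB',
        indicator_of_notMem fun h' => hc.2 h'.1, indicator_of_notMem fun h' => hB' h'.1,
        indicator_of_notMem hL']
      simp
    · have e : (A' ∩ {x | η x < t}).indicator fu x = A'.indicator fu x := by
        by_cases hA'x : x ∈ A'
        · rw [indicator_of_mem hA'x,
            indicator_of_mem (show x ∈ A' ∩ {x | η x < t} from ⟨hA'x, hc.2.2⟩)]
        · rw [indicator_of_notMem hA'x, indicator_of_notMem fun h' => hA'x h'.1]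
      have e' : fw x = fv x := heq0 x hc.2.2
      rw [e, indicator_of_mem (show x ∈ A ∪ B from Or.inr hc.1), indicator_of_mem hc.1,
        indicator_of_notMem (s := B ∩ {x | t < η x}) fun h' => lt_asymm hc.2.2 h'.2,
        indicator_of_notMem (s := L) fun h' => not_le.2 hc.2.2 h'.1, e']
      linarith
    · obtain ⟨m1, m2, m3, m4⟩ := hc
      rw [indicator_of_mem (show x ∈ A ∪ B from Or.inr m2), indicator_of_mem m1,
        indicator_of_mem m2,
        indicator_of_notMem (s := A' ∩ {x | η x < t}) fun h' => not_le.2 h'.2 m3, indicator_of_mem (s := L) ⟨m3, m4⟩]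
      have k1 : fw x ≤ _ := hup x
      have k2 : -(c₁ * q * pot W ε u Gu Hu x) ≤ fu x := hlow u Gu Hu x
      have k3 : -(c₁ * q * pot W ε v Gv Hv x) ≤ fv x := hlow v Gv Hv x
      have k4 := pot_nonneg hW.nonneg ε v Gv Hv x
      have k5 := hullPot_nonneg hW.continuous hW.nonneg (u x) (v x)
      have hcq : 0 < c₁ * q := mul_pos hc₁ hq
      have k6 : c₁ * q * (pot W ε u Gu Hu x + pot W ε v Gv Hv x)
          ≤ c₁ * q * layerPot W ε u v Gu Gv Hu Hv x := by
        refine mul_le_mul_of_nonneg_left ?_ hcq.le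
        rw [layerPot]
        linarith [sq_nonneg |u x - v x|]
      have k7 : g x = c₂ * (1 + 3 * q * n * K ^ 2 + 20 * n ^ 2 * K ^ 2)
          * layerPot W ε u v Gu Gv Hu Hv x + c₁ * q * layerPot W ε u v Gu Gv Hu Hv x := by
        rw [hgdef, layerFactor]
        ring
      have k8 : 0 ≤ c₁ * q * pot W ε v Gv Hv x := mul_nonneg hcq.le k4
      -- On the level set `η = t` the density of `v` is not subtracted, so it needs its own lower
      -- bound `k3`.
      by_cases hxt : t < η x
      · rw [indicator_of_mem (s := B ∩ {x | t < η x}) ⟨m2, hxt⟩]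
        linarith
      · rw [indicator_of_notMem (s := B ∩ {x | t < η x}) fun h' => hxt h'.2]
        linarith
    · obtain ⟨m1, m2, m3⟩ := hc
      have e : (B ∩ {x | t < η x}).indicator fv x = B.indicator fv x := by
        by_cases hBx : x ∈ B
        · have hxt : t < η x := by linarith
          rw [indicator_of_mem hBx,
            indicator_of_mem (show x ∈ B ∩ {x | t < η x} from ⟨hBx, hxt⟩)]
        · rw [indicator_of_notMem hBx, indicator_of_notMem fun h' => hBx h'.1]
      have e' : fw x = fu x := heq1 x m3
      rw [e, indicator_of_mem m1, indicator_of_mem m2,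
        indicator_of_notMem (s := A' ∩ {x | η x < t}) fun h' => by
          have : η x < t := h'.2
          linarith,
        indicator_of_notMem (s := L) fun h' => by linarith [h'.2], e']
      linarith
  have i1 := hfu.integrable_indicator hA'.isOpen.measurableSet
  have i2 := hfv.integrable_indicator hB.isOpen.measurableSet
  have i3 := (hfu.mono_set inter_subset_left).integrable_indicator hO1.measurableSet
  have i4 := (hfv.mono_set inter_subset_left).integrable_indicator hO2.measurableSet
  have i5 := hiL'.integrable_indicator hLm
  have i12 : Integrable fun x => A'.indicator fu x + B.indicator fv x := i1.add i2
  have i123 : Integrable fun x => A'.indicator fu x + B.indicator fv x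
      - (A' ∩ {x | η x < t}).indicator fu x := i12.sub i3
  have i1234 : Integrable fun x => A'.indicator fu x + B.indicator fv x
      - (A' ∩ {x | η x < t}).indicator fu x - (B ∩ {x | t < η x}).indicator fv x := i123.sub i4
  rw [integral_add i1234 i5, integral_sub i123 i4, integral_sub i12 i3, integral_add i1 i2,
    integral_indicator (hA.isOpen.union hB.isOpen).measurableSet,
    integral_indicator hA'.isOpen.measurableSet, integral_indicator hB.isOpen.measurableSet,
    integral_indicator hO1.measurableSet, integral_indicator hO2.measurableSet,
    integral_indicator hLm, hgdef, integral_const_mul] at key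
  linarith

end Layer

/-! ### Existence of a good interpolation -/

/-- The integral of the quantity that controls the energy in the transition layer. -/
noncomputable def layerInt {n : ℕ} (W : ℝ → ℝ) (ε : ℝ) (u v : E n → ℝ) (S : Set (E n)) : ℝ :=
  ∫ x in S, layerPot W ε u v (weakGrad S u) (weakGrad S v) (weakHess S u) (weakHess S v) x

theorem layerInt_eq {n : ℕ} {W : ℝ → ℝ} {ε : ℝ} {S : Set (E n)} (hS : IsOpen S)
    {u u' v v' : E n → ℝ} {Gu Gv : E n → E n} {Hu Hv : E n → Mat n} (hu : IsW22With S u' Gu Hu)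
    (hv : IsW22With S v' Gv Hv) (hu' : u =ᵐ[volume.restrict S] u')
    (hv' : v =ᵐ[volume.restrict S] v') :
    layerInt W ε u v S = ∫ x in S, layerPot W ε u' v' Gu Gv Hu Hv x := by
  obtain ⟨e1, e2⟩ := (hu.congr hu'.symm).weakGrad_ae_eq hS
  obtain ⟨e3, e4⟩ := (hv.congr hv'.symm).weakGrad_ae_eq hS
  refine integral_congr_ae ?_
  filter_upwards [e1, e2, e3, e4, hu', hv'] with x h1 h2 h3 h4 h5 h6
  simp only [layerPot, pot, h1, h2, h3, h4, h5, h6]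

theorem layerInt_nonneg {n : ℕ} {W : ℝ → ℝ} (hW : IsDoubleWell W) (ε : ℝ) (u v : E n → ℝ)
    (S : Set (E n)) : 0 ≤ layerInt W ε u v S :=
  integral_nonneg fun x => layerPot_nonneg hW.continuous hW.nonneg _ _ _ _ _ _ _ x

theorem layerFactor_pos (n : ℕ) {c₁ c₂ q : ℝ} (hc₁ : 0 < c₁) (hc₂ : 0 < c₂) (hq : 0 < q) (K : ℝ) :
    0 < layerFactor n c₁ c₂ q K := by
  rw [layerFactor]
  positivity

/-- The averaging argument for the finite measure with density `g` on `S`. -/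
theorem exists_mem_setIntegral_layer_le {n : ℕ} {S : Set (E n)} {g : E n → ℝ} (hg : ∀ x, 0 ≤ g x)
    (hi : IntegrableOn g S) {η : E n → ℝ} (hη : Measurable η) {ε : ℝ} (hε : 0 < ε) {T : Set ℝ}
    (hT : ENNReal.ofReal (1 / 8) < volume T)
    (hTS : ∀ t ∈ T, {x | t ≤ η x ∧ η x ≤ t + ε} ⊆ S) :
    ∃ t ∈ T, ∫ x in {x | t ≤ η x ∧ η x ≤ t + ε}, g x ≤ 8 * ε * ∫ x in S, g x := by
  have hfin : IsFiniteMeasure ((volume.restrict S).withDensity fun x => ENNReal.ofReal (g x)) :=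
    isFiniteMeasure_withDensity_ofReal hi.2
  obtain ⟨t, ht, hle⟩ := exists_mem_measure_layer_le
    ((volume.restrict S).withDensity fun x => ENNReal.ofReal (g x)) hη hε hT
  refine ⟨t, ht, ?_⟩
  have hLm : MeasurableSet {x | t ≤ η x ∧ η x ≤ t + ε} :=
    (measurableSet_le measurable_const hη).inter (measurableSet_le hη measurable_const)
  rw [withDensity_apply _ hLm, withDensity_apply _ MeasurableSet.univ, Measure.restrict_univ,
    Measure.restrict_restrict hLm, inter_eq_left.2 (hTS t ht),
    ← ofReal_integral_eq_lintegral_ofReal (hi.mono_set (hTS t ht)) (Eventually.of_forall hg),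
    ← ofReal_integral_eq_lintegral_ofReal hi (Eventually.of_forall hg),
    ← ENNReal.ofReal_mul (by positivity)] at hle
  exact (ENNReal.ofReal_le_ofReal_iff
    (mul_nonneg (by positivity) (integral_nonneg hg))).1 hle

/-- If `W(u)` or `W(v)` is not integrable, the right side is `⊤` and any good level serves.
Otherwise the level is chosen by averaging `layerPot` over the good levels. -/
theorem IsProfile.exists_interp {n : ℕ} (hn : 1 ≤ n) {A A' B : Set (E n)} {η : E n → ℝ}
    (h : IsProfile A A' η) (hA : IsC1Domain A) (hA' : IsC1Domain A') (hB : IsC1Domain B)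
    (hAB : A' \ closure A ⊆ B) {W : ℝ → ℝ} (hW : IsDoubleWell W) {c₁ c₂ q : ℝ} (hc₁ : 0 < c₁)
    (hc₂ : 0 ≤ c₂) (hq : 0 < q) {f : E n → ℝ → E n → Mat n → ℝ} (hf : IsDensity W c₁ c₂ q f)
    {K : ℝ} (hK : 1 ≤ K) (hb : ∀ t ε : ℝ, 0 < ε → ε ≤ 1 →
      (∀ i x, |ε * partialDeriv i (layerCutoff η t ε) x| ≤ K) ∧
      ∀ i j x, |ε ^ 2 * partialDeriv j (partialDeriv i (layerCutoff η t ε)) x| ≤ K)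
    {δ ε : ℝ} (hT : ENNReal.ofReal (1 / 8) < volume (goodLevels W q A' B η δ)) (hε : 0 < ε)
    (hε1 : ε ≤ 1 / 4) (hεδ : ε < δ) {u v : E n → ℝ} (hu : MemW22 A' u) (hv : MemW22 B v) :
    ∃ w, MemW22 (A ∪ B) w ∧ IsCutoffInterpolation A A' B u v w ∧ (∀ x ∈ A, w x = u x) ∧
      (∀ x, x ∉ A' → w x = v x) ∧
      energy f ε w (A ∪ B) ≤ energy f ε u A' + energy f ε v B +
        ((8 * layerFactor n c₁ c₂ q K * layerInt W ε u v (A' \ closure A) : ℝ) : EReal) := by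
  obtain ⟨Gu, Hu, hu⟩ := hu
  obtain ⟨Gv, Hv, hv⟩ := hv
  have hSo : IsOpen (A' \ closure A) := hA'.isOpen.sdiff isClosed_closure
  have hS : A' \ closure A ⊆ A' := sdiff_subset
  have hfin : volume (A' \ closure A) ≠ ⊤ := (hA'.isBounded.subset hS).measure_lt_top.ne
  have hηc := h.contDiff.continuous
  suffices hs : ∃ t ∈ goodLevels W q A' B η δ,
      energy f ε (fun x => layerCutoff η t ε x * u x + (1 - layerCutoff η t ε x) * v x) (A ∪ B) ≤
        energy f ε u A' + energy f ε v B +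
        ((8 * layerFactor n c₁ c₂ q K * layerInt W ε u v (A' \ closure A) : ℝ) : EReal) by
    obtain ⟨t, ht, hle⟩ := hs
    refine ⟨_, (h.isW22With_interp hA.isOpen hA'.isOpen hB.isOpen ht.1 hε hε1 hu hv).memW22,
      h.isCutoffInterpolation ht.1 hε hε1 u v, fun x hx => ?_, fun x hx => ?_, hle⟩
    · have : t + ε ≤ η x := by linarith [h.gt_of_mem x (subset_closure hx), ht.1.2]
      rw [layerCutoff_eq_one hε this]
      ring
    · have : layerCutoff η t ε x = 0 := image_eq_zero_of_notMem_tsupport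
        fun h' => hx (h.tsupport_layerCutoff_subset ht.1.1 hε h')
      simp only [this]
      ring
  have hne : (goodLevels W q A' B η δ).Nonempty := by
    by_contra hempty
    rw [not_nonempty_iff_eq_empty.1 hempty, measure_empty] at hT
    exact not_lt_bot hT
  have hbu := energy_ne_bot hA'.isOpen hW.continuous hW.nonneg hc₁ hf u hε
  have hbv := energy_ne_bot hB.isOpen hW.continuous hW.nonneg hc₁ hf v hε
  by_cases hiu : IntegrableOn (fun x => W (u x)) A'
  swap
  · obtain ⟨t, ht⟩ := hne
    refine ⟨t, ht, ?_⟩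
    rw [energy_eq_top hA'.isOpen hW.continuous hW.nonneg hc₁ hf hu hε hiu,
      EReal.top_add_of_ne_bot hbv, EReal.top_add_of_ne_bot (EReal.coe_ne_bot _)]
    exact le_top
  by_cases hiv : IntegrableOn (fun x => W (v x)) B
  swap
  · obtain ⟨t, ht⟩ := hne
    refine ⟨t, ht, ?_⟩
    rw [energy_eq_top hB.isOpen hW.continuous hW.nonneg hc₁ hf hv hε hiv,
      EReal.add_top_of_ne_bot hbu, EReal.top_add_of_ne_bot (EReal.coe_ne_bot _)]
    exact le_top
  have huS := hu.mono hS
  have hvS := hv.mono hAB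
  obtain ⟨t, ht, hL⟩ := exists_mem_setIntegral_layer_le
    (layerPot_nonneg hW.continuous hW.nonneg ε u v Gu Gv Hu Hv)
    (integrableOn_layerPot hfin hW huS hvS ε (hiu.mono_set hS) (hiv.mono_set hAB))
    hηc.measurable hε hT fun t ht => h.layer_subset ht.1 hε1
  refine ⟨t, ht, ?_⟩
  obtain ⟨hb1, hb2⟩ := hb t ε hε (by linarith)
  obtain ⟨g1, g2⟩ := ht.2 ε hε hεδ
  have key := h.integral_interp_le hn hA hA' hB hAB ht.1 hε hε1 hW hc₁ hc₂ hq hf hK hb1 hb2 hu hv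
    hiu hiv (g1 u (hu.mono inter_subset_left).memW22) (g2 v (hv.mono inter_subset_left).memW22)
  rw [energy_of_integrable (hA.isOpen.union hB.isOpen) hW.continuous hW.nonneg hc₁ hf
      (h.isW22With_interp hA.isOpen hA'.isOpen hB.isOpen ht.1 hε hε1 hu hv) ε
      (h.integrableOn_interp hA hA' hB hAB ht.1 hε hε1 hW hu hv hiu hiv),
    energy_of_integrable hA'.isOpen hW.continuous hW.nonneg hc₁ hf hu ε hiu,
    energy_of_integrable hB.isOpen hW.continuous hW.nonneg hc₁ hf hv ε hiv,
    layerInt_eq hSo huS hvS ae_eq_rfl ae_eq_rfl, ← EReal.coe_add, ← EReal.coe_add,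
    EReal.coe_le_coe_iff]
  have hF : 0 ≤ layerFactor n c₁ c₂ q K := by
    rw [layerFactor]
    positivity
  -- The factor `8 * ε` from the choice of the layer meets the `1 / ε` of the energy.
  have k1 := mul_le_mul_of_nonneg_left
    (key.trans (add_le_add_right (mul_le_mul_of_nonneg_left hL hF) _)) (one_div_pos.2 hε).le
  refine k1.trans (le_of_eq ?_)
  field_simp

/-- The factor in the coercivity estimate for the integral of `pot`. -/
noncomputable def coercFactor (q q' : ℝ) : ℝ := (1 + 1 / q') / (1 - q / q')

theorem one_le_coercFactor {q q' : ℝ} (hq : 0 < q) (hqq : q < q') : 1 ≤ coercFactor q q' := by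
  have hq' : 0 < q' := hq.trans hqq
  have h1 : q / q' < 1 := (div_lt_one hq').2 hqq
  have h2 : 0 < q / q' := div_pos hq hq'
  have h3 : 0 < 1 / q' := one_div_pos.2 hq'
  rw [coercFactor, le_div_iff₀ (by linarith)]
  linarith

/-- The hypothesis says `b ≤ (a + c) / q'`. Hence `a - q b + c` keeps at least the fraction `1 - q /
q'` of `a + c`, while `a + b + c` is at most `1 + 1 / q'` times it. -/
theorem coercive_aux {a b c q q' : ℝ} (hq : 0 < q) (hqq : q < q') (h : q' * b ≤ a + c) :
    a + b + c ≤ coercFactor q q' * (a - q * b + c) := by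
  have hq' : 0 < q' := hq.trans hqq
  have h1 : q / q' < 1 := (div_lt_one hq').2 hqq
  have h2 : b ≤ (a + c) / q' := by rw [le_div_iff₀ hq']; linarith
  have h3 : (1 - q / q') * (a + c) ≤ a - q * b + c := by
    have := mul_le_mul_of_nonneg_left h2 hq.le
    have e : q * ((a + c) / q') = q / q' * (a + c) := by ring
    linarith
  have h4 := mul_le_mul_of_nonneg_left h3
    (zero_le_one.trans (one_le_coercFactor hq hqq))
  refine le_trans ?_ h4
  have e : coercFactor q q' * ((1 - q / q') * (a + c)) = (1 + 1 / q') * (a + c) := by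
    have : (1 : ℝ) - q / q' ≠ 0 := by linarith
    rw [coercFactor, ← mul_assoc, div_mul_cancel₀ _ this]
  rw [e]
  have : (1 + 1 / q') * (a + c) = a + c + (a + c) / q' := by ring
  linarith

/-- The value of `ε` times the functional `Mminus`. -/
noncomputable def scaledEnergy {n : ℕ} (W : ℝ → ℝ) (q ε : ℝ) (u : E n → ℝ) (G : E n → E n)
    (H : E n → Mat n) (Ω : Set (E n)) : ℝ :=
  (∫ x in Ω, W (u x)) - q * (ε ^ 2 * ∫ x in Ω, ‖G x‖ ^ 2) + ε ^ 4 * ∫ x in Ω, ‖H x‖ ^ 2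

theorem integral_pot {n : ℕ} {Ω : Set (E n)} {u : E n → ℝ} {G : E n → E n} {H : E n → Mat n}
    (h : IsW22With Ω u G H) {W : ℝ → ℝ} (ε : ℝ) (hi : IntegrableOn (fun x => W (u x)) Ω) :
    ∫ x in Ω, pot W ε u G H x = (∫ x in Ω, W (u x)) + ε ^ 2 * (∫ x in Ω, ‖G x‖ ^ 2)
      + ε ^ 4 * ∫ x in Ω, ‖H x‖ ^ 2 := by
  have i1 := h.memLp_grad.integrable_norm_sq.const_mul (ε ^ 2)
  have i2 := h.memLp_hess.integrable_norm_sq.const_mul (ε ^ 4)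
  have i3 : Integrable (fun x => W (u x) + ε ^ 2 * ‖G x‖ ^ 2) (volume.restrict Ω) := hi.add i1
  rw [← integral_const_mul, ← integral_const_mul, ← integral_add hi i1, ← integral_add i3 i2]
  refine integral_congr_ae (Eventually.of_forall fun x => ?_)
  simp only [pot]
  rw [norm_smul, norm_smul, mul_pow, mul_pow, Real.norm_eq_abs, Real.norm_eq_abs, sq_abs, sq_abs]
  ring

theorem integral_pot_le {n : ℕ} {Ω : Set (E n)} (hΩ : IsOpen Ω) {u : E n → ℝ} {G : E n → E n}
    {H : E n → Mat n} (h : IsW22With Ω u G H) {W : ℝ → ℝ} {q q' ε : ℝ} (hq : 0 < q) (hqq : q < q')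
    (hε : 0 < ε) (hi : IntegrableOn (fun x => W (u x)) Ω) (hM : 0 ≤ Mminus W q' ε u Ω) :
    ∫ x in Ω, pot W ε u G H x ≤ coercFactor q q' * scaledEnergy W q ε u G H Ω := by
  rw [integral_pot h ε hi]
  exact coercive_aux hq hqq ((Mminus_nonneg_iff hΩ h q' hε hi).1 hM)

theorem Mminus_eq_scaledEnergy_div {n : ℕ} {Ω : Set (E n)} (hΩ : IsOpen Ω) {u : E n → ℝ}
    {G : E n → E n} {H : E n → Mat n} (h : IsW22With Ω u G H) {W : ℝ → ℝ} (q : ℝ) {ε : ℝ}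
    (hε : 0 < ε) (hi : IntegrableOn (fun x => W (u x)) Ω) :
    Mminus W q ε u Ω = ((scaledEnergy W q ε u G H Ω / ε : ℝ) : EReal) := by
  rw [Mminus_of_integrable hΩ h q ε hi, scaledEnergy]
  congr 1
  field_simp

/-! ### Bounds on the error -/

theorem Mminus_ne_bot {n : ℕ} {Ω : Set (E n)} (hΩ : IsOpen Ω) {W : ℝ → ℝ} (hW : Continuous W)
    (hW0 : ∀ s, 0 ≤ W s) (q : ℝ) {ε : ℝ} (hε : 0 < ε) (u : E n → ℝ) : Mminus W q ε u Ω ≠ ⊥ := by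
  by_cases h : MemW22 Ω u
  · obtain ⟨G, H, h⟩ := h
    by_cases hi : IntegrableOn (fun x => W (u x)) Ω
    · rw [Mminus_of_integrable hΩ h q ε hi]
      exact EReal.coe_ne_bot _
    · rw [Mminus_eq_top hΩ h hW hW0 q hε hi]
      simp
  · rw [Mminus, if_neg h]
    simp

/-- On `T` the segment between the two values degenerates and the potential is just `W(u)`, already
part of `pot`. Only off `T` does the additive constant `c₀` of the growth bound appear. -/
theorem layerInt_le {n : ℕ} {S T : Set (E n)} (hS : IsOpen S) (hfin : volume S ≠ ⊤) {W : ℝ → ℝ}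
    (hW : IsDoubleWell W) {c₀ : ℝ} (hc₀ : 1 ≤ c₀)
    (hmono : ∀ s t : ℝ, |s| ≤ |t| → W s ≤ c₀ * W t + c₀) {ε : ℝ} {u v : E n → ℝ} {Gu Gv : E n → E n}
    {Hu Hv : E n → Mat n} (hu : IsW22With S u Gu Hu) (hv : IsW22With S v Gv Hv)
    (hiu : IntegrableOn (fun x => W (u x)) S) (hiv : IntegrableOn (fun x => W (v x)) S)
    (hT : NullMeasurableSet T volume)
    (huv : ∀ᵐ x ∂(volume.restrict T), u x = v x) :
    layerInt W ε u v S ≤ c₀ * (volume (S \ T)).toReal + (∫ x in S \ T, |u x - v x| ^ 2)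
      + (c₀ + 1) * ((∫ x in S, pot W ε u Gu Hu x) + ∫ x in S, pot W ε v Gv Hv x) := by
  have hSo := hS.measurableSet.nullMeasurableSet (μ := volume)
  have hST : NullMeasurableSet (S \ T) volume := hSo.diff hT
  have hfT : volume (S \ T) ≠ ⊤ := ne_top_of_le_ne_top hfin (measure_mono sdiff_subset)
  have hfinT : IsFiniteMeasure (volume.restrict (S \ T)) := ⟨by simpa using hfT.lt_top⟩
  have id : IntegrableOn (fun x => |u x - v x| ^ 2) (S \ T) :=
    IntegrableOn.mono_set (hu.memLp.sub hv.memLp).integrable_norm_sq sdiff_subset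
  have i1 : IntegrableOn (fun x => c₀ + |u x - v x| ^ 2) (S \ T) := (integrable_const c₀).add id
  have i1' : IntegrableOn ((S \ T).indicator fun x => c₀ + |u x - v x| ^ 2) S :=
    (i1.integrable_indicator₀ hST).integrableOn
  have i2 : IntegrableOn (fun x => pot W ε u Gu Hu x + pot W ε v Gv Hv x) S :=
    (hu.integrableOn_pot ε hiu).add (hv.integrableOn_pot ε hiv)
  have i3 := Integrable.const_mul i2 (c₀ + 1)
  rw [layerInt_eq hS hu hv ae_eq_rfl ae_eq_rfl]
  have e : ∫ x in S, ((S \ T).indicator (fun x => c₀ + |u x - v x| ^ 2) x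
      + (c₀ + 1) * (pot W ε u Gu Hu x + pot W ε v Gv Hv x)) =
      c₀ * (volume (S \ T)).toReal + (∫ x in S \ T, |u x - v x| ^ 2)
      + (c₀ + 1) * ((∫ x in S, pot W ε u Gu Hu x) + ∫ x in S, pot W ε v Gv Hv x) := by
    rw [integral_add i1' i3, integral_const_mul,
      integral_add (hu.integrableOn_pot ε hiu) (hv.integrableOn_pot ε hiv),
      setIntegral_eq_integral_of_forall_compl_eq_zero, integral_indicator₀ hST,
      integral_add (integrable_const c₀) id]
    · simp [Measure.real, mul_comm]
    · intro x hx
      exact indicator_of_notMem (fun h' => hx h'.1) _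
  rw [← e]
  refine setIntegral_mono_on_ae (integrableOn_layerPot hfin hW hu hv ε hiu hiv) (i1'.add i3)
    hS.measurableSet ?_
  rw [ae_restrict_iff'₀ hT] at huv
  filter_upwards [huv] with x hx hxS
  have a1 := hullPot_le_add hW.nonneg (by linarith) hmono (u x) (v x)
  have a2 := hW.nonneg (u x)
  have a3 := hW.nonneg (v x)
  have a4 : W (u x) ≤ pot W ε u Gu Hu x := by
    rw [pot]
    linarith [sq_nonneg ‖ε • Gu x‖, sq_nonneg ‖ε ^ 2 • Hu x‖]
  have a5 : W (v x) ≤ pot W ε v Gv Hv x := by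
    rw [pot]
    linarith [sq_nonneg ‖ε • Gv x‖, sq_nonneg ‖ε ^ 2 • Hv x‖]
  have a6 : c₀ * (W (u x) + W (v x)) ≤ c₀ * (pot W ε u Gu Hu x + pot W ε v Gv Hv x) :=
    mul_le_mul_of_nonneg_left (by linarith) (by linarith)
  rw [layerPot]
  by_cases hxT : x ∈ T
  · have e1 := hx hxT
    have a7 : hullPot W (u x) (v x) ≤ W (u x) := by
      rw [← e1]
      exact hullPot_self_le _
    have a8 : W (u x) ≤ c₀ * (W (u x) + W (v x)) := by nlinarith
    rw [indicator_of_notMem fun h' => h'.2 hxT]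
    have a9 : |u x - v x| ^ 2 = 0 := by rw [e1]; simp
    linarith
  · rw [indicator_of_mem (show x ∈ S \ T from ⟨hxS, hxT⟩)]
    linarith

/-- For the limit the additive constant must be arbitrarily small, hence `σ` in place of `c₀`. -/
theorem layerInt_le_of_small {n : ℕ} {S : Set (E n)} (hS : IsOpen S) (hfin : volume S ≠ ⊤)
    {W : ℝ → ℝ} (hW : IsDoubleWell W) {σ Cσ : ℝ} (hCσ : 0 ≤ Cσ)
    (hσ : ∀ a b, hullPot W a b ≤ σ + Cσ * (W a + W b + |a - b| ^ 2)) {ε : ℝ} {u v : E n → ℝ}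
    {Gu Gv : E n → E n} {Hu Hv : E n → Mat n} (hu : IsW22With S u Gu Hu)
    (hv : IsW22With S v Gv Hv) (hiu : IntegrableOn (fun x => W (u x)) S)
    (hiv : IntegrableOn (fun x => W (v x)) S) :
    layerInt W ε u v S ≤ σ * (volume S).toReal + (Cσ + 1) * ((∫ x in S, |u x - v x| ^ 2)
      + ((∫ x in S, pot W ε u Gu Hu x) + ∫ x in S, pot W ε v Gv Hv x)) := by
  have hfinS : IsFiniteMeasure (volume.restrict S) := ⟨by simpa using hfin.lt_top⟩
  have id : Integrable (fun x => |u x - v x| ^ 2) (volume.restrict S) :=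
    (hu.memLp.sub hv.memLp).integrable_norm_sq
  have i2 : Integrable (fun x => pot W ε u Gu Hu x + pot W ε v Gv Hv x) (volume.restrict S) :=
    (hu.integrableOn_pot ε hiu).add (hv.integrableOn_pot ε hiv)
  have i3 : Integrable (fun x => |u x - v x| ^ 2 + (pot W ε u Gu Hu x + pot W ε v Gv Hv x))
    (volume.restrict S) := id.add i2
  rw [layerInt_eq hS hu hv ae_eq_rfl ae_eq_rfl]
  have e : ∫ x in S, (σ + (Cσ + 1) * (|u x - v x| ^ 2
      + (pot W ε u Gu Hu x + pot W ε v Gv Hv x))) =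
      σ * (volume S).toReal + (Cσ + 1) * ((∫ x in S, |u x - v x| ^ 2)
      + ((∫ x in S, pot W ε u Gu Hu x) + ∫ x in S, pot W ε v Gv Hv x)) := by
    rw [integral_add (integrable_const σ) (i3.const_mul (Cσ + 1)), integral_const_mul,
      integral_add id i2, integral_add (hu.integrableOn_pot ε hiu) (hv.integrableOn_pot ε hiv)]
    simp [Measure.real, mul_comm]
  rw [← e]
  refine integral_mono (integrableOn_layerPot hfin hW hu hv ε hiu hiv)
    ((integrable_const σ).add (i3.const_mul (Cσ + 1))) fun x => ?_
  have a1 := hσ (u x) (v x)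
  have a4 : W (u x) ≤ pot W ε u Gu Hu x := by
    rw [pot]
    linarith [sq_nonneg ‖ε • Gu x‖, sq_nonneg ‖ε ^ 2 • Hu x‖]
  have a5 : W (v x) ≤ pot W ε v Gv Hv x := by
    rw [pot]
    linarith [sq_nonneg ‖ε • Gv x‖, sq_nonneg ‖ε ^ 2 • Hv x‖]
  have a6 : Cσ * (W (u x) + W (v x)) ≤ Cσ * (pot W ε u Gu Hu x + pot W ε v Gv Hv x) :=
    mul_le_mul_of_nonneg_left (by linarith) hCσ
  simp only [layerPot]
  linarith

/-- Coercivity replaces the integrals of `pot` by multiples of `ε * Mminus`. If `W(u)` or `W(v)` is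
not integrable the right side is `⊤`, so the default value of the integral in `layerInt` does no
harm. -/
theorem layerInt_le_Mminus {n : ℕ} {S T : Set (E n)} (hS : IsOpen S) (hfin : volume S ≠ ⊤)
    {W : ℝ → ℝ} (hW : IsDoubleWell W) {c₀ : ℝ} (hc₀ : 1 ≤ c₀)
    (hmono : ∀ s t : ℝ, |s| ≤ |t| → W s ≤ c₀ * W t + c₀) {q q' : ℝ} (hq : 0 < q) (hqq : q < q')
    {ε : ℝ} (hε : 0 < ε) (hM : ∀ u, MemW22 S u → 0 ≤ Mminus W q' ε u S) {u v : E n → ℝ}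
    (hu : MemW22 S u) (hv : MemW22 S v) (hT : NullMeasurableSet T volume)
    (huv : ∀ᵐ x ∂(volume.restrict T), u x = v x) {F : ℝ} (hF : 0 < F) :
    ((F * layerInt W ε u v S : ℝ) : EReal) ≤
      ((F * ((c₀ + 1) * coercFactor q q') * (volume (S \ T)).toReal : ℝ) : EReal)
      + ((F * ((c₀ + 1) * coercFactor q q') * ∫ x in S \ T, |u x - v x| ^ 2 : ℝ) : EReal)
      + ((F * ((c₀ + 1) * coercFactor q q') * ε : ℝ) : EReal) *
        (Mminus W q ε u S + Mminus W q ε v S) := by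
  have hMu := hM u hu
  have hMv := hM v hv
  obtain ⟨Gu, Hu, hu⟩ := hu
  obtain ⟨Gv, Hv, hv⟩ := hv
  have hκ := one_le_coercFactor hq hqq
  set κ := coercFactor q q' with hκdef
  have hC : 0 < F * ((c₀ + 1) * κ) := mul_pos hF (mul_pos (by linarith) (by linarith))
  have hbu := Mminus_ne_bot hS hW.continuous hW.nonneg q hε u
  have hbv := Mminus_ne_bot hS hW.continuous hW.nonneg q hε v
  by_cases hiu : IntegrableOn (fun x => W (u x)) S
  swap
  · rw [Mminus_eq_top hS hu hW.continuous hW.nonneg q hε hiu, EReal.top_add_of_ne_bot hbv,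
      EReal.coe_mul_top_of_pos (mul_pos hC hε), ← EReal.coe_add,
      EReal.add_top_of_ne_bot (EReal.coe_ne_bot _)]
    exact le_top
  by_cases hiv : IntegrableOn (fun x => W (v x)) S
  swap
  · rw [Mminus_eq_top hS hv hW.continuous hW.nonneg q hε hiv, EReal.add_top_of_ne_bot hbu,
      EReal.coe_mul_top_of_pos (mul_pos hC hε), ← EReal.coe_add,
      EReal.add_top_of_ne_bot (EReal.coe_ne_bot _)]
    exact le_top
  rw [Mminus_eq_scaledEnergy_div hS hu q hε hiu, Mminus_eq_scaledEnergy_div hS hv q hε hiv]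
  have k0 := layerInt_le hS hfin hW hc₀ hmono (ε := ε) hu hv hiu hiv hT huv
  have k1 := integral_pot_le hS hu hq hqq hε hiu hMu
  have k2 := integral_pot_le hS hv hq hqq hε hiv hMv
  rw [← hκdef] at k1 k2
  norm_cast
  have n1 : 0 ≤ (volume (S \ T)).toReal := ENNReal.toReal_nonneg
  have n2 : 0 ≤ ∫ x in S \ T, |u x - v x| ^ 2 := integral_nonneg fun x => sq_nonneg _
  have k3 : c₀ ≤ (c₀ + 1) * κ := by nlinarith
  have k4 : 1 ≤ (c₀ + 1) * κ := by nlinarith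
  have k5 := mul_le_mul_of_nonneg_right k3 n1
  have k6 := mul_le_mul_of_nonneg_right k4 n2
  have k7 := mul_le_mul_of_nonneg_left (add_le_add k1 k2) (by linarith : 0 ≤ c₀ + 1)
  have k8 : layerInt W ε u v S ≤ (c₀ + 1) * κ * (volume (S \ T)).toReal
      + (c₀ + 1) * κ * (∫ x in S \ T, |u x - v x| ^ 2)
      + (c₀ + 1) * κ * (scaledEnergy W q ε u Gu Hu S + scaledEnergy W q ε v Gv Hv S) := by
    linarith
  refine (mul_le_mul_of_nonneg_left k8 hF.le).trans (le_of_eq ?_)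
  field_simp

/-- Neither energy is `⊥`, so a bound on the sum makes both finite. The lower growth bound then
yields `scaledEnergy` of order `ε`, and coercivity passes this on to `pot`. -/
theorem integral_pot_add_le {n : ℕ} {S : Set (E n)} (hS : IsOpen S) {W : ℝ → ℝ}
    (hW : IsDoubleWell W) {c₁ c₂ q q' : ℝ} (hc₁ : 0 < c₁) (hq : 0 < q) (hqq : q < q')
    {f : E n → ℝ → E n → Mat n → ℝ} (hf : IsDensity W c₁ c₂ q f)
    {ε : ℝ} (hε : 0 < ε) {u v : E n → ℝ} {Gu Gv : E n → E n} {Hu Hv : E n → Mat n}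
    (hu : IsW22With S u Gu Hu) (hv : IsW22With S v Gv Hv) (hMu : 0 ≤ Mminus W q' ε u S)
    (hMv : 0 ≤ Mminus W q' ε v S) {K : ℝ} (hE : energy f ε u S + energy f ε v S ≤ (K : EReal)) :
    IntegrableOn (fun x => W (u x)) S ∧ IntegrableOn (fun x => W (v x)) S ∧
      (∫ x in S, pot W ε u Gu Hu x) + (∫ x in S, pot W ε v Gv Hv x) ≤
        coercFactor q q' * K / c₁ * ε := by
  have hbu := energy_ne_bot hS hW.continuous hW.nonneg hc₁ hf u hε
  have hbv := energy_ne_bot hS hW.continuous hW.nonneg hc₁ hf v hε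
  have hiu : IntegrableOn (fun x => W (u x)) S := by
    by_contra hi
    rw [energy_eq_top hS hW.continuous hW.nonneg hc₁ hf hu hε hi,
      EReal.top_add_of_ne_bot hbv, top_le_iff] at hE
    exact EReal.coe_ne_top _ hE
  have hiv : IntegrableOn (fun x => W (v x)) S := by
    by_contra hi
    rw [energy_eq_top hS hW.continuous hW.nonneg hc₁ hf hv hε hi,
      EReal.add_top_of_ne_bot hbu, top_le_iff] at hE
    exact EReal.coe_ne_top _ hE
  refine ⟨hiu, hiv, ?_⟩
  rw [energy_of_integrable hS hW.continuous hW.nonneg hc₁ hf hu ε hiu,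
    energy_of_integrable hS hW.continuous hW.nonneg hc₁ hf hv ε hiv, ← EReal.coe_add,
    EReal.coe_le_coe_iff, ← mul_add, one_div_mul_eq_div, div_le_iff₀ hε] at hE
  have k1 := integral_pot_le hS hu hq hqq hε hiu hMu
  have k2 := integral_pot_le hS hv hq hqq hε hiv hMv
  have k3 : c₁ * scaledEnergy W q ε u Gu Hu S ≤ _ :=
    hf.le_integral hW.continuous hW.nonneg hc₁ hu ε hiu
  have k4 : c₁ * scaledEnergy W q ε v Gv Hv S ≤ _ :=
    hf.le_integral hW.continuous hW.nonneg hc₁ hv ε hiv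
  have hκ := one_le_coercFactor hq hqq
  have k5 : scaledEnergy W q ε u Gu Hu S + scaledEnergy W q ε v Gv Hv S ≤ K * ε / c₁ := by
    rw [le_div_iff₀ hc₁]
    linarith
  have k6 := mul_le_mul_of_nonneg_left k5 (zero_le_one.trans hκ)
  have e : coercFactor q q' * K / c₁ * ε = coercFactor q q' * (K * ε / c₁) := by ring
  rw [e]
  linarith

theorem integral_sq_eq_eLpNorm_sq {n : ℕ} {S : Set (E n)} {g : E n → ℝ}
    (hg : MemLp g 2 (volume.restrict S)) :
    ∫ x in S, |g x| ^ 2 = (eLpNorm g 2 (volume.restrict S)).toReal ^ 2 := by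
  have h0 : 0 ≤ ∫ x in S, |g x| ^ 2 := integral_nonneg fun x => sq_nonneg _
  rw [hg.eLpNorm_eq_integral_rpow_norm (by norm_num) (by norm_num)]
  simp only [ENNReal.toReal_ofNat, Real.norm_eq_abs, Real.rpow_ofNat]
  rw [ENNReal.toReal_ofReal (by positivity), ← Real.rpow_natCast, ← Real.rpow_mul h0]
  simp

/-- With `σ` fixed, the terms multiplied by `Cσ` vanish in the limit: the integrals of `pot` are of
order `ε`, and `u - v` tends to zero in `L²`. -/
theorem tendsto_layerInt {n : ℕ} {S : Set (E n)} (hS : IsOpen S) (hfin : volume S ≠ ⊤) {W : ℝ → ℝ}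
    (hW : IsDoubleWell W) {c₁ c₂ q q' : ℝ} (hc₁ : 0 < c₁) (hq : 0 < q) (hqq : q < q')
    {f : ℝ → E n → ℝ → E n → Mat n → ℝ} (hf : ∀ ε, 0 < ε → IsDensity W c₁ c₂ q (f ε))
    {u v : ℝ → E n → ℝ} (hu : ∀ ε, 0 < ε → MemW22 S (u ε)) (hv : ∀ ε, 0 < ε → MemW22 S (v ε))
    (hM : ∀ᶠ ε in 𝓝[>] (0 : ℝ), ∀ g, MemW22 S g → 0 ≤ Mminus W q' ε g S) {K : ℝ}
    (hE : ∀ᶠ ε in 𝓝[>] (0 : ℝ), energy (f ε) ε (u ε) S + energy (f ε) ε (v ε) S ≤ (K : EReal))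
    (huv : Tendsto (fun ε => eLpNorm (fun x => u ε x - v ε x) 2 (volume.restrict S))
      (𝓝[>] 0) (𝓝 0)) :
    Tendsto (fun ε => layerInt W ε (u ε) (v ε) S) (𝓝[>] 0) (𝓝 0) := by
  refine tendsto_order.2 ⟨fun a ha => Eventually.of_forall fun ε =>
    ha.trans_le (layerInt_nonneg hW _ _ _ _), fun ρ hρ => ?_⟩
  have hV : 0 ≤ (volume S).toReal := ENNReal.toReal_nonneg
  -- This choice makes `σ` times the volume of `S` at most `ρ / 2`; the `+ 1` covers volume zero.
  have hσ : 0 < ρ / (2 * ((volume S).toReal + 1)) := by positivity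
  obtain ⟨Cσ, hCσ, hhull⟩ := hW.exists_hullPot_le hσ
  have t1 : Tendsto (fun ε => (eLpNorm (fun x => u ε x - v ε x) 2 (volume.restrict S)).toReal)
      (𝓝[>] 0) (𝓝 0) := by
    exact (ENNReal.tendsto_toReal ENNReal.zero_ne_top).comp huv
  have t2 : Tendsto (fun ε : ℝ => ε) (𝓝[>] 0) (𝓝 0) := tendsto_nhdsWithin_of_tendsto_nhds tendsto_id
  have t3 : Tendsto (fun ε : ℝ => (Cσ + 1) *
      ((eLpNorm (fun x => u ε x - v ε x) 2 (volume.restrict S)).toReal ^ 2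
        + coercFactor q q' * K / c₁ * ε)) (𝓝[>] 0) (𝓝 0) := by
    simpa using ((t1.pow 2).add (t2.const_mul (coercFactor q q' * K / c₁))).const_mul (Cσ + 1)
  have t4 := (tendsto_order.1 t3).2 (ρ / 2) (half_pos hρ)
  filter_upwards [hM, hE, t4, self_mem_nhdsWithin] with ε hMε hEε hsmall hε
  have hMu := hMε _ (hu ε hε)
  have hMv := hMε _ (hv ε hε)
  obtain ⟨Gu, Hu, hu'⟩ := hu ε hε
  obtain ⟨Gv, Hv, hv'⟩ := hv ε hε
  obtain ⟨hiu, hiv, hpot⟩ :=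
    integral_pot_add_le hS hW hc₁ hq hqq (hf ε hε) hε hu' hv' hMu hMv hEε
  have key := layerInt_le_of_small hS hfin hW hCσ hhull (ε := ε) hu' hv' hiu hiv
  have e : ∫ x in S, |u ε x - v ε x| ^ 2 =
      (eLpNorm (fun x => u ε x - v ε x) 2 (volume.restrict S)).toReal ^ 2 :=
    integral_sq_eq_eLpNorm_sq (hu'.memLp.sub hv'.memLp)
  rw [e] at key
  have k1 : ρ / (2 * ((volume S).toReal + 1)) * (volume S).toReal ≤ ρ / 2 := by
    rw [div_mul_eq_mul_div, div_le_div_iff₀ (by positivity) (by norm_num)]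
    nlinarith
  have k2 := mul_le_mul_of_nonneg_left (add_le_add_right hpot
    ((eLpNorm (fun x => u ε x - v ε x) 2 (volume.restrict S)).toReal ^ 2))
    (by linarith : 0 ≤ Cσ + 1)
  linarith

/-- The derivatives are picked by choice, separately for each representative; uniqueness almost
everywhere on open sets makes the picks agree, and outside `W^{2,2}` both are zero. -/
theorem weakGrad_congr_ae {n : ℕ} {Ω : Set (E n)} (hΩ : IsOpen Ω) {u u' : E n → ℝ}
    (hu : u =ᵐ[volume.restrict Ω] u') :
    weakGrad Ω u =ᵐ[volume.restrict Ω] weakGrad Ω u' ∧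
      weakHess Ω u =ᵐ[volume.restrict Ω] weakHess Ω u' := by
  by_cases h : MemW22 Ω u'
  · obtain ⟨G, H, h⟩ := h
    obtain ⟨e1, e2⟩ := (h.congr hu.symm).weakGrad_ae_eq hΩ
    obtain ⟨e3, e4⟩ := h.weakGrad_ae_eq hΩ
    exact ⟨e1.trans e3.symm, e2.trans e4.symm⟩
  · have h' : ¬ MemW22 Ω u := fun ⟨G, H, h'⟩ => h (h'.congr hu).memW22
    simp [weakGrad, weakHess, h, h']

theorem layerInt_congr_ae {n : ℕ} {W : ℝ → ℝ} {ε : ℝ} {S : Set (E n)} (hS : IsOpen S)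
    {u u' v v' : E n → ℝ} (hu : u =ᵐ[volume.restrict S] u') (hv : v =ᵐ[volume.restrict S] v') :
    layerInt W ε u v S = layerInt W ε u' v' S := by
  obtain ⟨e1, e2⟩ := weakGrad_congr_ae hS hu
  obtain ⟨e3, e4⟩ := weakGrad_congr_ae hS hv
  refine integral_congr_ae ?_
  filter_upwards [e1, e2, e3, e4, hu, hv] with x h1 h2 h3 h4 h5 h6
  simp only [layerPot, pot, h1, h2, h3, h4, h5, h6]

open Classical in
/-- The error functional of the fundamental estimate, with a constant factor. -/
noncomputable def layerError {n : ℕ} (W : ℝ → ℝ) (F : ℝ) (ε : ℝ) (u v : E n → ℝ)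
    (A A' : Set (E n)) : ℝ≥0 :=
  -- Weak derivatives are known to be unique on open sets; the default value 0 secures invariance
  -- under a.e. changes for arbitrary `A` and `A'`.
  if IsOpen (A' \ closure A) then Real.toNNReal (F * layerInt W ε u v (A' \ closure A)) else 0

theorem layerError_congr_ae {n : ℕ} {W : ℝ → ℝ} {F ε : ℝ} {A A' : Set (E n)}
    {u u' v v' : E n → ℝ} (hu : u =ᵐ[volume.restrict (A' \ closure A)] u')
    (hv : v =ᵐ[volume.restrict (A' \ closure A)] v') :
    layerError W F ε u v A A' = layerError W F ε u' v' A A' := by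
  by_cases hS : IsOpen (A' \ closure A)
  · simp only [layerError, hS, if_true, layerInt_congr_ae hS hu hv]
  · simp only [layerError, hS, if_false]

theorem coe_layerError {n : ℕ} {W : ℝ → ℝ} (hW : IsDoubleWell W) {F : ℝ} (hF : 0 ≤ F) {ε : ℝ}
    {A A' : Set (E n)} (hS : IsOpen (A' \ closure A)) (u v : E n → ℝ) :
    (layerError W F ε u v A A' : ℝ) = F * layerInt W ε u v (A' \ closure A) := by
  rw [layerError, if_pos hS, Real.coe_toNNReal _ (mul_nonneg hF (layerInt_nonneg hW _ _ _ _))]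

/-- Stated for arbitrary sets so that `η` and `K` can be chosen as functions of `A` and `A'` alone;
this is why the final constant does not involve `B`. -/
theorem exists_profile_bound {n : ℕ} (A A' : Set (E n)) : ∃ (η : E n → ℝ) (K : ℝ), 1 ≤ K ∧
    (IsOpen A' → Bornology.IsBounded A' → closure A ⊆ A' → IsProfile A A' η ∧
      ∀ t ε : ℝ, 0 < ε → ε ≤ 1 → (∀ i x, |ε * partialDeriv i (layerCutoff η t ε) x| ≤ K) ∧
        ∀ i j x, |ε ^ 2 * partialDeriv j (partialDeriv i (layerCutoff η t ε)) x| ≤ K) := by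
  by_cases h : IsOpen A' ∧ Bornology.IsBounded A' ∧ closure A ⊆ A'
  · obtain ⟨η, hη⟩ := exists_isProfile h.1 h.2.1 h.2.2
    obtain ⟨K, hK, hb⟩ := exists_bound_layerCutoff hη.contDiff hη.hasCompactSupport
    exact ⟨η, K, hK, fun _ _ _ => ⟨hη, hb⟩⟩
  · exact ⟨0, 1, le_rfl, fun h1 h2 h3 => absurd ⟨h1, h2, h3⟩ h⟩

theorem IsThreshold.exists_eps {n : ℕ} {W : ℝ → ℝ} {qs q q' : ℝ} (hqs : IsThreshold n W qs)
    (hq : q < qs / n) (hq' : q' < qs / n) (A A' B : Set (E n)) (η : E n → ℝ) :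
    ∃ ε₀ : ℝ, 0 < ε₀ ∧
      (IsProfile A A' η → IsC1Domain A' → IsC1Domain B → A' \ closure A ⊆ B →
        ε₀ ≤ 1 / 4 ∧ ∃ δ, ε₀ < δ ∧ ENNReal.ofReal (1 / 8) < volume (goodLevels W q A' B η δ)) ∧
      (IsC1Domain (A' \ closure A) → ∀ ε, 0 < ε → ε ≤ ε₀ → ∀ u, MemW22 (A' \ closure A) u →
        0 ≤ Mminus W q' ε u (A' \ closure A)) := by
  have h1 : ∃ a : ℝ, 0 < a ∧ (IsProfile A A' η → IsC1Domain A' → IsC1Domain B →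
      A' \ closure A ⊆ B → ENNReal.ofReal (1 / 8) < volume (goodLevels W q A' B η a)) := by
    by_cases h : IsProfile A A' η ∧ IsC1Domain A' ∧ IsC1Domain B ∧ A' \ closure A ⊆ B
    · obtain ⟨δ, hδ, hT⟩ := h.1.exists_goodLevels hqs hq h.2.1 h.2.2.1 h.2.2.2
      exact ⟨δ, hδ, fun _ _ _ _ => hT⟩
    · exact ⟨1, one_pos, fun h1 h2 h3 h4 => absurd ⟨h1, h2, h3, h4⟩ h⟩
  have h2 : ∃ b : ℝ, 0 < b ∧ (IsC1Domain (A' \ closure A) → ∀ ε, 0 < ε → ε < b → ∀ u,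
      MemW22 (A' \ closure A) u → 0 ≤ Mminus W q' ε u (A' \ closure A)) := by
    by_cases h : IsC1Domain (A' \ closure A)
    · obtain ⟨b, hb, hM⟩ := hqs.domain q' hq' _ h
      exact ⟨b, hb, fun _ => hM⟩
    · exact ⟨1, one_pos, fun h' => absurd h' h⟩
  obtain ⟨a, ha, h1⟩ := h1
  obtain ⟨b, hb, h2⟩ := h2
  -- The halves turn the strict bounds `ε < a` and `ε < b` into ones valid up to and including `ε₀`.
  have l1 : min (1 / 4) (min (a / 2) (b / 2)) ≤ a / 2 := (min_le_right _ _).trans (min_le_left _ _)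
  have l2 : min (1 / 4) (min (a / 2) (b / 2)) ≤ b / 2 := (min_le_right _ _).trans (min_le_right _ _)
  refine ⟨min (1 / 4) (min (a / 2) (b / 2)), by positivity, fun k1 k2 k3 k4 =>
    ⟨min_le_left _ _, a, by linarith, h1 k1 k2 k3 k4⟩, fun k ε hε hεl => h2 k ε hε ?_⟩
  linarith

end PhaseTransition

/-! ### The fundamental estimate. -/

theorem mainTheorem6 (n : ℕ) (hn : 1 ≤ n) (W : ℝ → ℝ) (hW : IsDoubleWell W) :
    -- the threshold constant exists
    (∃ qs : ℝ, IsThreshold n W qs) ∧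
    -- and the fundamental estimate holds for each such constant
    ∀ qs : ℝ, IsThreshold n W qs → ∀ q : ℝ, 0 < q → q < qs / n →
    -- the bound on `ε` depends on `q`, `A`, `A'`, `B` only
    ∃ ε₀ : Set (E n) → Set (E n) → Set (E n) → ℝ, (∀ A A' B, 0 < ε₀ A A' B) ∧
    ∀ c₁ c₂ : ℝ, 0 < c₁ → c₁ ≤ c₂ →
    -- the constant depends on `c₁`, `c₂`, `W`, `q`, `A`, `A'` only
    ∃ C : Set (E n) → Set (E n) → ℝ, (∀ A A', 0 < C A A') ∧
    ∀ f : ℝ → E n → ℝ → E n → Mat n → ℝ, (∀ ε, 0 < ε → IsDensity W c₁ c₂ q (f ε)) →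
    -- the error functional
    ∃ err : ℝ → (E n → ℝ) → (E n → ℝ) → Set (E n) → Set (E n) → ℝ≥0,
      -- it depends on the functions only through their a.e. classes on `A' \ closure A`
      (∀ (ε : ℝ) (A A' : Set (E n)) (u u' v v' : E n → ℝ),
        u =ᵐ[volume.restrict (A' \ closure A)] u' → v =ᵐ[volume.restrict (A' \ closure A)] v' →
        err ε u v A A' = err ε u' v' A A') ∧
      ∀ A A' B : Set (E n), IsC1Domain A → IsC1Domain A' → IsC1Domain B →
        closure A ⊆ A' → A' \ closure A ⊆ B →
      ∀ u v : ℝ → E n → ℝ, (∀ ε, 0 < ε → MemW22 A' (u ε)) → (∀ ε, 0 < ε → MemW22 B (v ε)) →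
        -- the interpolation and the estimate
        (∃ w : ℝ → E n → ℝ, ∀ ε, 0 < ε → ε ≤ ε₀ A A' B →
          MemW22 (A ∪ B) (w ε) ∧
          IsCutoffInterpolation A A' B (u ε) (v ε) (w ε) ∧
          (∀ᵐ x ∂(volume.restrict A), w ε x = u ε x) ∧
          (∀ᵐ x ∂(volume.restrict (B \ closure A')), w ε x = v ε x) ∧
          energy (f ε) ε (w ε) (A ∪ B) ≤ energy (f ε) ε (u ε) A' + energy (f ε) ε (v ε) B
            + ((err ε (u ε) (v ε) A A' : ℝ) : EReal)) ∧
        -- the bound on the error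
        (∀ ε, 0 < ε → ε ≤ ε₀ A A' B → ∀ T : Set (E n), NullMeasurableSet T volume →
          T ⊆ A' \ closure A → (∀ᵐ x ∂(volume.restrict T), u ε x = v ε x) →
          ((err ε (u ε) (v ε) A A' : ℝ) : EReal) ≤
            ((C A A' * (volume ((A' \ closure A) \ T)).toReal : ℝ) : EReal)
            + ((C A A' * ∫ x in (A' \ closure A) \ T, |u ε x - v ε x| ^ 2 : ℝ) : EReal)
            + ((C A A' * ε : ℝ) : EReal) *
              (Mminus W q ε (u ε) (A' \ closure A) + Mminus W q ε (v ε) (A' \ closure A))) ∧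
        -- the error vanishes in the limit
        ((∃ K : ℝ, ∀ᶠ ε in 𝓝[>] (0 : ℝ),
            energy (f ε) ε (u ε) (A' \ closure A) + energy (f ε) ε (v ε) (A' \ closure A)
              ≤ (K : EReal)) →
          Tendsto (fun ε => eLpNorm (fun x => u ε x - v ε x) 2
            (volume.restrict (A' \ closure A))) (𝓝[>] 0) (𝓝 0) →
          Tendsto (fun ε => err ε (u ε) (v ε) A A') (𝓝[>] 0) (𝓝 0)) := by
  refine ⟨exists_isThreshold hn hW, fun qs hqs q hq hqq => ?_⟩
  -- The room between `q` and `q'` is what makes the functional with `q` coercive on `A' \ closure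
  -- A`.
  obtain ⟨q', hq1, hq2⟩ := exists_between hqq
  obtain ⟨c₀, hc₀, hmono⟩ := hW.almost_mono
  -- These choices precede `c₁`, `c₂` and `f`, as the asserted dependence of `ε₀` and of the
  -- constant requires.
  choose η K hK hηK using fun A A' : Set (E n) => exists_profile_bound A A'
  choose ε₀ hε₀ hlev hthr using fun A A' B : Set (E n) => hqs.exists_eps hqq hq2 A A' B (η A A')
  refine ⟨ε₀, hε₀, fun c₁ c₂ hc₁ hc₁₂ => ?_⟩
  have hc₂ : 0 < c₂ := hc₁.trans_le hc₁₂
  have hF : ∀ A A', 0 < 8 * layerFactor n c₁ c₂ q (K A A') := fun A A' =>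
    mul_pos (by norm_num) (layerFactor_pos n hc₁ hc₂ hq _)
  have hκ := one_le_coercFactor hq hq1
  refine ⟨fun A A' => 8 * layerFactor n c₁ c₂ q (K A A') * ((c₀ + 1) * coercFactor q q'),
    fun A A' => mul_pos (hF A A') (mul_pos (by linarith) (by linarith)), fun f hf => ?_⟩
  refine ⟨fun ε u v A A' => layerError W (8 * layerFactor n c₁ c₂ q (K A A')) ε u v A A',
    fun ε A A' u u' v v' hu hv => layerError_congr_ae hu hv, ?_⟩
  intro A A' B hA hA' hB hsub hAB u v hu hv
  obtain ⟨hη, hb⟩ := hηK A A' hA'.isOpen hA'.isBounded hsub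
  obtain ⟨hε4, δ, hδ, hT⟩ := hlev A A' B hη hA' hB hAB
  have hSC := hA.diff_closure hA' hsub
  have hM := hthr A A' B hSC
  have hfin : volume (A' \ closure A) ≠ ⊤ := hSC.isBounded.measure_lt_top.ne
  have huS : ∀ ε, 0 < ε → MemW22 (A' \ closure A) (u ε) := fun ε hε => by
    obtain ⟨G, H, h⟩ := hu ε hε
    exact (h.mono sdiff_subset).memW22
  have hvS : ∀ ε, 0 < ε → MemW22 (A' \ closure A) (v ε) := fun ε hε => by
    obtain ⟨G, H, h⟩ := hv ε hε
    exact (h.mono hAB).memW22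
  have herr : ∀ ε, (layerError W (8 * layerFactor n c₁ c₂ q (K A A')) ε (u ε) (v ε) A A' : ℝ) =
      8 * layerFactor n c₁ c₂ q (K A A') * layerInt W ε (u ε) (v ε) (A' \ closure A) :=
    fun ε => coe_layerError hW (hF A A').le hSC.isOpen _ _
  refine ⟨?_, fun ε hε hεl T hTm hTS huv => ?_, ?_⟩
  · have hex : ∀ ε, ∃ w : E n → ℝ, 0 < ε → ε ≤ ε₀ A A' B →
        MemW22 (A ∪ B) w ∧ IsCutoffInterpolation A A' B (u ε) (v ε) w ∧
        (∀ x ∈ A, w x = u ε x) ∧ (∀ x, x ∉ A' → w x = v ε x) ∧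
        energy (f ε) ε w (A ∪ B) ≤ energy (f ε) ε (u ε) A' + energy (f ε) ε (v ε) B +
          ((8 * layerFactor n c₁ c₂ q (K A A') *
            layerInt W ε (u ε) (v ε) (A' \ closure A) : ℝ) : EReal) := fun ε => by
      by_cases h : 0 < ε ∧ ε ≤ ε₀ A A' B
      · obtain ⟨w, hw⟩ := hη.exists_interp hn hA hA' hB hAB hW hc₁ hc₂.le hq (hf ε h.1) (hK A A') hb
          hT h.1 (h.2.trans hε4) (h.2.trans_lt hδ) (hu ε h.1) (hv ε h.1)
        exact ⟨w, fun _ _ => hw⟩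
      · exact ⟨0, fun h1 h2 => absurd ⟨h1, h2⟩ h⟩
    choose w hw using hex
    refine ⟨w, fun ε hε hεl => ?_⟩
    obtain ⟨w1, w2, w3, w4, w5⟩ := hw ε hε hεl
    refine ⟨w1, w2, ?_, ?_, ?_⟩
    · filter_upwards [ae_restrict_mem hA.isOpen.measurableSet] with x hx using w3 x hx
    · filter_upwards [ae_restrict_mem (hB.isOpen.sdiff isClosed_closure).measurableSet] with x hx
      exact w4 x fun h => hx.2 (subset_closure h)
    · rw [herr]
      exact w5
  · rw [herr]
    exact layerInt_le_Mminus hSC.isOpen hfin hW hc₀ hmono hq hq1 hε (hM ε hε hεl) (huS ε hε)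
      (hvS ε hε) hTm huv (hF A A')
  · rintro ⟨k, hk⟩ hlim
    have hMe : ∀ᶠ ε in 𝓝[>] (0 : ℝ), ∀ g, MemW22 (A' \ closure A) g →
        0 ≤ Mminus W q' ε g (A' \ closure A) := by
      filter_upwards [Ioc_mem_nhdsGT (hε₀ A A' B)] with ε hε using hM ε hε.1 hε.2
    have hlay := (tendsto_layerInt hSC.isOpen hfin hW hc₁ hq hq1 hf huS hvS hMe hk hlim).const_mul
      (8 * layerFactor n c₁ c₂ q (K A A'))
    rw [← NNReal.tendsto_coe]
    simpa only [herr, mul_zero, NNReal.coe_zero] using hlay
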